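/- All Lie algebras are real and finite dimensional. A Lie algebra $\mathfrak g$ with an inner product $\langle\,,\rangle$ of signature $(-,+,\dots,+)$ is \emph{Lorentzian}. Its Levi-Civita product is defined by $2\langle uv,w\rangle=\langle[u,v],w\rangle+\langle[w,u],v\rangle+\langle[w,v],u\rangle$; with $\mathrm L_uv=uv$, $(\mathfrak g,\langle\,,\rangle)$ is \emph{flat} if $\mathrm L_{[u,v]}=[\mathrm L_u,\mathrm L_v]$ for all $u,v$. The center $Z(\mathfrak g)$ is \emph{degenerate} if $Z(\mathfrak g)\cap Z(\mathfrak g)^\perp\neq\{0\}$. **Theorem.** Let $\mathfrak g$ be a Lie algebra of dimension at most $6$ with a bilinear form $\langle\,,\rangle$. Then $(\mathfrak g,\langle\,,\rangle)$ is a Lorentzian flat Lie algebra with degenerate center if and only if $\mathfrak g$ has a basis $(z,\bar z,e_1,\dots,e_{n-2})$, $3\le n\le 6$, in which the brackets and the form are those of one of the entries below. Moreover each entry, for all its parameter values, does define a Lie algebra, and this Lie algebra has the stated nature ("$k$-nilpotent": nilpotent of class exactly $k$; "$k$-solvable": solvable of derived length exactly $k$). Brackets of basis vectors, and (up to symmetry)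 products of basis vectors, that are not listed vanish. Parameters are real, with no restriction other than those shown. *Dimension 3.* 1. $[\bar z,e_1]=z$; $\langle z,\bar z\rangle=\alpha$, $\langle e_1,e_1\rangle=1$; $\alpha>0$. Heisenberg. *Dimension 4.* 2. $[\bar z,e_1]=z$; $\langle z,\bar z\rangle=\alpha$, $\langle e_1,e_1\rangle=1$, $\langle e_1,e_2\rangle=a$, $\langle e_2,e_2\rangle=1+a^2$; $\alpha>0$. 2-nilpotent. 3. $[\bar z,e_1]=az$, $[\bar z,e_2]=e_1$, $[e_1,e_2]=-z$; $\langle z,\bar z\rangle=\langle e_1,e_1\rangle=\alpha$, $\langle\bar z,e_1\rangle=\beta$, $\langle e_2,e_2\rangle=1$; $\alpha>0$. 3-nilpotent. 4. $[\bar z,e_1]=e_2$, $[\bar z,e_2]=-e_1$; $\langle z,\bar z\rangle=\alpha^{-1}$, $\langle\bar z,e_1\rangle=\beta$, $\langle\bar z,e_2\rangle=\gamma$, $\langle e_1,e_1\rangle=\langle e_2,e_2\rangle=\alpha^2$; $\alpha\ne0$. 2-solvable. *Dimension 5.* 5. $[\bar z,e_1]=z$; $\langle z,\bar z\rangle=\alpha$,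 $\langle e_1,e_1\rangle=1$, $\langle e_1,e_2\rangle=a$, $\langle e_1,e_3\rangle=b$, $\langle e_2,e_2\rangle=1+a^2$, $\langle e_2,e_3\rangle=ab$, $\langle e_3,e_3\rangle=1+b^2$; $\alpha>0$. 2-nilpotent. 6. $[\bar z,e_1]=az$, $[\bar z,e_2]=bz$, $[\bar z,e_3]=e_1$, $[e_1,e_3]=-z$, $[e_2,e_3]=-cz$; $\langle z,\bar z\rangle=\langle e_1,e_1\rangle=\alpha$, $\langle\bar z,e_1\rangle=\beta$, $\langle e_1,e_2\rangle=c\alpha$, $\langle e_2,e_2\rangle=\langle e_3,e_3\rangle=1$; $\alpha>0$, $\alpha c^2<1$. 3-nilpotent. 7. $[\bar z,e_1]=e_2$, $[\bar z,e_2]=-e_1$, $[\bar z,e_3]=az$; $\langle z,\bar z\rangle=\alpha^{-1}$, $\langle\bar z,e_1\rangle=\beta$, $\langle\bar z,e_2\rangle=\gamma$, $\langle e_1,e_1\rangle=\langle e_2,e_2\rangle=\alpha^2$, $\langle e_3,e_3\rangle=1$; $\alpha>0$. 2-solvable. 8. $[\bar z,e_1]=ae_2+be_3+cz$, $[\bar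 z,e_2]=de_3$, $[\bar z,e_3]=-de_2$, $[e_1,e_2]=e_3$, $[e_1,e_3]=-e_2$; $\langle z,\bar z\rangle=1$, $\langle\bar z,e_2\rangle=-\alpha b$, $\langle\bar z,e_3\rangle=\alpha a$, $\langle e_1,e_1\rangle=\alpha^{-1}$, $\langle e_2,e_2\rangle=\langle e_3,e_3\rangle=\alpha$; $\alpha>0$, $c\ne0$. 2-solvable. *Dimension 6.* 9. $[\bar z,e_1]=z$; $\langle z,\bar z\rangle=\alpha$, $\langle e_1,e_1\rangle=1$, $\langle e_1,e_2\rangle=a$, $\langle e_1,e_3\rangle=b$, $\langle e_1,e_4\rangle=c$, $\langle e_2,e_2\rangle=1+a^2$, $\langle e_2,e_3\rangle=ab$, $\langle e_2,e_4\rangle=ac$, $\langle e_3,e_3\rangle=1+b^2$, $\langle e_3,e_4\rangle=bc$, $\langle e_4,e_4\rangle=1+c^2$; $\alpha>0$. 2-nilpotent. 10. $[\bar z,e_1]=e_2$, $[\bar z,e_2]=-e_1$, $[\bar z,e_3]=ae_4$, $[\bar z,e_4]=-ae_3$; $\langle z,\bar z\rangle=\alpha^{-1}$, $\langle\bar z,e_1\rangle=\beta$,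 $\langle\bar z,e_2\rangle=\gamma$, $\langle\bar z,e_3\rangle=\mu$, $\langle\bar z,e_4\rangle=\nu$, $\langle e_1,e_1\rangle=\langle e_2,e_2\rangle=\alpha^2$, $\langle e_3,e_3\rangle=\langle e_4,e_4\rangle=\alpha^2a^2$; $\alpha\ne0$, $a\neq0$. 2-solvable. 11. $[\bar z,e_1]=e_2$, $[\bar z,e_2]=-e_1$, $[\bar z,e_3]=az$, $[\bar z,e_4]=bz$; $\langle z,\bar z\rangle=\alpha^{-1}$, $\langle\bar z,e_1\rangle=\beta$, $\langle\bar z,e_2\rangle=\gamma$, $\langle e_1,e_1\rangle=\langle e_2,e_2\rangle=\alpha^2$, $\langle e_3,e_3\rangle=\langle e_4,e_4\rangle=1$; $\alpha\ne0$. 2-solvable. 12. With $\mu=\rho_1\rho_2\cos(\omega_1-\omega_2)$: $[\bar z,e_1]=az$, $[\bar z,e_2]=bz$, $[\bar z,e_3]=e_1$, $[\bar z,e_4]=e_2$, $[e_1,e_3]=-\rho_1^2z$, $[e_2,e_4]=-\rho_2^2z$, $[e_1,e_4]=[e_2,e_3]=-\mu z$; $\langle z,\bar z\rangle=1$, $\langle\bar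 z,e_1\rangle=\beta$, $\langle\bar z,e_2\rangle=\gamma$, $\langle e_1,e_1\rangle=\rho_1^2$, $\langle e_1,e_2\rangle=\mu$, $\langle e_2,e_2\rangle=\rho_2^2$, $\langle e_3,e_3\rangle=\langle e_4,e_4\rangle=1$; $\rho_1,\rho_2>0$, $\sin(\omega_1-\omega_2)\ne0$. 2-solvable. 13. $[\bar z,e_1]=az$, $[\bar z,e_2]=bz$, $[\bar z,e_3]=cz$, $[\bar z,e_4]=e_1$, $[e_1,e_4]=-z$, $[e_2,e_4]=-dz$, $[e_3,e_4]=-ez$; $\langle z,\bar z\rangle=\langle e_1,e_1\rangle=\alpha$, $\langle\bar z,e_1\rangle=\beta$, $\langle e_1,e_2\rangle=\alpha d$, $\langle e_1,e_3\rangle=\alpha e$, $\langle e_2,e_2\rangle=\langle e_3,e_3\rangle=\langle e_4,e_4\rangle=1$; $\alpha>0$, $\alpha(d^2+e^2)<1$. 3-nilpotent. 14. $[\bar z,e_1]=e_2$, $[\bar z,e_2]=-e_1$, $[\bar z,e_3]=az$, $[\bar z,e_4]=e_3$, $[e_3,e_4]=-z$; $\langle z,\bar z\rangle=\langle e_3,e_3\rangle=\alpha$,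 $\langle\bar z,e_1\rangle=\gamma$, $\langle\bar z,e_2\rangle=\mu$, $\langle\bar z,e_3\rangle=\nu$, $\langle e_1,e_1\rangle=\langle e_2,e_2\rangle=\langle e_4,e_4\rangle=\beta$; $\alpha,\beta>0$. 2-solvable. 15. With $X=\rho\cos\omega$, $Y=\rho\sin\omega$: $[\bar z,e_1]=e_2$, $[\bar z,e_2]=-e_1$, $[\bar z,e_3]=Xe_1+Ye_2+e_4$, $[\bar z,e_4]=-Ye_1+Xe_2-e_3$, $[e_1,e_3]=[e_2,e_4]=-Xz$, $[e_1,e_4]=Yz$, $[e_2,e_3]=-Yz$, $[e_3,e_4]=2\rho^2z$; $\langle z,\bar z\rangle=1$, $\langle\bar z,e_1\rangle=\alpha$, $\langle\bar z,e_2\rangle=\beta$, $\langle\bar z,e_3\rangle=\gamma$, $\langle\bar z,e_4\rangle=\mu$, $\langle e_1,e_1\rangle=\langle e_2,e_2\rangle=1$, $\langle e_1,e_3\rangle=\langle e_2,e_4\rangle=Y$, $\langle e_1,e_4\rangle=X$, $\langle e_2,e_3\rangle=-X$, $\langle e_3,e_3\rangle=\langle e_4,e_4\rangle=1+\rho^2$;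 $\rho>0$. 3-solvable. 16. $[\bar z,e_1]=ae_2+be_3+ce_4+dz$, $[\bar z,e_2]=ez$, $[\bar z,e_3]=fe_4$, $[\bar z,e_4]=-fe_3$, $[e_1,e_2]=az$, $[e_1,e_3]=e_4$, $[e_1,e_4]=-e_3$; $\langle z,\bar z\rangle=\langle e_2,e_2\rangle=\alpha$, $\langle\bar z,e_3\rangle=-c$, $\langle\bar z,e_4\rangle=b$, $\langle e_1,e_1\rangle=\beta$, $\langle e_1,e_2\rangle=\gamma$, $\langle e_3,e_3\rangle=\langle e_4,e_4\rangle=1$; $\alpha,\beta>0$, $\alpha\beta-\gamma^2=1$, $(a,d,e)\neq(0,0,0)$. 2-solvable. -/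

import Mathlib

/-- A metric of signature `(-, +, ..., +)`: in some basis the Gram matrix is `diag(-1, 1, ..., 1)`.
In particular such a form is symmetric and nondegenerate. -/
def IsLorentzian {g : Type*} [AddCommGroup g] [Module ℝ g]
    (B : LinearMap.BilinForm ℝ g) : Prop :=
  ∃ (m : ℕ) (b : Module.Basis (Fin (m + 1)) ℝ g),
    ∀ i j, B (b i) (b j) = if i = j then (if i = 0 then -1 else 1) else 0

/-- `L` is the Levi-Civita product `u v = L u v` of the metric `B`, given by the Koszul formula
`2⟨uv, w⟩ = ⟨[u,v], w⟩ + ⟨[w,u], v⟩ + ⟨[w,v], u⟩`.  For nondegenerate `B` there is exactly one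
such `L`. -/
def IsLeviCivitaProduct {g : Type*} [LieRing g] [LieAlgebra ℝ g]
    (B : LinearMap.BilinForm ℝ g) (L : g →ₗ[ℝ] Module.End ℝ g) : Prop :=
  ∀ u v w : g, 2 * B (L u v) w = B ⁅u, v⁆ w + B ⁅w, u⁆ v + B ⁅w, v⁆ u

/-- The metric is flat: the curvature `K(u,v) = L_{[u,v]} - [L_u, L_v]` of its Levi-Civita product
vanishes identically. -/
def IsFlatMetric {g : Type*} [LieRing g] [LieAlgebra ℝ g]
    (B : LinearMap.BilinForm ℝ g) : Prop :=
  ∃ L : g →ₗ[ℝ] Module.End ℝ g, IsLeviCivitaProduct B L ∧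
    ∀ u v : g, L ⁅u, v⁆ - (L u * L v - L v * L u) = 0

/-- The center is degenerate: the metric restricted to the center has a nonzero radical. -/
def HasDegenerateCenter {g : Type*} [LieRing g] [LieAlgebra ℝ g]
    (B : LinearMap.BilinForm ℝ g) : Prop :=
  ∃ z ∈ LieAlgebra.center ℝ g, z ≠ 0 ∧ ∀ w ∈ LieAlgebra.center ℝ g, B z w = 0

/-- The entries of the column "Nature". -/
inductive Nature : Type where
  | heisenberg : Nature
  | nilpotent (k : ℕ) : Nature
  | solvable (k : ℕ) : Nature

/-- The Lie algebra `g` is of the stated nature: the three-dimensional Heisenberg algebra,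
nilpotent of class exactly `k`, or solvable of derived length exactly `k`. -/
def Nature.Holds (g : Type*) [LieRing g] [LieAlgebra ℝ g] : Nature → Prop
  | .heisenberg => ∃ b : Module.Basis (Fin 3) ℝ g,
      ⁅b 0, b 1⁆ = b 2 ∧ ⁅b 0, b 2⁆ = 0 ∧ ⁅b 1, b 2⁆ = 0
  | .nilpotent k => LieRing.IsNilpotent g ∧ LieModule.nilpotencyLength g g = k
  | .solvable k => LieAlgebra.IsSolvable g ∧ LieAlgebra.derivedLength ℝ g = k

/-- One entry of the tables in dimension `n`.  The basis is ordered `z, z̄, e₁, ..., e_{n-2}`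
(indices `0, 1, 2, ..., n-1`).  A triple `(i, j, v)` in `brackets` says that the bracket of the
`i`-th and the `j`-th basis vector has coordinate vector `v`. -/
structure Entry (n : ℕ) where
  brackets : List (Fin n × Fin n × (Fin n → ℝ))
  gram : Matrix (Fin n) (Fin n) ℝ
  nature : Nature

/-- The structure constants given by the list of non-vanishing brackets: coordinates of
the bracket of the `i`-th and `j`-th basis vectors, extended by antisymmetry and by zero. -/
def Entry.structureConst {n : ℕ} (E : Entry n) (i j : Fin n) : Fin n → ℝ :=
  (E.brackets.map fun t =>
    (if t.1 = i ∧ t.2.1 = j then t.2.2 else 0) - (if t.1 = j ∧ t.2.1 = i then t.2.2 else 0)).sum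

/-- In the basis `b`, the Lie bracket of `g` and the metric `B` are those of the entry `E`. -/
def Entry.Realizes {n : ℕ} (E : Entry n) {g : Type*} [LieRing g] [LieAlgebra ℝ g]
    (B : LinearMap.BilinForm ℝ g) (b : Module.Basis (Fin n) ℝ g) : Prop :=
  (∀ i j, ⁅b i, b j⁆ = ∑ k, E.structureConst i j k • b k) ∧
    ∀ i j, B (b i) (b j) = E.gram i j

/-- The tables: all the entries, in dimensions three to six, with their parameters. -/
inductive IsListed : (n : ℕ) → Entry n → Prop
  | dim3 (α : ℝ) (hα : 0 < α) : IsListed 3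
      { brackets := [(1, 2, ![1, 0, 0])]
        gram := !![0, α, 0;
                   α, 0, 0;
                   0, 0, 1]
        nature := .heisenberg }
  | dim4_a (α a : ℝ) (hα : 0 < α) : IsListed 4
      { brackets := [(1, 2, ![1, 0, 0, 0])]
        gram := !![0, α, 0, 0;
                   α, 0, 0, 0;
                   0, 0, 1, a;
                   0, 0, a, 1 + a ^ 2]
        nature := .nilpotent 2 }
  | dim4_b (α β a : ℝ) (hα : 0 < α) : IsListed 4
      { brackets := [(1, 2, ![a, 0, 0, 0]), (1, 3, ![0, 0, 1, 0]), (2, 3, ![-1, 0, 0, 0])]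
        gram := !![0, α, 0, 0;
                   α, 0, β, 0;
                   0, β, α, 0;
                   0, 0, 0, 1]
        nature := .nilpotent 3 }
  | dim4_c (α β γ : ℝ) (hα : α ≠ 0) : IsListed 4
      { brackets := [(1, 2, ![0, 0, 0, 1]), (1, 3, ![0, 0, -1, 0])]
        gram := !![0, α⁻¹, 0, 0;
                   α⁻¹, 0, β, γ;
                   0, β, α ^ 2, 0;
                   0, γ, 0, α ^ 2]
        nature := .solvable 2 }
  | dim5_a (α a b : ℝ) (hα : 0 < α) : IsListed 5
      { brackets := [(1, 2, ![1, 0, 0, 0, 0])]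
        gram := !![0, α, 0, 0, 0;
                   α, 0, 0, 0, 0;
                   0, 0, 1, a, b;
                   0, 0, a, 1 + a ^ 2, a * b;
                   0, 0, b, a * b, 1 + b ^ 2]
        nature := .nilpotent 2 }
  | dim5_b (α β a b c : ℝ) (hα : 0 < α) (hc : α * c ^ 2 < 1) : IsListed 5
      { brackets := [(1, 2, ![a, 0, 0, 0, 0]), (1, 3, ![b, 0, 0, 0, 0]),
          (1, 4, ![0, 0, 1, 0, 0]), (2, 4, ![-1, 0, 0, 0, 0]), (3, 4, ![-c, 0, 0, 0, 0])]
        gram := !![0, α, 0, 0, 0;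
                   α, 0, β, 0, 0;
                   0, β, α, c * α, 0;
                   0, 0, c * α, 1, 0;
                   0, 0, 0, 0, 1]
        nature := .nilpotent 3 }
  | dim5_c (α β γ a : ℝ) (hα : 0 < α) : IsListed 5
      { brackets := [(1, 2, ![0, 0, 0, 1, 0]), (1, 3, ![0, 0, -1, 0, 0]),
          (1, 4, ![a, 0, 0, 0, 0])]
        gram := !![0, α⁻¹, 0, 0, 0;
                   α⁻¹, 0, β, γ, 0;
                   0, β, α ^ 2, 0, 0;
                   0, γ, 0, α ^ 2, 0;
                   0, 0, 0, 0, 1]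
        nature := .solvable 2 }
  | dim5_d (α a b c d : ℝ) (hα : 0 < α) (hc : c ≠ 0) : IsListed 5
      { brackets := [(1, 2, ![c, 0, 0, a, b]), (1, 3, ![0, 0, 0, 0, d]),
          (1, 4, ![0, 0, 0, -d, 0]), (2, 3, ![0, 0, 0, 0, 1]), (2, 4, ![0, 0, 0, -1, 0])]
        gram := !![0, 1, 0, 0, 0;
                   1, 0, 0, -(α * b), α * a;
                   0, 0, α⁻¹, 0, 0;
                   0, -(α * b), 0, α, 0;
                   0, α * a, 0, 0, α]
        nature := .solvable 2 }
  | dim6_a (α a b c : ℝ) (hα : 0 < α) : IsListed 6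
      { brackets := [(1, 2, ![1, 0, 0, 0, 0, 0])]
        gram := !![0, α, 0, 0, 0, 0;
                   α, 0, 0, 0, 0, 0;
                   0, 0, 1, a, b, c;
                   0, 0, a, 1 + a ^ 2, a * b, a * c;
                   0, 0, b, a * b, 1 + b ^ 2, b * c;
                   0, 0, c, a * c, b * c, 1 + c ^ 2]
        nature := .nilpotent 2 }
  | dim6_b (α β γ μ ν a : ℝ) (hα : α ≠ 0) (ha : a ≠ 0) : IsListed 6
      { brackets := [(1, 2, ![0, 0, 0, 1, 0, 0]), (1, 3, ![0, 0, -1, 0, 0, 0]),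
          (1, 4, ![0, 0, 0, 0, 0, a]), (1, 5, ![0, 0, 0, 0, -a, 0])]
        gram := !![0, α⁻¹, 0, 0, 0, 0;
                   α⁻¹, 0, β, γ, μ, ν;
                   0, β, α ^ 2, 0, 0, 0;
                   0, γ, 0, α ^ 2, 0, 0;
                   0, μ, 0, 0, α ^ 2 * a ^ 2, 0;
                   0, ν, 0, 0, 0, α ^ 2 * a ^ 2]
        nature := .solvable 2 }
  | dim6_c (α β γ a b : ℝ) (hα : α ≠ 0) : IsListed 6
      { brackets := [(1, 2, ![0, 0, 0, 1, 0, 0]), (1, 3, ![0, 0, -1, 0, 0, 0]),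
          (1, 4, ![a, 0, 0, 0, 0, 0]), (1, 5, ![b, 0, 0, 0, 0, 0])]
        gram := !![0, α⁻¹, 0, 0, 0, 0;
                   α⁻¹, 0, β, γ, 0, 0;
                   0, β, α ^ 2, 0, 0, 0;
                   0, γ, 0, α ^ 2, 0, 0;
                   0, 0, 0, 0, 1, 0;
                   0, 0, 0, 0, 0, 1]
        nature := .solvable 2 }
  | dim6_d (ρ₁ ρ₂ ω₁ ω₂ μ β γ a b : ℝ) (hρ₁ : 0 < ρ₁) (hρ₂ : 0 < ρ₂)
      (hω : Real.sin (ω₁ - ω₂) ≠ 0) (hμ : μ = ρ₁ * ρ₂ * Real.cos (ω₁ - ω₂)) : IsListed 6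
      { brackets := [(1, 2, ![a, 0, 0, 0, 0, 0]), (1, 3, ![b, 0, 0, 0, 0, 0]),
          (1, 4, ![0, 0, 1, 0, 0, 0]), (1, 5, ![0, 0, 0, 1, 0, 0]),
          (2, 4, ![-ρ₁ ^ 2, 0, 0, 0, 0, 0]), (3, 5, ![-ρ₂ ^ 2, 0, 0, 0, 0, 0]),
          (2, 5, ![-μ, 0, 0, 0, 0, 0]), (3, 4, ![-μ, 0, 0, 0, 0, 0])]
        gram := !![0, 1, 0, 0, 0, 0;
                   1, 0, β, γ, 0, 0;
                   0, β, ρ₁ ^ 2, μ, 0, 0;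
                   0, γ, μ, ρ₂ ^ 2, 0, 0;
                   0, 0, 0, 0, 1, 0;
                   0, 0, 0, 0, 0, 1]
        nature := .solvable 2 }
  | dim6_e (α β a b c d e : ℝ) (hα : 0 < α) (hde : α * (d ^ 2 + e ^ 2) < 1) : IsListed 6
      { brackets := [(1, 2, ![a, 0, 0, 0, 0, 0]), (1, 3, ![b, 0, 0, 0, 0, 0]),
          (1, 4, ![c, 0, 0, 0, 0, 0]), (1, 5, ![0, 0, 1, 0, 0, 0]),
          (2, 5, ![-1, 0, 0, 0, 0, 0]), (3, 5, ![-d, 0, 0, 0, 0, 0]),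
          (4, 5, ![-e, 0, 0, 0, 0, 0])]
        gram := !![0, α, 0, 0, 0, 0;
                   α, 0, β, 0, 0, 0;
                   0, β, α, α * d, α * e, 0;
                   0, 0, α * d, 1, 0, 0;
                   0, 0, α * e, 0, 1, 0;
                   0, 0, 0, 0, 0, 1]
        nature := .nilpotent 3 }
  | dim6_f (α β γ μ ν a : ℝ) (hα : 0 < α) (hβ : 0 < β) : IsListed 6
      { brackets := [(1, 2, ![0, 0, 0, 1, 0, 0]), (1, 3, ![0, 0, -1, 0, 0, 0]),
          (1, 4, ![a, 0, 0, 0, 0, 0]), (1, 5, ![0, 0, 0, 0, 1, 0]),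
          (4, 5, ![-1, 0, 0, 0, 0, 0])]
        gram := !![0, α, 0, 0, 0, 0;
                   α, 0, γ, μ, ν, 0;
                   0, γ, β, 0, 0, 0;
                   0, μ, 0, β, 0, 0;
                   0, ν, 0, 0, α, 0;
                   0, 0, 0, 0, 0, β]
        nature := .solvable 2 }
  | dim6_g (ρ ω X Y α β γ μ : ℝ) (hρ : 0 < ρ) (hX : X = ρ * Real.cos ω)
      (hY : Y = ρ * Real.sin ω) : IsListed 6
      { brackets := [(1, 2, ![0, 0, 0, 1, 0, 0]), (1, 3, ![0, 0, -1, 0, 0, 0]),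
          (1, 4, ![0, 0, X, Y, 0, 1]), (1, 5, ![0, 0, -Y, X, -1, 0]),
          (2, 4, ![-X, 0, 0, 0, 0, 0]), (2, 5, ![Y, 0, 0, 0, 0, 0]),
          (3, 4, ![-Y, 0, 0, 0, 0, 0]), (3, 5, ![-X, 0, 0, 0, 0, 0]),
          (4, 5, ![2 * ρ ^ 2, 0, 0, 0, 0, 0])]
        gram := !![0, 1, 0, 0, 0, 0;
                   1, 0, α, β, γ, μ;
                   0, α, 1, 0, Y, X;
                   0, β, 0, 1, -X, Y;
                   0, γ, Y, -X, 1 + ρ ^ 2, 0;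
                   0, μ, X, Y, 0, 1 + ρ ^ 2]
        nature := .solvable 3 }
  | dim6_h (α β γ a b c d e f : ℝ) (hα : 0 < α) (hβ : 0 < β) (hγ : α * β - γ ^ 2 = 1)
      (hade : (a, d, e) ≠ (0, 0, 0)) : IsListed 6
      { brackets := [(1, 2, ![d, 0, 0, a, b, c]), (1, 3, ![e, 0, 0, 0, 0, 0]),
          (1, 4, ![0, 0, 0, 0, 0, f]), (1, 5, ![0, 0, 0, 0, -f, 0]),
          (2, 3, ![a, 0, 0, 0, 0, 0]), (2, 4, ![0, 0, 0, 0, 0, 1]),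
          (2, 5, ![0, 0, 0, 0, -1, 0])]
        gram := !![0, α, 0, 0, 0, 0;
                   α, 0, 0, 0, -c, b;
                   0, 0, β, γ, 0, 0;
                   0, 0, γ, α, 0, 0;
                   0, -c, 0, 0, 1, 0;
                   0, b, 0, 0, 0, 1]
        nature := .solvable 2 }

/-!
Let `g` be flat and Lorentzian, and let `z` be a nonzero vector in the radical of the form on the
center; then `z` is null. Left multiplications by central elements vanish
(`IsLeviCivitaProduct.eq_zero_of_central`), and the subspaces spanned by `z` and orthogonal to `z`
are ideals for the Levi-Civita product. Hence `g` is a double extension `ℝ z ⊕ ℝ z̄ ⊕ V` of a flat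
Euclidean Lie algebra `V` of dimension at most four. It is described by the product `P` of `V`, a
skew operator `A`, an operator `ξ` and a vector `b₀`; the flatness of `g` amounts to a few
identities between them, recorded in `FlatExtension` (`exists_flatExtension`). As `z` is
orthogonal to the center, no central element has a component along `z̄`.

The product of a flat Euclidean Lie algebra vanishes on commutators in its first argument
(`IsFlatEuclidean.apply_commutator`). In dimension at most four this leaves two possibilities
(`IsFlatEuclidean.eq_zero_or_exists`): either `P = 0`, or a single direction `s` acts, by
rotations of a plane orthogonal to it.

If `P = 0`, the identities reduce to `[A, ξ] = -ξ²`. Since `A` is skew, this forces `ξ² = 0`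
(`sq_eq_zero_of_commutator_eq_neg_sq`), so that `A` and `ξ` commute, and the normal forms of the
pair are found according to the rank of `ξ`, which is zero, one or two
(`IsFlatFrame.hasListedBasis_of_abelian`). If `P ≠ 0`, the identities determine `A` up to the
angle of a rotation of the same plane, and leave in `ξ` and `b₀` only a few free parameters; these
cannot all vanish, as otherwise there is a central element with a component along `z̄`
(`IsFlatFrame.hasListedBasis_of_nonabelian`). In each case an explicit basis identifies `g` with
an entry of the list.

Conversely, for each entry the Levi-Civita product is written down as a multiplication table
(`IsListed.exists_isFlatTable`). Checking that it is torsion-free, skew and flat involves only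
polynomial identities between structure constants, and the Jacobi identity follows, being the
Bianchi identity of a flat torsion-free product (`Entry.IsFlatTable.jacobi`). So each entry is
realized by a flat metric Lie algebra. The signature and the degeneracy of the center are visible
from the Gram matrix, in which `z` is null and its orthogonal complement is positive semidefinite
with radical `ℝ z`, and from the brackets with `z̄` (`IsListed.hasCenterAt`); the nilpotency class
or derived length is computed in coordinates (`IsListed.natureTest`).
-/

open Module

/-! ### Products given by tables of structure constants -/

/-- The bilinear product on `ℝⁿ` given by a multiplication table: a triple `(i, j, v)` says that the
product of the `i`-th and the `j`-th standard basis vector is `v`; unlisted products vanish. -/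
noncomputable def tableMul {n : ℕ} (l : List (Fin n × Fin n × (Fin n → ℝ))) :
    (Fin n → ℝ) →ₗ[ℝ] (Fin n → ℝ) →ₗ[ℝ] (Fin n → ℝ) :=
  (l.map fun t => LinearMap.mk₂ ℝ (fun x y : Fin n → ℝ => (x t.1 * y t.2.1) • t.2.2)
    (fun x x' y => by rw [Pi.add_apply, add_mul, add_smul])
    (fun c x y => by rw [Pi.smul_apply, smul_eq_mul, mul_assoc, mul_smul])
    (fun x y y' => by rw [Pi.add_apply, mul_add, add_smul])
    (fun c x y => by rw [Pi.smul_apply, smul_eq_mul, mul_left_comm, mul_smul])).sum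

theorem tableMul_nil {n : ℕ} (x y : Fin n → ℝ) : tableMul [] x y = 0 := rfl

theorem tableMul_cons {n : ℕ} (t : Fin n × Fin n × (Fin n → ℝ))
    (l : List (Fin n × Fin n × (Fin n → ℝ))) (x y : Fin n → ℝ) :
    tableMul (t :: l) x y = (x t.1 * y t.2.1) • t.2.2 + tableMul l x y := by
  simp [tableMul]

/-- The bracket of an entry, in coordinates. -/
noncomputable def Entry.bracket {n : ℕ} (E : Entry n) :
    (Fin n → ℝ) →ₗ[ℝ] (Fin n → ℝ) →ₗ[ℝ] (Fin n → ℝ) :=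
  tableMul E.brackets - (tableMul E.brackets).flip

theorem Entry.bracket_apply {n : ℕ} (E : Entry n) (x y : Fin n → ℝ) :
    E.bracket x y = tableMul E.brackets x y - tableMul E.brackets y x := rfl

theorem Entry.bracket_swap {n : ℕ} (E : Entry n) (x y : Fin n → ℝ) :
    E.bracket x y = -E.bracket y x := by
  simp [Entry.bracket_apply]

theorem Entry.bracket_single {n : ℕ} (E : Entry n) (i j : Fin n) :
    E.bracket (Pi.single i 1) (Pi.single j 1) = E.structureConst i j := by
  rw [Entry.bracket_apply, Entry.structureConst]
  induction E.brackets with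
  | nil => simp [tableMul_nil]
  | cons t l ih =>
    rw [tableMul_cons, tableMul_cons, List.map_cons, List.sum_cons, ← ih]
    have h : ∀ k m : Fin n, ((Pi.single k (1 : ℝ) : Fin n → ℝ) t.1 *
        (Pi.single m (1 : ℝ) : Fin n → ℝ) t.2.1) • t.2.2 =
        if t.1 = k ∧ t.2.1 = m then t.2.2 else 0 := by
      intro k m
      by_cases h1 : t.1 = k <;> by_cases h2 : t.2.1 = m <;> simp [h1, h2]
    rw [h, h]
    abel

section Coordinates

variable {n : ℕ} {E : Entry n} {g : Type*} [LieRing g] [LieAlgebra ℝ g]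
  {B : LinearMap.BilinForm ℝ g} {b : Basis (Fin n) ℝ g}

theorem Entry.Realizes.equivFun_lie (h : E.Realizes B b) (u v : g) :
    b.equivFun ⁅u, v⁆ = E.bracket (b.equivFun u) (b.equivFun v) := by
  have key : ((LieAlgebra.ad ℝ g : g →ₗ[ℝ] Module.End ℝ g).compr₂ (b.equivFun : g →ₗ[ℝ] _)) =
      E.bracket.compl₁₂ (b.equivFun : g →ₗ[ℝ] _) (b.equivFun : g →ₗ[ℝ] _) := by
    refine b.ext fun i => b.ext fun j => ?_
    have e : ∀ i, b.equivFun (b i) = Pi.single i 1 := fun i => by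
      ext j; simp [Pi.single_apply, eq_comm]
    simp only [LinearMap.compr₂_apply, LinearMap.compl₁₂_apply, LinearEquiv.coe_coe, e,
      Entry.bracket_single]
    have : (LieAlgebra.ad ℝ g : g →ₗ[ℝ] Module.End ℝ g) (b i) (b j) = ⁅b i, b j⁆ := rfl
    rw [this, h.1 i j, ← b.equivFun_symm_apply, LinearEquiv.apply_symm_apply]
  exact LinearMap.congr_fun (LinearMap.congr_fun key u) v

theorem Entry.Realizes.apply_eq (h : E.Realizes B b) (u v : g) :
    B u v = b.equivFun u ⬝ᵥ E.gram.mulVec (b.equivFun v) := by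
  have key : B = (Matrix.toBilin b E.gram) := by
    refine LinearMap.BilinForm.ext_basis b fun i j => ?_
    rw [h.2, ← LinearMap.BilinForm.toMatrix_apply b, LinearMap.BilinForm.toMatrix_toBilin]
  rw [key, Matrix.toBilin_apply]
  simp [dotProduct, Matrix.mulVec, Finset.mul_sum, mul_assoc]

end Coordinates

/-- A multiplication table that makes the entry a flat metric algebra in coordinates: it is
compatible with the Gram matrix, its commutator is the bracket, and its curvature vanishes. -/
structure Entry.IsFlatTable {n : ℕ} (E : Entry n) (l : List (Fin n × Fin n × (Fin n → ℝ))) :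
    Prop where
  skew : ∀ x y, tableMul l x y ⬝ᵥ E.gram.mulVec y = 0
  torsion : ∀ x y, tableMul l x y - tableMul l y x = E.bracket x y
  flat : ∀ x y z, tableMul l (E.bracket x y) z =
    tableMul l x (tableMul l y z) - tableMul l y (tableMul l x z)

/-! ### From a table of Levi-Civita products to a flat metric Lie algebra -/

namespace Entry.IsFlatTable

variable {n : ℕ} {E : Entry n} {l : List (Fin n × Fin n × (Fin n → ℝ))}

theorem bracket_self (x : Fin n → ℝ) : E.bracket x x = 0 := by
  rw [Entry.bracket_apply, sub_self]

/-- The Jacobi identity is the Bianchi identity of a flat torsion-free product. -/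
theorem jacobi (h : E.IsFlatTable l) (x y z : Fin n → ℝ) :
    E.bracket x (E.bracket y z) = E.bracket (E.bracket x y) z + E.bracket y (E.bracket x z) := by
  have h1 := h.flat x y z
  have h2 := h.flat y z x
  have h3 := h.flat x z y
  rw [← h.torsion x (E.bracket y z), ← h.torsion (E.bracket x y) z, ← h.torsion y (E.bracket x z),
    h1, h2, h3, ← h.torsion x y, ← h.torsion y z, ← h.torsion x z]
  simp only [map_sub]
  abel

/-- The Lie ring in coordinates. -/
noncomputable abbrev lieRing (h : E.IsFlatTable l) : LieRing (Fin n → ℝ) where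
  bracket x y := E.bracket x y
  add_lie x y z := by simp
  lie_add x y z := by simp
  lie_self x := bracket_self x
  leibniz_lie x y z := h.jacobi x y z

theorem exists_realizes (h : E.IsFlatTable l) :
    ∃ (g : Type) (_ : LieRing g) (_ : LieAlgebra ℝ g) (B : LinearMap.BilinForm ℝ g)
      (b : Basis (Fin n) ℝ g), E.Realizes B b := by
  let _ : LieRing (Fin n → ℝ) := h.lieRing
  let _ : LieAlgebra ℝ (Fin n → ℝ) :=
    { lie_smul := fun c x y => (E.bracket x).map_smul c y }
  refine ⟨Fin n → ℝ, inferInstance, inferInstance, Matrix.toBilin' E.gram, Pi.basisFun ℝ (Fin n),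
    fun i j => ?_, fun i j => ?_⟩
  · rw [Pi.basisFun_apply, Pi.basisFun_apply]
    change E.bracket _ _ = _
    rw [Entry.bracket_single]
    exact ((Pi.basisFun ℝ (Fin n)).sum_repr (E.structureConst i j)).symm
  · rw [Pi.basisFun_apply, Pi.basisFun_apply, Matrix.toBilin'_single]

end Entry.IsFlatTable

section

variable {g : Type*} [LieRing g] [LieAlgebra ℝ g] {B : LinearMap.BilinForm ℝ g}

/-- The Levi-Civita product is any torsion-free product by skew operators. -/
theorem isLeviCivitaProduct_of_skew {L : g →ₗ[ℝ] Module.End ℝ g}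
    (hs : ∀ u v, B (L u v) v = 0) (ht : ∀ u v, L u v - L v u = ⁅u, v⁆) :
    IsLeviCivitaProduct B L := by
  have hs' : ∀ u v w, B (L u v) w + B (L u w) v = 0 := fun u v w => by
    have := hs u (v + w)
    simp only [map_add, LinearMap.add_apply, hs] at this
    linarith
  intro u v w
  rw [← ht u v, ← ht w u, ← ht w v]
  simp only [map_sub, LinearMap.sub_apply]
  linarith [hs' u v w, hs' v u w, hs' w u v]

theorem Entry.Realizes.isFlatMetric {n : ℕ} {E : Entry n} {l : List (Fin n × Fin n × (Fin n → ℝ))}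
    {b : Basis (Fin n) ℝ g} (h : E.Realizes B b) (hl : E.IsFlatTable l) :
    IsFlatMetric B := by
  let e : g ≃ₗ[ℝ] (Fin n → ℝ) := b.equivFun
  let L : g →ₗ[ℝ] Module.End ℝ g :=
    ((tableMul l).compl₁₂ (e : g →ₗ[ℝ] (Fin n → ℝ)) (e : g →ₗ[ℝ] (Fin n → ℝ))).compr₂
      (e.symm : (Fin n → ℝ) →ₗ[ℝ] g)
  have hL : ∀ u v, e (L u v) = tableMul l (e u) (e v) := fun u v => e.apply_symm_apply _
  refine ⟨L, isLeviCivitaProduct_of_skew (fun u v => ?_) (fun u v => ?_), ?_⟩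
  · rw [h.apply_eq]
    exact (congrArg (· ⬝ᵥ _) (hL u v)).trans (hl.skew _ _)
  · apply e.injective
    rw [map_sub, hL, hL, hl.torsion]
    exact (h.equivFun_lie u v).symm
  · intro u v
    ext w
    apply e.injective
    have h1 : e ⁅u, v⁆ = E.bracket (e u) (e v) := h.equivFun_lie u v
    simp only [LinearMap.sub_apply, Module.End.mul_apply, map_sub, hL, h1, hl.flat]
    simp

end

/-! ### Lorentzian forms and splittings off a null plane -/

section

variable {g : Type*} [AddCommGroup g] [Module ℝ g] {B : LinearMap.BilinForm ℝ g}

theorem exists_basis_of_gram [FiniteDimensional ℝ g] {n : ℕ} (hn : finrank ℝ g = n) (v : Fin n → g)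
    (h : ∀ c : Fin n → ℝ, (∀ j, ∑ i, c i * B (v i) (v j) = 0) → c = 0) :
    ∃ b : Basis (Fin n) ℝ g, ⇑b = v := by
  have hv : LinearIndependent ℝ v := by
    rw [Fintype.linearIndependent_iff]
    intro c hc i
    refine congrFun (h c fun j => ?_) i
    have := congrArg (fun x => B x (v j)) hc
    simpa [map_sum, LinearMap.sum_apply] using this
  rcases n with _ | n
  · exact ⟨basisOfLinearIndependentOfCardEqFinrank' v hv (by simp [hn]), by simp⟩
  · exact ⟨basisOfLinearIndependentOfCardEqFinrank hv (by simp [hn]), by simp⟩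

/-- A splitting of the metric as a hyperbolic plane plus a Euclidean space. -/
def IsSplitting (B : LinearMap.BilinForm ℝ g) {V : Type*} [NormedAddCommGroup V]
    [InnerProductSpace ℝ V] (Φ : (ℝ × ℝ × V) ≃ₗ[ℝ] g) : Prop :=
  ∀ p q, B (Φ p) (Φ q) = p.1 * q.2.1 + p.2.1 * q.1 + inner ℝ p.2.2 q.2.2

theorem IsSplitting.finrank_eq {m : ℕ} {Φ : (ℝ × ℝ × EuclideanSpace ℝ (Fin m)) ≃ₗ[ℝ] g} :
    finrank ℝ g = m + 2 := by
  rw [← Φ.finrank_eq]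
  simp
  ring

theorem exists_isSplitting [FiniteDimensional ℝ g] (hB : ∀ u v, B u v = B v u) {z w : g}
    (hzz : B z z = 0) (hww : B w w = 0) (hzw : B z w = 1)
    (hpos : ∀ x, B z x = 0 → B w x = 0 → x ≠ 0 → 0 < B x x) :
    ∃ (m : ℕ) (Φ : (ℝ × ℝ × EuclideanSpace ℝ (Fin m)) ≃ₗ[ℝ] g),
      IsSplitting B Φ ∧ Φ (1, 0, 0) = z := by
  let W : Submodule ℝ g := LinearMap.ker (B z) ⊓ LinearMap.ker (B w)
  have hW : ∀ x : W, B z x = 0 ∧ B w x = 0 := fun x => x.2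
  obtain ⟨v, hv⟩ := LinearMap.BilinForm.exists_orthogonal_basis
    (B := B.restrict W) ⟨fun x y => hB x y⟩
  have hv' : ∀ i j, i ≠ j → B (v i) (v j) = 0 := fun i j hij => hv hij
  have hvp : ∀ i, 0 < B (v i) (v i) := fun i =>
    hpos _ (hW _).1 (hW _).2 (by simpa using v.ne_zero i)
  let r : Fin (finrank ℝ W) → ℝ := fun i => Real.sqrt (B (v i) (v i))
  have hr : ∀ i, r i ≠ 0 := fun i => (Real.sqrt_pos.2 (hvp i)).ne'
  have hr2 : ∀ i, B (v i) (v i) = r i * r i := fun i => (Real.mul_self_sqrt (hvp i).le).symm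
  let f : Fin (finrank ℝ W) → g := fun i => (r i)⁻¹ • (v i : g)
  have hzf : ∀ i, B z (f i) = 0 := fun i => by simp [f, (hW (v i)).1]
  have hwf : ∀ i, B w (f i) = 0 := fun i => by simp [f, (hW (v i)).2]
  have hff : ∀ i j, B (f i) (f j) = if i = j then 1 else 0 := by
    intro i j
    split_ifs with hij
    · subst hij
      simp only [f, map_smul, LinearMap.smul_apply, smul_eq_mul, hr2]
      field_simp [hr i]
    · simp [f, hv' i j hij]
  have hexp : ∀ x : W, (x : g) = ∑ i, B x (f i) • f i := by
    intro x
    have h1 : (x : g) = ∑ i, v.repr x i • (v i : g) := by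
      have := congrArg W.subtype (v.sum_repr x)
      rw [map_sum] at this
      exact this.symm
    have h2 : ∀ j, B x (v j) = v.repr x j * (r j * r j) := by
      intro j
      rw [h1, map_sum, LinearMap.sum_apply, Finset.sum_eq_single j]
      · simp [hr2]
      · intro i _ hij
        simp [hv' i j hij]
      · simp
    conv_lhs => rw [h1]
    refine Finset.sum_congr rfl fun j _ => ?_
    simp only [f, map_smul, smul_eq_mul, h2, smul_smul]
    congr 1
    field_simp [hr j]
  let F : (ℝ × ℝ × EuclideanSpace ℝ (Fin (finrank ℝ W))) →ₗ[ℝ] g :=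
    { toFun := fun p => p.1 • z + p.2.1 • w + ∑ i, p.2.2 i • f i
      map_add' := fun p q => by
        simp only [Prod.fst_add, Prod.snd_add, PiLp.add_apply, add_smul, Finset.sum_add_distrib]
        abel
      map_smul' := fun c p => by
        simp [mul_smul, Finset.smul_sum] }
  have hF : ∀ p, F p = p.1 • z + p.2.1 • w + ∑ i, p.2.2 i • f i := fun p => rfl
  have hBF : ∀ p q, B (F p) (F q) = p.1 * q.2.1 + p.2.1 * q.1 + inner ℝ p.2.2 q.2.2 := by
    intro p q
    have hwz : B w z = 1 := by rw [hB, hzw]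
    have hfz : ∀ i, B (f i) z = 0 := fun i => by rw [hB, hzf]
    have hfw : ∀ i, B (f i) w = 0 := fun i => by rw [hB, hwf]
    simp only [hF, map_add, map_smul, map_sum, LinearMap.add_apply, LinearMap.smul_apply,
      LinearMap.sum_apply, smul_eq_mul, hzz, hww, hzw, hwz, hzf, hwf, hfz, hfw, hff,
      PiLp.inner_apply, RCLike.inner_apply, conj_trivial]
    simp only [mul_zero, add_zero, mul_one, zero_add, Finset.sum_const_zero, mul_ite,
      Finset.sum_ite_eq', Finset.mem_univ, if_true]
    rw [show ∑ i, q.2.2 i * p.2.2 i = ∑ i, p.2.2 i * q.2.2 i from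
      Finset.sum_congr rfl fun i _ => mul_comm _ _]
    ring
  have hinj : Function.Injective F := by
    rw [← LinearMap.ker_eq_bot, LinearMap.ker_eq_bot']
    intro p hp
    have h1 := hBF p (0, 1, 0)
    have h2 := hBF p (1, 0, 0)
    have h3 := hBF p (0, 0, p.2.2)
    simp only [hp, map_zero, LinearMap.zero_apply, mul_one, mul_zero, inner_zero_right,
      add_zero, zero_add] at h1 h2 h3
    exact Prod.ext h1.symm (Prod.ext h2.symm (inner_self_eq_zero.1 h3.symm))
  have hsurj : Function.Surjective F := by
    intro u
    have hu : u - B u w • z - B u z • w ∈ W := by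
      refine ⟨?_, ?_⟩
      · simp [hzz, hzw, hB z u]
      · simp [hww, hB w z, hzw, hB w u]
    have h := hexp ⟨_, hu⟩
    refine ⟨(B u w, B u z, WithLp.toLp 2 fun i => B (u - B u w • z - B u z • w) (f i)), ?_⟩
    rw [hF]
    simp only at h ⊢
    rw [← h]
    abel
  refine ⟨_, LinearEquiv.ofBijective F ⟨hinj, hsurj⟩, hBF, ?_⟩
  change F (1, 0, 0) = z
  simp [hF]

theorem IsSplitting.isLorentzian [FiniteDimensional ℝ g] {m : ℕ}
    {Φ : (ℝ × ℝ × EuclideanSpace ℝ (Fin m)) ≃ₗ[ℝ] g} (hΦ : IsSplitting B Φ) : IsLorentzian B := by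
  let s : ℝ := (Real.sqrt 2)⁻¹
  have hs : s * s = 1 / 2 := by
    simp only [s]
    rw [← mul_inv, Real.mul_self_sqrt (by norm_num)]
    norm_num
  let v : Fin (m + 2) → g := fun i => Φ (Fin.cases (s, -s, 0)
    (Fin.cases (s, s, 0) fun j => (0, 0, EuclideanSpace.single j 1)) i)
  have hv : ∀ i j, B (v i) (v j) = if i = j then (if i = 0 then -1 else 1) else 0 := by
    intro i j
    refine Fin.cases ?_ (fun i => Fin.cases ?_ (fun i => ?_) i) i <;>
    refine Fin.cases ?_ (fun j => Fin.cases ?_ (fun j => ?_) j) j <;>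
    simp only [v, hΦ _ _, Fin.cases_zero, Fin.cases_succ] <;>
    simp [Fin.succ_ne_zero, (Fin.succ_ne_zero _).symm, EuclideanSpace.inner_single_left,
      PiLp.single_apply, eq_comm] <;> first | linarith | simp [Fin.ext_iff]
  obtain ⟨b, hb⟩ := exists_basis_of_gram (B := B) (IsSplitting.finrank_eq (Φ := Φ)) v (by
    intro c hc
    ext j
    have := hc j
    simp only [hv, mul_ite, mul_zero, Finset.sum_ite_eq', Finset.mem_univ,
      if_true] at this
    split_ifs at this <;> simpa using this)
  exact ⟨m + 1, b, fun i j => by rw [hb]; exact hv i j⟩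

theorem IsLorentzian.symm (h : IsLorentzian B) (u v : g) : B u v = B v u := by
  obtain ⟨m, b, hb⟩ := h
  have : B = B.flip := LinearMap.BilinForm.ext_basis b fun i j => by
    change B (b i) (b j) = B (b j) (b i)
    rw [hb, hb]
    simp only [eq_comm (a := j)]
    split_ifs with h1 <;> simp_all
  conv_lhs => rw [this]
  rfl

theorem IsLorentzian.exists_isSplitting [FiniteDimensional ℝ g] (h : IsLorentzian B) {z : g}
    (hz : z ≠ 0) (hzz : B z z = 0) :
    ∃ (m : ℕ) (Φ : (ℝ × ℝ × EuclideanSpace ℝ (Fin m)) ≃ₗ[ℝ] g),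
      IsSplitting B Φ ∧ Φ (1, 0, 0) = z := by
  have hB := h.symm
  obtain ⟨m, b, hb⟩ := h
  have hBc : ∀ u v, B u v = -(b.repr u 0 * b.repr v 0) + ∑ i : Fin m,
    b.repr u i.succ * b.repr v i.succ := by
    intro u v
    rw [← LinearMap.sum_repr_mul_repr_mul b b (B := B), Finsupp.sum_fintype _ _ (by simp)]
    simp only [hb]
    simp [Fin.sum_univ_succ, Fin.succ_ne_zero]
    refine congrArg₂ (· + ·) ?_ (Finset.sum_congr rfl fun i _ => ?_) <;>
      split_ifs with h <;> simp [h]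
  -- The reflection of `z` in the time axis is a null vector transversal to `z`.
  let w : g := b.equivFun.symm fun i => Fin.cases (-b.repr z 0) (fun j => b.repr z j.succ) i
  have hw : ∀ i, b.repr w i = Fin.cases (-b.repr z 0) (fun j => b.repr z j.succ) i := fun i => by
    rw [← b.equivFun_apply, LinearEquiv.apply_symm_apply]
  have hw0 : b.repr w 0 = -b.repr z 0 := hw 0
  have hws : ∀ j : Fin m, b.repr w j.succ = b.repr z j.succ := fun j => hw j.succ
  have hz0 : b.repr z 0 ≠ 0 := by
    intro h0
    rw [hBc, h0] at hzz
    simp only [mul_zero, neg_zero, zero_add] at hzz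
    rw [Finset.sum_eq_zero_iff_of_nonneg fun i _ => mul_self_nonneg _] at hzz
    apply hz
    apply b.repr.injective
    ext i
    refine Fin.cases ?_ (fun j => ?_) i
    · simpa using h0
    · simpa using hzz j (Finset.mem_univ _)
  set s := 2 * (b.repr z 0 * b.repr z 0) with hs
  have hs0 : s ≠ 0 := by simp [hs, hz0]
  have hzw : B z w = s := by
    rw [hBc] at hzz ⊢
    simp only [hw0, hws]
    linarith
  have hww : B w w = 0 := by
    rw [hBc] at hzz ⊢
    simp only [hw0, hws]
    linarith
  refine _root_.exists_isSplitting hB (w := s⁻¹ • w) hzz (by simp [hww]) (by simp [hzw, hs0]) ?_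
  intro x hzx hwx hx
  have hwx' : B w x = 0 := by simpa [hs0] using hwx
  rw [hBc] at hzx hwx'
  simp only [hw0, hws] at hwx'
  have hx0 : b.repr x 0 = 0 := by
    have : b.repr z 0 * b.repr x 0 = 0 := by linarith
    simpa [hz0] using this
  rw [hBc, hx0]
  simp only [mul_zero, neg_zero, zero_add]
  refine lt_of_le_of_ne (Finset.sum_nonneg fun i _ => mul_self_nonneg _) fun h => hx ?_
  rw [eq_comm, Finset.sum_eq_zero_iff_of_nonneg fun i _ => mul_self_nonneg _] at h
  apply b.repr.injective
  ext i
  refine Fin.cases ?_ (fun j => ?_) i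
  · simpa using hx0
  · simpa using h j (Finset.mem_univ _)

/-- A symmetric form with a null vector `z` outside its radical that is positive on `z^⊥` modulo
`z` is Lorentzian. -/
theorem isLorentzian_of_null [FiniteDimensional ℝ g] (hB : ∀ u v, B u v = B v u) {z w : g}
    (hzz : B z z = 0) (hzw : B z w ≠ 0)
    (hpos : ∀ x, B z x = 0 → 0 < B x x ∨ ∃ t : ℝ, x = t • z) : IsLorentzian B := by
  have hwz : B w z ≠ 0 := by rwa [hB]
  let w' := (B z w)⁻¹ • (w - (B w w / (2 * B z w)) • z)
  have hzw' : B z w' = 1 := by simp [w', hzz, hzw]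
  have hww' : B w' w' = 0 := by
    simp only [w', map_smul, map_sub, LinearMap.smul_apply, LinearMap.sub_apply, smul_eq_mul, hzz,
      hB w z]
    field_simp
    ring
  obtain ⟨m, Φ, hΦ, -⟩ := _root_.exists_isSplitting hB hzz hww' hzw' (by
    intro x hx hwx hx0
    rcases hpos x hx with h | ⟨t, rfl⟩
    · exact h
    · have : t = 0 := by simpa [hB w', hzw'] using hwx
      simp [this] at hx0)
  exact hΦ.isLorentzian

end

/-! ### Nilpotency class and derived length from structure constants -/

section

variable {g : Type*} [LieRing g] [LieAlgebra ℝ g]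

theorem nilpotent_holds_of_lcs {k : ℕ}
    (h0 : LieModule.lowerCentralSeries ℝ g g (k + 1) = ⊥)
    (h1 : LieModule.lowerCentralSeries ℝ g g k ≠ ⊥) : (Nature.nilpotent (k + 1)).Holds g :=
  ⟨LieModule.IsNilpotent.mk g h0, (LieModule.nilpotencyLength_eq_succ_iff ℝ g g k).2 ⟨h0, h1⟩⟩

theorem nilpotent_two_holds (h : ∀ x y w : g, ⁅x, ⁅y, w⁆⁆ = 0) (h' : ∃ x y : g, ⁅x, y⁆ ≠ 0) :
    (Nature.nilpotent 2).Holds g := by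
  refine nilpotent_holds_of_lcs ?_ ?_
  · rw [LieModule.lowerCentralSeries_succ, LieModule.lowerCentralSeries_succ, eq_bot_iff]
    refine (LieSubmodule.mono_lie_right ⊤ (N' := LieModule.maxTrivSubmodule ℝ g g)
      ((LieSubmodule.lie_le_iff _ _ _).2 ?_)).trans ?_
    · intro x _ m _
      rw [LieModule.mem_maxTrivSubmodule]
      exact fun y => h y x m
    · rw [LieSubmodule.lie_le_iff]
      exact fun x _ m hm => (LieModule.mem_maxTrivSubmodule ℝ g g m).1 hm x
  · obtain ⟨x, y, hxy⟩ := h'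
    rw [LieModule.lowerCentralSeries_succ, ne_eq, LieSubmodule.lie_eq_bot_iff]
    exact fun hn => hxy (hn x trivial y trivial)

theorem nilpotent_three_holds (h : ∀ x y w u : g, ⁅x, ⁅y, ⁅w, u⁆⁆⁆ = 0)
    (h' : ∃ x y w : g, ⁅x, ⁅y, w⁆⁆ ≠ 0) : (Nature.nilpotent 3).Holds g := by
  refine nilpotent_holds_of_lcs ?_ ?_
  · have h1 : LieModule.lowerCentralSeries ℝ g g 2 ≤ LieModule.maxTrivSubmodule ℝ g g := by
      have h2 : LieModule.lowerCentralSeries ℝ g g 1 ≤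
          (LieModule.maxTrivSubmodule ℝ g g).normalizer := by
        rw [LieModule.lowerCentralSeries_succ, LieSubmodule.lie_le_iff]
        intro x _ m _
        rw [LieSubmodule.mem_normalizer]
        intro y
        rw [LieModule.mem_maxTrivSubmodule]
        exact fun z => h z y x m
      rw [LieModule.lowerCentralSeries_succ, LieSubmodule.lie_le_iff]
      exact fun x _ m hm => (LieSubmodule.mem_normalizer _ m).1 (h2 hm) x
    rw [LieModule.lowerCentralSeries_succ, LieSubmodule.lie_eq_bot_iff]
    exact fun x _ m hm => (LieModule.mem_maxTrivSubmodule ℝ g g m).1 (h1 hm) x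
  · obtain ⟨x, y, w, hxy⟩ := h'
    rw [LieModule.lowerCentralSeries_succ, ne_eq, LieSubmodule.lie_eq_bot_iff]
    refine fun hn => hxy (hn x trivial _ ?_)
    rw [LieModule.lowerCentralSeries_succ]
    exact LieSubmodule.lie_mem_lie trivial trivial

theorem solvable_holds_of_derivedSeries {k : ℕ}
    (h0 : LieAlgebra.derivedSeries ℝ g (k + 1) = ⊥)
    (h1 : LieAlgebra.derivedSeries ℝ g k ≠ ⊥) : (Nature.solvable (k + 1)).Holds g := by
  refine ⟨LieAlgebra.IsSolvable.mk h0, ?_⟩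
  rw [LieAlgebra.derivedSeries_of_derivedLength_succ, LieAlgebra.abelian_iff_derived_succ_eq_bot]
  exact ⟨h0, h1⟩

theorem derivedSeries_two_le (N : LieIdeal ℝ g) (h : ∀ x y w u : g, ⁅⁅x, y⁆, ⁅w, u⁆⁆ ∈ N) :
    LieAlgebra.derivedSeries ℝ g 2 ≤ N := by
  have hD : LieSubmodule.toSubmodule (LieAlgebra.derivedSeries ℝ g 1) =
      Submodule.span ℝ { ⁅x, n⁆ | (x ∈ (⊤ : LieIdeal ℝ g)) (n ∈ (⊤ : LieIdeal ℝ g)) } :=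
    LieSubmodule.lieIdeal_oper_eq_linear_span' _ _
  change ⁅LieAlgebra.derivedSeries ℝ g 1, LieAlgebra.derivedSeries ℝ g 1⁆ ≤ N
  rw [LieSubmodule.lie_le_iff]
  intro a ha c hc
  rw [← LieSubmodule.mem_toSubmodule, hD] at ha hc
  induction ha using Submodule.span_induction with
  | mem a ha =>
    obtain ⟨x, -, y, -, rfl⟩ := ha
    induction hc using Submodule.span_induction with
    | mem c hc =>
      obtain ⟨w, -, u, -, rfl⟩ := hc
      exact h x y w u
    | zero => simp
    | add c d _ _ hc hd => rw [lie_add]; exact add_mem hc hd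
    | smul t c _ hc => rw [lie_smul]; exact N.smul_mem t hc
  | zero => simp
  | add c d _ _ hc hd => rw [add_lie]; exact add_mem hc hd
  | smul t c _ hc => rw [smul_lie]; exact N.smul_mem t hc

theorem solvable_two_holds (h : ∀ x y w u : g, ⁅⁅x, y⁆, ⁅w, u⁆⁆ = 0)
    (h' : ∃ x y : g, ⁅x, y⁆ ≠ 0) : (Nature.solvable 2).Holds g := by
  refine solvable_holds_of_derivedSeries ?_ ?_
  · exact eq_bot_iff.2 (derivedSeries_two_le ⊥ fun x y w u => by simp [h])
  · obtain ⟨x, y, hxy⟩ := h'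
    intro hn
    have : ⁅x, y⁆ ∈ LieAlgebra.derivedSeries ℝ g 1 :=
      LieSubmodule.lie_mem_lie (LieSubmodule.mem_top x) (LieSubmodule.mem_top y)
    rw [hn] at this
    exact hxy (by simpa using this)

theorem solvable_three_holds (h : ∀ x y w u v : g, ⁅v, ⁅⁅x, y⁆, ⁅w, u⁆⁆⁆ = 0)
    (h' : ∃ x y w u : g, ⁅⁅x, y⁆, ⁅w, u⁆⁆ ≠ 0) : (Nature.solvable 3).Holds g := by
  have hD : ∀ x y : g, ⁅x, y⁆ ∈ LieAlgebra.derivedSeries ℝ g 1 := fun x y =>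
    LieSubmodule.lie_mem_lie (LieSubmodule.mem_top x) (LieSubmodule.mem_top y)
  refine solvable_holds_of_derivedSeries ?_ ?_
  · have h2 := derivedSeries_two_le (LieAlgebra.center ℝ g) fun x y w u => by
      rw [LieModule.mem_maxTrivSubmodule]
      exact h x y w u
    change ⁅LieAlgebra.derivedSeries ℝ g 2, LieAlgebra.derivedSeries ℝ g 2⁆ = ⊥
    rw [LieSubmodule.lie_eq_bot_iff]
    exact fun x _ m hm => (LieModule.mem_maxTrivSubmodule ℝ g g m).1 (h2 hm) x
  · obtain ⟨x, y, w, u, hxy⟩ := h'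
    intro hn
    have : ⁅⁅x, y⁆, ⁅w, u⁆⁆ ∈ LieAlgebra.derivedSeries ℝ g 2 :=
      LieSubmodule.lie_mem_lie (hD x y) (hD w u)
    rw [hn] at this
    exact hxy (by simpa using this)

/-- The nature of an entry, read off from its bracket in coordinates. -/
def Entry.NatureTest {n : ℕ} (E : Entry n) : Nature → Prop
  | .heisenberg => ∃ e : Fin 3 ≃ Fin n, E.structureConst (e 0) (e 1) = Pi.single (e 2) 1 ∧
      E.structureConst (e 0) (e 2) = 0 ∧ E.structureConst (e 1) (e 2) = 0
  | .nilpotent 2 => (∀ x y w, E.bracket x (E.bracket y w) = 0) ∧ ∃ x y, E.bracket x y ≠ 0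
  | .nilpotent 3 => (∀ x y w u, E.bracket x (E.bracket y (E.bracket w u)) = 0) ∧
      ∃ x y w, E.bracket x (E.bracket y w) ≠ 0
  | .solvable 2 => (∀ x y w u, E.bracket (E.bracket x y) (E.bracket w u) = 0) ∧
      ∃ x y, E.bracket x y ≠ 0
  | .solvable 3 => (∀ x y w u v, E.bracket v (E.bracket (E.bracket x y) (E.bracket w u)) = 0) ∧
      ∃ x y w u, E.bracket (E.bracket x y) (E.bracket w u) ≠ 0
  | _ => False

theorem Entry.Realizes.nature_holds {n : ℕ} {E : Entry n} {B : LinearMap.BilinForm ℝ g}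
    {b : Basis (Fin n) ℝ g} (h : E.Realizes B b) {ν : Nature} (hE : E.NatureTest ν) :
    ν.Holds g := by
  have hz : ∀ u : g, u = 0 ↔ b.equivFun u = 0 := fun u => by simp
  have hsurj : ∀ x : Fin n → ℝ, ∃ u, b.equivFun u = x := b.equivFun.surjective
  revert hE
  unfold Entry.NatureTest
  split
  · rintro ⟨e, h1, h2, h3⟩
    refine ⟨b.reindex e.symm, ?_⟩
    simp only [Basis.reindex_apply, Equiv.symm_symm, h.1, h1, h2, h3]
    simp [Pi.single_apply]
  · rintro ⟨h1, x, y, h2⟩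
    obtain ⟨x, rfl⟩ := hsurj x
    obtain ⟨y, rfl⟩ := hsurj y
    exact nilpotent_two_holds (fun x y w => by simp only [hz, h.equivFun_lie, h1])
      ⟨x, y, by rwa [ne_eq, hz, h.equivFun_lie]⟩
  · rintro ⟨h1, x, y, w, h2⟩
    obtain ⟨x, rfl⟩ := hsurj x
    obtain ⟨y, rfl⟩ := hsurj y
    obtain ⟨w, rfl⟩ := hsurj w
    exact nilpotent_three_holds (fun x y w u => by simp only [hz, h.equivFun_lie, h1])
      ⟨x, y, w, by rwa [ne_eq, hz, h.equivFun_lie, h.equivFun_lie]⟩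
  · rintro ⟨h1, x, y, h2⟩
    obtain ⟨x, rfl⟩ := hsurj x
    obtain ⟨y, rfl⟩ := hsurj y
    exact solvable_two_holds (fun x y w u => by simp only [hz, h.equivFun_lie, h1])
      ⟨x, y, by rwa [ne_eq, hz, h.equivFun_lie]⟩
  · rintro ⟨h1, x, y, w, u, h2⟩
    obtain ⟨x, rfl⟩ := hsurj x
    obtain ⟨y, rfl⟩ := hsurj y
    obtain ⟨w, rfl⟩ := hsurj w
    obtain ⟨u, rfl⟩ := hsurj u
    exact solvable_three_holds (fun x y w u v => by simp only [hz, h.equivFun_lie, h1])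
      ⟨x, y, w, u, by rwa [ne_eq, hz, h.equivFun_lie, h.equivFun_lie, h.equivFun_lie]⟩
  · exact fun h => h.elim

end

/-! ### The nature and the center of the listed Lie algebras -/

set_option maxHeartbeats 4000000 in
/-- Every listed entry has the stated nature. -/
theorem IsListed.natureTest {n : ℕ} {E : Entry n} (h : IsListed n E) : E.NatureTest E.nature := by
  cases h
  case dim3 α hα =>
    refine ⟨⟨![1, 2, 0], ![2, 0, 1], by decide, by decide⟩, ?_⟩
    refine ⟨?_, ?_, ?_⟩ <;> ext k <;> fin_cases k <;> simp [Entry.structureConst]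
  case' dim4_a => refine ⟨fun x y w => ?_, ![0, 1, 0, 0], ![0, 0, 1, 0], fun h => ?_⟩
  case' dim4_b =>
    refine ⟨fun x y w u => ?_, ![0, 0, 0, 1], ![0, 1, 0, 0], ![0, 0, 0, 1], fun h => ?_⟩
  case' dim4_c => refine ⟨fun x y w u => ?_, ![0, 1, 0, 0], ![0, 0, 1, 0], fun h => ?_⟩
  case' dim5_a => refine ⟨fun x y w => ?_, ![0, 1, 0, 0, 0], ![0, 0, 1, 0, 0], fun h => ?_⟩
  case' dim5_b =>
    refine ⟨fun x y w u => ?_, ![0, 0, 0, 0, 1], ![0, 1, 0, 0, 0], ![0, 0, 0, 0, 1], fun h => ?_⟩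
  case' dim5_c => refine ⟨fun x y w u => ?_, ![0, 1, 0, 0, 0], ![0, 0, 1, 0, 0], fun h => ?_⟩
  case' dim5_d => refine ⟨fun x y w u => ?_, ![0, 0, 1, 0, 0], ![0, 0, 0, 1, 0], fun h => ?_⟩
  case' dim6_a => refine ⟨fun x y w => ?_, ![0, 1, 0, 0, 0, 0], ![0, 0, 1, 0, 0, 0], fun h => ?_⟩
  case' dim6_b => refine ⟨fun x y w u => ?_, ![0, 1, 0, 0, 0, 0], ![0, 0, 1, 0, 0, 0], fun h => ?_⟩
  case' dim6_c => refine ⟨fun x y w u => ?_, ![0, 1, 0, 0, 0, 0], ![0, 0, 1, 0, 0, 0], fun h => ?_⟩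
  case' dim6_d => refine ⟨fun x y w u => ?_, ![0, 1, 0, 0, 0, 0], ![0, 0, 0, 0, 1, 0], fun h => ?_⟩
  case' dim6_e =>
    refine ⟨fun x y w u => ?_, ![0, 0, 0, 0, 0, 1], ![0, 1, 0, 0, 0, 0], ![0, 0, 0, 0, 0, 1],
      fun h => ?_⟩
  case' dim6_f => refine ⟨fun x y w u => ?_, ![0, 1, 0, 0, 0, 0], ![0, 0, 1, 0, 0, 0], fun h => ?_⟩
  case' dim6_h => refine ⟨fun x y w u => ?_, ![0, 0, 1, 0, 0, 0], ![0, 0, 0, 0, 1, 0], fun h => ?_⟩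
  case dim6_g ρ ω X Y α β γ μ hρ hX hY =>
    have hs : ρ ^ 2 = X ^ 2 + Y ^ 2 := by
      rw [hX, hY, mul_pow, mul_pow, Real.sin_sq]
      ring
    refine ⟨fun x y w u v => ?_, ![0, 1, 0, 0, 0, 0], ![0, 0, 0, 0, 1, 0], ![0, 1, 0, 0, 0, 0],
      ![0, 0, 0, 0, 0, 1], fun h => ?_⟩
    · ext k
      fin_cases k <;> simp [Entry.bracket_apply, tableMul_cons, tableMul_nil]
    · have := congrFun h 0
      simp [Entry.bracket_apply, tableMul_cons, tableMul_nil] at this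
      nlinarith [sq_pos_of_pos hρ]
  all_goals first
    | replace h := congrFun h
      simp [Fin.forall_fin_succ, Entry.bracket_apply, tableMul_cons, tableMul_nil] at h
    | ext k
      fin_cases k <;> simp [Entry.bracket_apply, tableMul_cons, tableMul_nil]

theorem weighted_sq_sum_nonpos {a b c d p q r s : ℝ} (ha : 0 < a) (hb : 0 < b) (hc : 0 < c)
    (hd : 0 < d) (h : a * p ^ 2 + b * q ^ 2 + c * r ^ 2 + d * s ^ 2 ≤ 0) :
    p = 0 ∧ q = 0 ∧ r = 0 ∧ s = 0 := by
  have h1 := mul_nonneg ha.le (sq_nonneg p)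
  have h2 := mul_nonneg hb.le (sq_nonneg q)
  have h3 := mul_nonneg hc.le (sq_nonneg r)
  have h4 := mul_nonneg hd.le (sq_nonneg s)
  have key : ∀ {a p : ℝ}, 0 < a → a * p ^ 2 ≤ 0 → p = 0 := fun {a p} ha h =>
    pow_eq_zero_iff two_ne_zero |>.1 (le_antisymm (nonpos_of_mul_nonpos_right h ha) (sq_nonneg p))
  exact ⟨key ha (by linarith), key hb (by linarith), key hc (by linarith), key hd (by linarith)⟩

/-- The shape of the Gram matrix that makes a metric Lorentzian: the basis vector `i₀` is null, it
is orthogonal to all the basis vectors but `i₁`, and the form is positive definite on the span of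
the remaining ones. -/
structure Entry.IsNullGram {n : ℕ} (E : Entry n) (i₀ i₁ : Fin n) : Prop where
  symm : ∀ i j, E.gram i j = E.gram j i
  ne : i₀ ≠ i₁
  gram_ne : E.gram i₀ i₁ ≠ 0
  gram_eq : ∀ j, j ≠ i₁ → E.gram i₀ j = 0
  pos : ∀ x : Fin n → ℝ, x i₁ = 0 → x ⬝ᵥ E.gram.mulVec x ≤ 0 → ∀ k, k ≠ i₀ → x k = 0

/-- The basis vector `i₀` is central, and the center lies in the span of the basis vectors other
than `i₁`. -/
structure Entry.HasCenterAt {n : ℕ} (E : Entry n) (i₀ i₁ : Fin n) : Prop where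
  central : ∀ y, E.bracket (Pi.single i₀ 1) y = 0
  eq_zero : ∀ x, (∀ y, E.bracket x y = 0) → x i₁ = 0

set_option maxHeartbeats 4000000 in
theorem IsListed.hasCenterAt {n : ℕ} {E : Entry n} (h : IsListed n E) :
    ∃ i₀ i₁, E.HasCenterAt i₀ i₁ ∧ E.IsNullGram i₀ i₁ := by
  cases h
  all_goals refine ⟨0, 1, ⟨fun y => ?_, fun x hx => ?_⟩, ⟨?_, by decide, ?_, ?_, fun x h1 hx => ?_⟩⟩
  case dim3.refine_2 =>
    simpa [Entry.bracket_apply, tableMul_cons, tableMul_nil] using congrFun (hx ![0, 0, 1]) 0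
  case' dim4_a.refine_2 => replace hx := congrFun (hx ![0, 0, 1, 0]) 0
  case' dim4_b.refine_2 => replace hx := congrFun (hx ![0, 0, 0, 1]) 2
  case' dim4_c.refine_2 => replace hx := congrFun (hx ![0, 0, 1, 0]) 3
  case' dim5_a.refine_2 => replace hx := congrFun (hx ![0, 0, 1, 0, 0]) 0
  case' dim5_b.refine_2 => replace hx := congrFun (hx ![0, 0, 0, 0, 1]) 2
  case' dim5_c.refine_2 => replace hx := congrFun (hx ![0, 0, 1, 0, 0]) 3
  case dim5_d.refine_2 α a b c d hα hc =>
    simpa [Entry.bracket_apply, tableMul_cons, tableMul_nil, hc] using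
      congrFun (hx ![0, 0, 1, 0, 0]) 0
  case' dim6_a.refine_2 => replace hx := congrFun (hx ![0, 0, 1, 0, 0, 0]) 0
  case' dim6_b.refine_2 => replace hx := congrFun (hx ![0, 0, 1, 0, 0, 0]) 3
  case' dim6_c.refine_2 => replace hx := congrFun (hx ![0, 0, 1, 0, 0, 0]) 3
  case' dim6_d.refine_2 => replace hx := congrFun (hx ![0, 0, 0, 0, 1, 0]) 2
  case' dim6_e.refine_2 => replace hx := congrFun (hx ![0, 0, 0, 0, 0, 1]) 2
  case' dim6_f.refine_2 => replace hx := congrFun (hx ![0, 0, 1, 0, 0, 0]) 3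
  case' dim6_g.refine_2 => replace hx := congrFun (hx ![0, 0, 1, 0, 0, 0]) 3
  case dim6_h.refine_2 α β γ a b c d e f hα hβ hγ hade =>
    have h1 := congrFun (hx ![0, 0, 1, 0, 0, 0]) 3
    have h2 := congrFun (hx ![0, 0, 1, 0, 0, 0]) 0
    have h3 := congrFun (hx ![0, 0, 0, 1, 0, 0]) 0
    simp [Entry.bracket_apply, tableMul_cons, tableMul_nil] at h1 h2 h3
    rcases h1 with h1 | rfl
    · exact h1
    · by_contra h0
      simp [h0] at h2 h3
      exact hade (by simp [h2, h3])
  -- Positivity: the quadratic form is written as a sum of squares.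
  case' dim3.refine_6 α hα =>
    have := weighted_sq_sum_nonpos (p := x 2) (q := 0) (r := 0) (s := 0) one_pos one_pos one_pos
      one_pos
  case' dim4_a.refine_6 α a hα =>
    have := weighted_sq_sum_nonpos (p := x 2 + a * x 3) (q := x 3) (r := 0) (s := 0) one_pos
      one_pos one_pos one_pos
  case' dim4_b.refine_6 α β a hα =>
    have := weighted_sq_sum_nonpos (p := x 2) (q := x 3) (r := 0) (s := 0) hα one_pos one_pos
      one_pos
  case' dim4_c.refine_6 α β γ hα =>
    have hα2 : 0 < α ^ 2 := by positivity
    have := weighted_sq_sum_nonpos (p := x 2) (q := x 3) (r := 0) (s := 0) hα2 hα2 one_pos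
      one_pos
  case' dim5_a.refine_6 α a b hα =>
    have := weighted_sq_sum_nonpos (p := x 2 + a * x 3 + b * x 4) (q := x 3) (r := x 4) (s := 0)
      one_pos one_pos one_pos one_pos
  case' dim5_b.refine_6 α β a b c hα hc =>
    have := weighted_sq_sum_nonpos (p := x 2 + c * x 3) (q := x 3) (r := x 4) (s := 0) hα
      (sub_pos.2 hc) one_pos one_pos
  case' dim5_c.refine_6 α β γ a hα =>
    have hα2 : 0 < α ^ 2 := by positivity
    have := weighted_sq_sum_nonpos (p := x 2) (q := x 3) (r := x 4) (s := 0) hα2 hα2 one_pos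
      one_pos
  case' dim5_d.refine_6 α a b c d hα hc =>
    have := weighted_sq_sum_nonpos (p := x 2) (q := x 3) (r := x 4) (s := 0) (inv_pos.2 hα) hα hα
      one_pos
  case' dim6_a.refine_6 α a b c hα =>
    have := weighted_sq_sum_nonpos (p := x 2 + a * x 3 + b * x 4 + c * x 5) (q := x 3) (r := x 4)
      (s := x 5) one_pos one_pos one_pos one_pos
  case' dim6_b.refine_6 α β γ μ ν a hα ha =>
    have hα2 : 0 < α ^ 2 := by positivity
    have hα3 : 0 < α ^ 2 * a ^ 2 := by positivity
    have := weighted_sq_sum_nonpos (p := x 2) (q := x 3) (r := x 4) (s := x 5) hα2 hα2 hα3 hα3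
  case' dim6_c.refine_6 α β γ a b hα =>
    have hα2 : 0 < α ^ 2 := by positivity
    have := weighted_sq_sum_nonpos (p := x 2) (q := x 3) (r := x 4) (s := x 5) hα2 hα2 one_pos
      one_pos
  case' dim6_d.refine_6 ρ₁ ρ₂ ω₁ ω₂ μ β γ a b hρ₁ hρ₂ hω hμ =>
    have hs : 0 < (ρ₂ * Real.sin (ω₁ - ω₂)) ^ 2 := by positivity
    have hρ : 0 < ρ₁ ^ 2 := by positivity
    have hsum := Real.sin_sq_add_cos_sq (ω₁ - ω₂)
    have := weighted_sq_sum_nonpos (p := x 2 + ρ₂ * Real.cos (ω₁ - ω₂) / ρ₁ * x 3) (q := x 3)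
      (r := x 4) (s := x 5) hρ hs one_pos one_pos
  case' dim6_e.refine_6 α β a b c d e hα hde =>
    have he := mul_nonneg hα.le (sq_nonneg (e * x 3 - d * x 4))
    have := weighted_sq_sum_nonpos (p := x 2 + d * x 3 + e * x 4) (q := x 3) (r := x 4) (s := x 5)
      hα (sub_pos.2 hde) (sub_pos.2 hde) one_pos
  case' dim6_f.refine_6 α β γ μ ν a hα hβ =>
    have := weighted_sq_sum_nonpos (p := x 2) (q := x 3) (r := x 4) (s := x 5) hβ hβ hα hβ
  case' dim6_g.refine_6 ρ ω X Y α β γ μ hρ hX hY =>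
    have hs : ρ ^ 2 = X ^ 2 + Y ^ 2 := by
      rw [hX, hY, mul_pow, mul_pow, Real.sin_sq]
      ring
    have := weighted_sq_sum_nonpos (p := x 2 + Y * x 4 + X * x 5) (q := x 3 - X * x 4 + Y * x 5)
      (r := x 4) (s := x 5) one_pos one_pos one_pos one_pos
  case' dim6_h.refine_6 α β γ a b c d e f hα hβ hγ hade =>
    have hα0 := hα.ne'
    have := weighted_sq_sum_nonpos (p := x 2) (q := γ * x 2 + α * x 3) (r := x 4) (s := x 5)
      (inv_pos.2 hα) (inv_pos.2 hα) one_pos one_pos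
  all_goals first
    | (have hq := this
       clear this
       simp [dotProduct, Matrix.mulVec, Fin.sum_univ_succ, h1] at hx
       replace hq := hq (by
        first
        | (refine le_trans (le_of_eq ?_) hx
           ring1)
        | (refine le_trans (le_of_eq ?_) hx
           rw [hs]
           ring1)
        | linarith
        | (refine le_trans (le_of_eq ?_) hx
           rw [hμ]
           field_simp
           linear_combination (ρ₂ ^ 2 * x 3 ^ 2) * hsum)
        | (refine le_trans (le_of_eq ?_) hx
           field_simp
           linear_combination (-(x 2) ^ 2) * hγ))
       clear hx
       obtain ⟨hp, hq, hr, ht⟩ := hq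
       intro k hk
       fin_cases k <;> simp_all)
    | (intro i j; fin_cases i <;> fin_cases j <;> rfl)
    | (intro j hj; fin_cases j <;> simp_all; done)
    | (simp [Entry.bracket_apply, tableMul_cons, tableMul_nil] at hx; exact hx)
    | (ext k; fin_cases k <;> simp [Entry.bracket_apply, tableMul_cons, tableMul_nil]; done)
    | (simp; done)
    | (simp; positivity)

/-! ### The Levi-Civita tables of the listed entries -/

set_option maxHeartbeats 4000000 in
/-- Every listed entry is flat: the table of its Levi-Civita product is written down. -/
theorem IsListed.exists_isFlatTable {n : ℕ} {E : Entry n} (h : IsListed n E) :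
    ∃ l, E.IsFlatTable l := by
  -- Some parameters are first rescaled, or expressed through the coordinates
  -- `x`, `y`, ... of `z̄ z̄`, so that all the identities to be checked become polynomial.
  cases h
  case' dim3 α hα =>
    refine ⟨[(1, 1, ![0, 0, -α]), (1, 2, ![1, 0, 0])], ?_⟩
  case' dim4_a α a hα =>
    refine ⟨[(1, 1, ![0, 0, -α * (1 + a ^ 2), α * a]), (1, 2, ![1, 0, 0, 0])], ?_⟩
  case' dim4_b α β a hα =>
    obtain ⟨β, rfl⟩ : ∃ t, β = α * t := ⟨β / α, by field_simp⟩
    refine ⟨[(1, 1, ![a * β, 0, -a, -(α * β)]), (1, 2, ![a, 0, 0, 0]), (1, 3, ![β, 0, 0, 0]),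
      (3, 1, ![β, 0, -1, 0]), (3, 2, ![1, 0, 0, 0])], ?_⟩
  case' dim4_c α β γ hα =>
    obtain ⟨β, rfl⟩ : ∃ t, β = α ^ 2 * t := ⟨β / α ^ 2, by field_simp⟩
    obtain ⟨γ, rfl⟩ : ∃ t, γ = α ^ 2 * t := ⟨γ / α ^ 2, by field_simp⟩
    refine ⟨[(1, 1, ![0, 0, -γ, β]), (1, 2, ![0, 0, 0, 1]), (1, 3, ![0, 0, -1, 0])], ?_⟩
  case' dim5_a α a b hα =>
    refine ⟨[(1, 1, ![0, 0, -α * (1 + a ^ 2 + b ^ 2), α * a, α * b]),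
      (1, 2, ![1, 0, 0, 0, 0])], ?_⟩
  case' dim5_b α β a b c hα hc =>
    obtain ⟨β, rfl⟩ : ∃ t, β = α * t := ⟨β / α, by field_simp⟩
    obtain ⟨x, rfl⟩ : ∃ x, a = -x + α * c * (b + c * x) :=
      ⟨(a - α * c * b) / (α * c ^ 2 - 1), by
        have : α * c ^ 2 - 1 ≠ 0 := by linarith
        field_simp
        ring⟩
    refine ⟨[(1, 1, ![-(x * β), 0, x, -(α * (b + c * x)), -(α * β)]),
      (1, 2, ![-x + α * c * (b + c * x), 0, 0, 0, 0]), (1, 3, ![b, 0, 0, 0, 0]),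
      (1, 4, ![β, 0, 0, 0, 0]), (4, 1, ![β, 0, -1, 0, 0]), (4, 2, ![1, 0, 0, 0, 0]),
      (4, 3, ![c, 0, 0, 0, 0])], ?_⟩
  case' dim5_c α β γ a hα =>
    obtain ⟨β, rfl⟩ : ∃ t, β = α ^ 2 * t := ⟨β / α ^ 2, by field_simp⟩
    obtain ⟨γ, rfl⟩ : ∃ t, γ = α ^ 2 * t := ⟨γ / α ^ 2, by field_simp⟩
    refine ⟨[(1, 1, ![0, 0, -γ, β, -(a * α⁻¹)]), (1, 2, ![0, 0, 0, 1, 0]),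
      (1, 3, ![0, 0, -1, 0, 0]), (1, 4, ![a, 0, 0, 0, 0])], ?_⟩
  case' dim5_d α a b c d hα hc =>
    obtain ⟨c, rfl⟩ : ∃ t, c = α⁻¹ * t := ⟨α * c, by field_simp⟩
    refine ⟨[(1, 1, ![0, 0, -c, -(d * a), -(d * b)]), (1, 2, ![α⁻¹ * c, 0, 0, 0, 0]),
      (2, 1, ![0, 0, 0, -a, -b]), (1, 3, ![0, 0, 0, 0, d]), (1, 4, ![0, 0, 0, -d, 0]),
      (2, 3, ![0, 0, 0, 0, 1]), (2, 4, ![0, 0, 0, -1, 0])], ?_⟩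
  case' dim6_a α a b c hα =>
    refine ⟨[(1, 1, ![0, 0, -α * (1 + a ^ 2 + b ^ 2 + c ^ 2), α * a, α * b, α * c]),
      (1, 2, ![1, 0, 0, 0, 0, 0])], ?_⟩
  case' dim6_b α β γ μ ν a hα ha =>
    obtain ⟨β, rfl⟩ : ∃ t, β = α ^ 2 * t := ⟨β / α ^ 2, by field_simp⟩
    obtain ⟨γ, rfl⟩ : ∃ t, γ = α ^ 2 * t := ⟨γ / α ^ 2, by field_simp⟩
    obtain ⟨μ, rfl⟩ : ∃ t, μ = α ^ 2 * a * t := ⟨μ / (α ^ 2 * a), by field_simp⟩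
    obtain ⟨ν, rfl⟩ : ∃ t, ν = α ^ 2 * a * t := ⟨ν / (α ^ 2 * a), by field_simp⟩
    refine ⟨[(1, 1, ![0, 0, -γ, β, -ν, μ]), (1, 2, ![0, 0, 0, 1, 0, 0]),
      (1, 3, ![0, 0, -1, 0, 0, 0]), (1, 4, ![0, 0, 0, 0, 0, a]), (1, 5, ![0, 0, 0, 0, -a, 0])], ?_⟩
  case' dim6_c α β γ a b hα =>
    obtain ⟨β, rfl⟩ : ∃ t, β = α ^ 2 * t := ⟨β / α ^ 2, by field_simp⟩
    obtain ⟨γ, rfl⟩ : ∃ t, γ = α ^ 2 * t := ⟨γ / α ^ 2, by field_simp⟩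
    refine ⟨[(1, 1, ![0, 0, -γ, β, -(a * α⁻¹), -(b * α⁻¹)]), (1, 2, ![0, 0, 0, 1, 0, 0]),
      (1, 3, ![0, 0, -1, 0, 0, 0]), (1, 4, ![a, 0, 0, 0, 0, 0]), (1, 5, ![b, 0, 0, 0, 0, 0])], ?_⟩
  case' dim6_d ρ₁ ρ₂ ω₁ ω₂ μ β γ a b hρ₁ hρ₂ hω hμ =>
    have hD : ρ₁ ^ 2 * ρ₂ ^ 2 - μ ^ 2 ≠ 0 := by
      have : ρ₁ ^ 2 * ρ₂ ^ 2 - μ ^ 2 = (ρ₁ * ρ₂ * Real.sin (ω₁ - ω₂)) ^ 2 := by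
        rw [hμ, mul_pow _ (Real.sin _), Real.sin_sq]
        ring
      rw [this]
      positivity
    obtain ⟨x, y, ha, hb⟩ : ∃ x y, a = -(ρ₁ ^ 2 * x + μ * y) ∧ b = -(μ * x + ρ₂ ^ 2 * y) := by
      generalize hd : ρ₁ ^ 2 * ρ₂ ^ 2 - μ ^ 2 = D at hD
      refine ⟨-(a * ρ₂ ^ 2 - b * μ) / D, -(b * ρ₁ ^ 2 - a * μ) / D, ?_, ?_⟩
      · field_simp
        linear_combination -a * hd
      · field_simp
        linear_combination -b * hd
    clear hD hμ hω
    subst ha hb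
    refine ⟨[(1, 1, ![-(x * β + y * γ), 0, x, y, -β, -γ]),
      (1, 2, ![-(ρ₁ ^ 2 * x + μ * y), 0, 0, 0, 0, 0]),
      (1, 3, ![-(μ * x + ρ₂ ^ 2 * y), 0, 0, 0, 0, 0]),
      (1, 4, ![β, 0, 0, 0, 0, 0]), (1, 5, ![γ, 0, 0, 0, 0, 0]),
      (4, 1, ![β, 0, -1, 0, 0, 0]), (5, 1, ![γ, 0, 0, -1, 0, 0]),
      (4, 2, ![ρ₁ ^ 2, 0, 0, 0, 0, 0]), (4, 3, ![μ, 0, 0, 0, 0, 0]),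
      (5, 2, ![μ, 0, 0, 0, 0, 0]), (5, 3, ![ρ₂ ^ 2, 0, 0, 0, 0, 0])], ?_⟩
  case' dim6_e α β a b c d e hα hde =>
    obtain ⟨β, rfl⟩ : ∃ t, β = α * t := ⟨β / α, by field_simp⟩
    obtain ⟨x, rfl⟩ : ∃ x, a = -x + α * d * (b + d * x) + α * e * (c + e * x) :=
      ⟨(a - α * d * b - α * e * c) / (α * (d ^ 2 + e ^ 2) - 1), by
        have : α * (d ^ 2 + e ^ 2) - 1 ≠ 0 := by linarith
        field_simp
        ring⟩
    refine ⟨[(1, 1, ![-(x * β), 0, x, -(α * (b + d * x)), -(α * (c + e * x)), -(α * β)]),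
      (1, 2, ![-x + α * d * (b + d * x) + α * e * (c + e * x), 0, 0, 0, 0, 0]),
      (1, 3, ![b, 0, 0, 0, 0, 0]), (1, 4, ![c, 0, 0, 0, 0, 0]),
      (1, 5, ![β, 0, 0, 0, 0, 0]), (5, 1, ![β, 0, -1, 0, 0, 0]), (5, 2, ![1, 0, 0, 0, 0, 0]),
      (5, 3, ![d, 0, 0, 0, 0, 0]), (5, 4, ![e, 0, 0, 0, 0, 0])], ?_⟩
  case' dim6_f α β γ μ ν a hα hβ =>
    obtain ⟨γ, rfl⟩ : ∃ t, γ = β * t := ⟨γ / β, by field_simp⟩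
    obtain ⟨μ, rfl⟩ : ∃ t, μ = β * t := ⟨μ / β, by field_simp⟩
    obtain ⟨ν, rfl⟩ : ∃ t, ν = α * β * t := ⟨ν / (α * β), by field_simp⟩
    refine ⟨[(1, 1, ![a * β * ν, 0, -μ, γ, -a, -(α * ν)]), (1, 2, ![0, 0, 0, 1, 0, 0]),
      (1, 3, ![0, 0, -1, 0, 0, 0]), (1, 4, ![a, 0, 0, 0, 0, 0]), (1, 5, ![β * ν, 0, 0, 0, 0, 0]),
      (5, 1, ![β * ν, 0, 0, 0, -1, 0]), (5, 4, ![1, 0, 0, 0, 0, 0])], ?_⟩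
  case' dim6_g ρ ω X Y α β γ μ hρ hX hY =>
    have hs : ρ ^ 2 = X ^ 2 + Y ^ 2 := by
      rw [hX, hY, mul_pow, mul_pow, Real.sin_sq]
      ring
    rw [hs]
    refine ⟨[(1, 1, ![-((-β + μ * Y - γ * X) * α + (α - μ * X - γ * Y) * β), 0,
        -β + μ * Y - γ * X, α - μ * X - γ * Y, -μ, γ]),
      (1, 2, ![0, 0, 0, 1, 0, 0]), (1, 3, ![0, 0, -1, 0, 0, 0]),
      (1, 4, ![X * α + Y * β, 0, 0, 0, 0, 1]), (1, 5, ![X * β - Y * α, 0, 0, 0, -1, 0]),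
      (4, 1, ![X * α + Y * β, 0, -X, -Y, 0, 0]), (5, 1, ![X * β - Y * α, 0, Y, -X, 0, 0]),
      (4, 2, ![X, 0, 0, 0, 0, 0]), (4, 3, ![Y, 0, 0, 0, 0, 0]),
      (4, 5, ![X ^ 2 + Y ^ 2, 0, 0, 0, 0, 0]), (5, 2, ![-Y, 0, 0, 0, 0, 0]),
      (5, 3, ![X, 0, 0, 0, 0, 0]), (5, 4, ![-(X ^ 2 + Y ^ 2), 0, 0, 0, 0, 0])], ?_⟩
  case' dim6_h α β γ a b c d e f hα hβ hγ hade =>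
    obtain ⟨γ, rfl⟩ : ∃ t, γ = α * t := ⟨γ / α, by field_simp⟩
    obtain ⟨d, rfl⟩ : ∃ t, d = α⁻¹ * t := ⟨α * d, by field_simp⟩
    obtain ⟨e, rfl⟩ : ∃ t, e = α⁻¹ * t := ⟨α * e, by field_simp⟩
    obtain rfl : β = α⁻¹ + α * γ ^ 2 := by
      field_simp
      linear_combination hγ
    refine ⟨[(1, 1, ![0, 0, α * (-d + e * γ), α * d * γ - e * (α⁻¹ + α * γ ^ 2), -(f * b),
      -(f * c)]),
      (1, 2, ![α⁻¹ * d, 0, 0, 0, 0, 0]), (2, 1, ![0, 0, 0, -a, -b, -c]),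
      (1, 3, ![α⁻¹ * e, 0, 0, 0, 0, 0]), (1, 4, ![0, 0, 0, 0, 0, f]), (1, 5, ![0, 0, 0, 0, -f, 0]),
      (2, 2, ![a * γ, 0, 0, 0, 0, 0]), (2, 3, ![a, 0, 0, 0, 0, 0]),
      (2, 4, ![0, 0, 0, 0, 0, 1]), (2, 5, ![0, 0, 0, 0, -1, 0])], ?_⟩
  all_goals
    refine ⟨fun x y => ?_, fun x y => ?_, fun x y z => ?_⟩
    case' refine_2 => ext k; fin_cases k
    case' refine_3 => ext k; fin_cases k
    all_goals
      simp [Entry.bracket_apply, tableMul_cons, tableMul_nil, Fin.sum_univ_succ, dotProduct,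
        Matrix.mulVec]
      try ring

/-! ### Realizations of the listed entries -/

section

variable {n : ℕ} {E : Entry n} {g : Type*} [LieRing g] [LieAlgebra ℝ g]
  {B : LinearMap.BilinForm ℝ g} {b : Basis (Fin n) ℝ g}

theorem Entry.Realizes.isLorentzian {i₀ i₁ : Fin n} (h : E.Realizes B b)
    (hE : E.IsNullGram i₀ i₁) : IsLorentzian B := by
  have : FiniteDimensional ℝ g := b.finiteDimensional_of_finite
  have hsymm : E.gram.transpose = E.gram := Matrix.ext fun i j => hE.symm j i
  refine isLorentzian_of_null (z := b i₀) (w := b i₁) (fun u v => ?_) ?_ ?_ fun x hx => ?_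
  · rw [h.apply_eq, h.apply_eq, Matrix.dotProduct_mulVec, ← Matrix.mulVec_transpose, hsymm,
      dotProduct_comm]
  · rw [h.2, hE.gram_eq _ hE.ne]
  · rw [h.2]
    exact hE.gram_ne
  · have hx1 : b.equivFun x i₁ = 0 := by
      have h1 : B (b i₀) x = E.gram i₀ i₁ * b.equivFun x i₁ := by
        conv_lhs => rw [← b.sum_equivFun x]
        rw [map_sum, Finset.sum_eq_single i₁]
        · simp [h.2, mul_comm]
        · intro j _ hj
          simp [h.2, hE.gram_eq j hj]
        · simp
      rw [hx] at h1
      exact (mul_eq_zero.1 h1.symm).resolve_left hE.gram_ne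
    by_cases hp : 0 < B x x
    · exact Or.inl hp
    · refine Or.inr ⟨b.equivFun x i₀, ?_⟩
      rw [h.apply_eq, not_lt] at hp
      conv_lhs => rw [← b.sum_equivFun x]
      rw [Finset.sum_eq_single i₀]
      · intro j _ hj
        rw [hE.pos _ hx1 hp j hj, zero_smul]
      · simp

theorem Entry.Realizes.hasDegenerateCenter {i₀ i₁ : Fin n} (h : E.Realizes B b)
    (hG : E.IsNullGram i₀ i₁) (hE : E.HasCenterAt i₀ i₁) : HasDegenerateCenter B := by
  have hc : ∀ w : g, w ∈ LieAlgebra.center ℝ g ↔ ∀ y, E.bracket (b.equivFun w) y = 0 := by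
    intro w
    rw [LieModule.mem_maxTrivSubmodule]
    constructor
    · intro hw y
      obtain ⟨y, rfl⟩ := b.equivFun.surjective y
      rw [← h.equivFun_lie, ← lie_skew, hw, neg_zero, map_zero]
    · intro hw y
      apply b.equivFun.injective
      rw [h.equivFun_lie, Entry.bracket_swap, hw, neg_zero, map_zero]
  refine ⟨b i₀, ?_, b.ne_zero i₀, fun w hw => ?_⟩
  · rw [hc]
    intro y
    have : b.equivFun (b i₀) = Pi.single i₀ 1 := by
      ext j; simp [Pi.single_apply, eq_comm]
    rw [this, hE.central]
  · conv_lhs => rw [← b.sum_equivFun w]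
    rw [map_sum]
    refine Finset.sum_eq_zero fun j _ => ?_
    by_cases hj : j = i₁
    · rw [hj, hE.eq_zero _ ((hc w).1 hw), zero_smul, map_zero]
    · rw [map_smul, h.2, hG.gram_eq j hj, smul_zero]

theorem IsListed.isLorentzian_and_isFlat_and_degenerate (hE : IsListed n E) (h : E.Realizes B b) :
    IsLorentzian B ∧ IsFlatMetric B ∧ HasDegenerateCenter B := by
  obtain ⟨l, hl⟩ := hE.exists_isFlatTable
  obtain ⟨i₀, i₁, hc, hG⟩ := hE.hasCenterAt
  exact ⟨h.isLorentzian hG, h.isFlatMetric hl, h.hasDegenerateCenter hG hc⟩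

theorem Entry.structureConst_swap (E : Entry n) (i j : Fin n) :
    E.structureConst i j = -E.structureConst j i := by
  rw [← Entry.bracket_single, Entry.bracket_swap, Entry.bracket_single]

theorem Entry.structureConst_self (E : Entry n) (i : Fin n) : E.structureConst i i = 0 := by
  rw [← Entry.bracket_single, Entry.bracket_apply, sub_self]

/-- A family of vectors with the brackets and the products of a listed entry is a basis, as its
Gram matrix is nonsingular. -/
theorem IsListed.exists_realizes [FiniteDimensional ℝ g] (hE : IsListed n E)
    (hB : ∀ u v, B u v = B v u) (hn : finrank ℝ g = n) (v : Fin n → g)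
    (hv : ∀ i j, i < j → ⁅v i, v j⁆ = ∑ k, E.structureConst i j k • v k)
    (hG : ∀ i j, i ≤ j → B (v i) (v j) = E.gram i j) :
    ∃ b : Basis (Fin n) ℝ g, E.Realizes B b := by
  obtain ⟨i₀, i₁, -, hE'⟩ := hE.hasCenterAt
  have hG' : ∀ i j, B (v i) (v j) = E.gram i j := fun i j => by
    rcases le_total i j with hij | hij
    · exact hG i j hij
    · rw [hB, hG j i hij, hE'.symm]
  have hv' : ∀ i j, ⁅v i, v j⁆ = ∑ k, E.structureConst i j k • v k := fun i j => by
    rcases lt_trichotomy i j with hij | rfl | hij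
    · exact hv i j hij
    · simp [Entry.structureConst_self]
    · rw [← lie_skew, hv j i hij, E.structureConst_swap i j]
      simp
  obtain ⟨b, rfl⟩ := exists_basis_of_gram (B := B) hn v (by
    intro c hc
    simp only [hG'] at hc
    have h1 : c i₁ = 0 := by
      have := hc i₀
      rw [Finset.sum_eq_single i₁ (fun j _ hj => by rw [hE'.symm, hE'.gram_eq j hj, mul_zero])
        (by simp), hE'.symm] at this
      exact (mul_eq_zero.1 this).resolve_right hE'.gram_ne
    have h2 : ∀ k, k ≠ i₀ → c k = 0 := by
      refine hE'.pos c h1 (le_of_eq ?_)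
      rw [Matrix.dotProduct_mulVec]
      refine Finset.sum_eq_zero fun j _ => ?_
      rw [Matrix.vecMul, dotProduct, hc j, zero_mul]
    have h3 : c i₀ = 0 := by
      have := hc i₁
      rw [Finset.sum_eq_single i₀ (fun j _ hj => by rw [h2 j hj, zero_mul]) (by simp)] at this
      exact (mul_eq_zero.1 this).resolve_right hE'.gram_ne
    ext k
    by_cases hk : k = i₀
    · rw [hk, h3]; rfl
    · exact h2 k hk)
  exact ⟨b, hv', hG'⟩

end

/-! ### Flat Lorentzian Lie algebras with degenerate center as extensions -/

/-- The data of a double extension of a flat Euclidean algebra `(V, P)` by a line: `g` is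
`ℝ z ⊕ ℝ z̄ ⊕ V` with `z` central and orthogonal to `z ⊕ V`; `P` is the Levi-Civita product of
`V`, while `A`, `ξ` and `b₀` are the `V`-components of `a ↦ z̄ a`, `a ↦ a z̄` and `z̄ z̄`. The laws
are what flatness of `g` amounts to. -/
structure FlatExtension (V : Type*) [NormedAddCommGroup V] [InnerProductSpace ℝ V] where
  P : V →ₗ[ℝ] V →ₗ[ℝ] V
  A : V →ₗ[ℝ] V
  ξ : V →ₗ[ℝ] V
  b₀ : V
  P_skew : ∀ a b c, inner ℝ (P a b) c = -inner ℝ b (P a c)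
  A_skew : ∀ a b, inner ℝ (A a) b = -inner ℝ a (A b)
  P_flat : ∀ a b c, P (P a b - P b a) c = P a (P b c) - P b (P a c)
  ξ_cocycle : ∀ a b, ξ (P a b - P b a) = P a (ξ b) - P b (ξ a)
  P_derivation : ∀ a b, P (A a - ξ a) b = A (P a b) - P a (A b)
  A_ξ : ∀ a, A (ξ a) - ξ (A a) = P a b₀ - ξ (ξ a)

namespace FlatExtension

variable {V : Type*} [NormedAddCommGroup V] [InnerProductSpace ℝ V] (D : FlatExtension V)

/-- The bracket of the double extension; the triple `(x, y, a)` stands for `x z + y z̄ + a`. -/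
noncomputable def bracket (p q : ℝ × ℝ × V) : ℝ × ℝ × V :=
  (q.2.1 * inner ℝ D.b₀ p.2.2 - p.2.1 * inner ℝ D.b₀ q.2.2 +
      (inner ℝ p.2.2 (D.ξ q.2.2) - inner ℝ q.2.2 (D.ξ p.2.2)), 0,
    p.2.1 • (D.A q.2.2 - D.ξ q.2.2) - q.2.1 • (D.A p.2.2 - D.ξ p.2.2) +
      (D.P p.2.2 q.2.2 - D.P q.2.2 p.2.2))

end FlatExtension

section

variable {g : Type*} [LieRing g] [LieAlgebra ℝ g] {B : LinearMap.BilinForm ℝ g}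
  {L : g →ₗ[ℝ] Module.End ℝ g}

theorem IsLorentzian.eq_smul_of_null [FiniteDimensional ℝ g] (h : IsLorentzian B) {x y : g}
    (hx : x ≠ 0) (hxx : B x x = 0) (hxy : B x y = 0) (hyy : B y y = 0) : ∃ t : ℝ, y = t • x := by
  obtain ⟨m, Φ, hΦ, rfl⟩ := h.exists_isSplitting hx hxx
  obtain ⟨p, rfl⟩ := Φ.surjective y
  have h1 := hΦ (1, 0, 0) p
  have h2 := hΦ p p
  rw [hxy] at h1
  rw [hyy] at h2
  simp only [one_mul, zero_mul, inner_zero_left, add_zero] at h1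
  simp only [← h1, mul_zero, zero_mul, zero_add] at h2
  refine ⟨p.1, ?_⟩
  rw [← map_smul]
  congr 1
  exact Prod.ext (by simp) (Prod.ext (by simp [← h1]) (by simpa using inner_self_eq_zero.1 h2.symm))

theorem IsLorentzian.eq_zero_of_forall (h : IsLorentzian B) {u : g} (hu : ∀ w, B u w = 0) :
    u = 0 := by
  obtain ⟨m, b, hb⟩ := h
  apply b.repr.injective
  ext j
  have := hu (b j)
  rw [← b.sum_repr u] at this
  simp only [map_sum, map_smul, LinearMap.sum_apply, LinearMap.smul_apply, hb, smul_eq_mul,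
    mul_ite, mul_zero, Finset.sum_ite_eq', Finset.mem_univ, if_true] at this
  split_ifs at this <;> simpa using this

theorem IsLeviCivitaProduct.skew (hL : IsLeviCivitaProduct B L) (u v w : g) :
    B (L u v) w = -B (L u w) v := by
  have h1 := hL u v w
  have h2 := hL u w v
  rw [← lie_skew u w, ← lie_skew v u, ← lie_skew v w] at h2
  simp only [map_neg, LinearMap.neg_apply] at h2
  linarith

theorem IsLeviCivitaProduct.torsion (hL : IsLeviCivitaProduct B L) (hB : IsLorentzian B)
    (u v : g) : L u v - L v u = ⁅u, v⁆ := by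
  rw [← sub_eq_zero]
  refine hB.eq_zero_of_forall fun w => ?_
  have h1 := hL u v w
  have h2 := hL v u w
  rw [← lie_skew v u] at h2
  simp only [map_neg, map_sub, LinearMap.sub_apply, LinearMap.neg_apply] at h1 h2 ⊢
  linarith

/-- In a flat Lorentzian Lie algebra the Levi-Civita operator of a central element vanishes: its
square is zero, so that its range is totally null, hence a line, and a skew operator has even
rank. -/
theorem IsLeviCivitaProduct.eq_zero_of_central [FiniteDimensional ℝ g]
    (hL : IsLeviCivitaProduct B L) (hB : IsLorentzian B)
    (hflat : ∀ u v : g, L ⁅u, v⁆ - (L u * L v - L v * L u) = 0) {z : g} (hz : ∀ v : g, ⁅z, v⁆ = 0) :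
    L z = 0 := by
  have hcomm : ∀ v, L v z = L z v := fun v => by
    rw [← sub_eq_zero, hL.torsion hB, ← lie_skew, hz, neg_zero]
  have hzz : L z z = 0 := hB.eq_zero_of_forall fun w => by
    have := hL z z w
    rw [← lie_skew w z] at this
    simp only [hz, map_zero, LinearMap.zero_apply, neg_zero, add_zero] at this
    linarith
  have hsq : ∀ v, L z (L z v) = 0 := fun v => by
    have := LinearMap.congr_fun (hflat z v) z
    rw [hz, map_zero, zero_sub] at this
    simp only [LinearMap.neg_apply, LinearMap.sub_apply, Module.End.mul_apply, hzz, map_zero,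
      sub_zero, LinearMap.zero_apply, neg_eq_zero, hcomm v] at this
    exact this
  have hnull : ∀ u v, B (L z u) (L z v) = 0 := fun u v => by
    rw [hL.skew, hsq, map_zero, LinearMap.zero_apply, neg_zero]
  ext v
  by_contra hp
  rw [LinearMap.zero_apply] at hp
  have hline := fun w => hB.eq_smul_of_null hp (hnull v v) (hnull v w) (hnull w w)
  have hself : ∀ w, B (L z w) w = 0 := fun w => by linarith [hL.skew z w w]
  have hvan : ∀ w, B (L z v) w ≠ 0 → L z w = 0 := fun w hw => by
    obtain ⟨t, ht⟩ := hline w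
    have := hself w
    rw [ht, map_smul, LinearMap.smul_apply, smul_eq_mul, mul_eq_zero] at this
    rw [ht, this.resolve_right hw, zero_smul]
  obtain ⟨w, hw⟩ : ∃ w, B (L z v) w ≠ 0 := by
    by_contra! hall
    exact hp (hB.eq_zero_of_forall hall)
  have h1 := hvan (v + w) (by rw [map_add, hself, zero_add]; exact hw)
  rw [map_add, hvan w hw, add_zero] at h1
  exact hp h1

/-- A flat Lorentzian Lie algebra with degenerate center is a double extension. -/
theorem exists_flatExtension [FiniteDimensional ℝ g] (hB : IsLorentzian B) (hF : IsFlatMetric B)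
    (hC : HasDegenerateCenter B) :
    ∃ (m : ℕ) (Φ : (ℝ × ℝ × EuclideanSpace ℝ (Fin m)) ≃ₗ[ℝ] g)
      (D : FlatExtension (EuclideanSpace ℝ (Fin m))), IsSplitting B Φ ∧
      (∀ p q, ⁅Φ p, Φ q⁆ = Φ (D.bracket p q)) ∧
      ∀ p, (∀ q, D.bracket p q = 0) → p.2.1 = 0 := by
  obtain ⟨z, hzc, hz0, hzC⟩ := hC
  obtain ⟨L, hL, hflat⟩ := hF
  replace hL : IsLeviCivitaProduct B L := hL
  have hz : ∀ v : g, ⁅z, v⁆ = 0 := fun v => by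
    rw [← lie_skew, (LieModule.mem_maxTrivSubmodule ℝ g g z).1 hzc v, neg_zero]
  have hLz := hL.eq_zero_of_central hB hflat hz
  have hLz' : ∀ u, L u z = 0 := fun u => by
    have := hL.torsion hB u z
    rwa [hLz, LinearMap.zero_apply, sub_zero, ← lie_skew, hz, neg_zero] at this
  obtain ⟨m, Φ, hΦ, hΦz⟩ := hB.exists_isSplitting hz0 (hzC z hzc)
  let π : g →ₗ[ℝ] EuclideanSpace ℝ (Fin m) :=
    (LinearMap.snd ℝ ℝ _ ∘ₗ LinearMap.snd ℝ ℝ _) ∘ₗ (Φ.symm : g →ₗ[ℝ] _)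
  let i : EuclideanSpace ℝ (Fin m) →ₗ[ℝ] g :=
    (Φ : _ →ₗ[ℝ] g) ∘ₗ LinearMap.inr ℝ ℝ _ ∘ₗ LinearMap.inr ℝ ℝ _
  have hi : ∀ a, i a = Φ (0, 0, a) := fun a => rfl
  have hπ : ∀ p, π (Φ p) = p.2.2 := fun p => by simp [π]
  set w := Φ (0, 1, 0) with hw
  have hΦp : ∀ p, Φ p = p.1 • z + p.2.1 • w + i p.2.2 := fun p => by
    rw [← hΦz, hw, hi, ← map_smul, ← map_smul, ← map_add, ← map_add]
    congr 1
    simp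
  have hexp : ∀ u, u = Φ (B u w, B u z, π u) := fun u => by
    obtain ⟨p, rfl⟩ := Φ.surjective u
    rw [hπ, hw, ← hΦz, hΦ, hΦ]
    simp
  have hBπ : ∀ u a, B u (i a) = inner ℝ (π u) a := fun u a => by
    obtain ⟨p, rfl⟩ := Φ.surjective u
    rw [hπ, hi, hΦ]
    simp
  let P : EuclideanSpace ℝ (Fin m) →ₗ[ℝ] EuclideanSpace ℝ (Fin m) →ₗ[ℝ]
      EuclideanSpace ℝ (Fin m) := (L.compl₁₂ i i).compr₂ π
  let A : EuclideanSpace ℝ (Fin m) →ₗ[ℝ] EuclideanSpace ℝ (Fin m) := π ∘ₗ L w ∘ₗ i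
  let ξ : EuclideanSpace ℝ (Fin m) →ₗ[ℝ] EuclideanSpace ℝ (Fin m) := π ∘ₗ L.flip w ∘ₗ i
  let b₀ := π (L w w)
  have hP : ∀ a b, P a b = π (L (i a) (i b)) := fun a b => rfl
  have hA : ∀ a, A a = π (L w (i a)) := fun a => rfl
  have hξ : ∀ a, ξ a = π (L (i a) w) := fun a => rfl
  have hLBz : ∀ u v, B (L u v) z = 0 := fun u v => by
    rw [hL.skew, hLz', map_zero, LinearMap.zero_apply, neg_zero]
  have hLBw : ∀ u, B (L u w) w = 0 := fun u => by linarith [hL.skew u w w]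
  have hLab : ∀ a b, L (i a) (i b) = Φ (-inner ℝ b (ξ a), 0, P a b) := fun a b => by
    rw [hexp (L (i a) (i b)), hLBz, hL.skew, hBπ, real_inner_comm, hP, hξ]
  have hLwa : ∀ a, L w (i a) = Φ (-inner ℝ a b₀, 0, A a) := fun a => by
    rw [hexp (L w (i a)), hLBz, hL.skew, hBπ, real_inner_comm]
    rfl
  have hLaw : ∀ a, L (i a) w = Φ (0, 0, ξ a) := fun a => by
    rw [hexp (L (i a) w), hLBz, hLBw]
    rfl
  have hLww : L w w = Φ (0, 0, b₀) := by
    rw [hexp (L w w), hLBz, hLBw]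
  -- The Levi-Civita product in terms of the splitting.
  have hmul : ∀ p q, L (Φ p) (Φ q) =
      Φ (-(p.2.1 * inner ℝ q.2.2 b₀) - inner ℝ q.2.2 (ξ p.2.2), 0,
        (p.2.1 * q.2.1) • b₀ + p.2.1 • A q.2.2 + q.2.1 • ξ p.2.2 + P p.2.2 q.2.2) := fun p q => by
    rw [hΦp p, hΦp q]
    simp only [map_add, map_smul, LinearMap.add_apply, LinearMap.smul_apply, hLz, hLz',
      smul_zero, zero_add, hLab, hLwa, hLaw, hLww]
    simp only [← map_smul Φ, ← map_add Φ]
    congr 1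
    refine Prod.ext ?_ (Prod.ext ?_ ?_)
    · simp only [Prod.fst_add, Prod.smul_fst, smul_eq_mul]
      ring
    · simp
    · simp only [Prod.snd_add, Prod.smul_snd]
      module
  have hlie : ∀ p q, ⁅Φ p, Φ q⁆ = Φ (-(p.2.1 * inner ℝ q.2.2 b₀) - inner ℝ q.2.2 (ξ p.2.2) -
      (-(q.2.1 * inner ℝ p.2.2 b₀) - inner ℝ p.2.2 (ξ q.2.2)), 0,
      (p.2.1 * q.2.1) • b₀ + p.2.1 • A q.2.2 + q.2.1 • ξ p.2.2 + P p.2.2 q.2.2 -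
      ((q.2.1 * p.2.1) • b₀ + q.2.1 • A p.2.2 + p.2.1 • ξ q.2.2 + P q.2.2 p.2.2)) := fun p q => by
    rw [← hL.torsion hB, hmul, hmul, ← map_sub]
    congr 1
    simp
  have hfl : ∀ p q r, π (L ⁅Φ p, Φ q⁆ (Φ r)) =
      π (L (Φ p) (L (Φ q) (Φ r))) - π (L (Φ q) (L (Φ p) (Φ r))) := fun p q r => by
    have := LinearMap.congr_fun (hflat (Φ p) (Φ q)) (Φ r)
    simp only [LinearMap.sub_apply, Module.End.mul_apply, LinearMap.zero_apply, sub_eq_zero] at this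
    rw [this, map_sub]
  have hA_skew : ∀ a b, inner ℝ (A a) b = -inner ℝ a (A b) := fun a b => by
    rw [real_inner_comm _ a, hA, hA, ← hBπ, ← hBπ, hL.skew]
  have hP_skew : ∀ a b c, inner ℝ (P a b) c = -inner ℝ b (P a c) := fun a b c => by
    rw [real_inner_comm _ b, hP, hP, ← hBπ, ← hBπ, hL.skew]
  simp only [hlie, hmul, hπ] at hfl
  let D : FlatExtension (EuclideanSpace ℝ (Fin m)) :=
    { P := P, A := A, ξ := ξ, b₀ := b₀
      P_skew := hP_skew
      A_skew := hA_skew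
      P_flat := fun a b c => by simpa using hfl (0, 0, a) (0, 0, b) (0, 0, c)
      ξ_cocycle := fun a b => by simpa using hfl (0, 0, a) (0, 0, b) (0, 1, 0)
      P_derivation := fun a b => by simpa using hfl (0, 1, 0) (0, 0, a) (0, 0, b)
      A_ξ := fun a => by
        have := hfl (0, 1, 0) (0, 0, a) (0, 1, 0)
        simp at this
        rw [sub_eq_sub_iff_add_eq_add] at this ⊢
        rw [← this, add_comm] }
  have hbr : ∀ p q, ⁅Φ p, Φ q⁆ = Φ (D.bracket p q) := fun p q => by
    rw [hlie, FlatExtension.bracket]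
    congr 1
    refine Prod.ext ?_ (Prod.ext rfl ?_)
    · simp only [D, real_inner_comm b₀]
      ring
    · simp only [D]
      module
  refine ⟨m, Φ, D, hΦ, hbr, fun p hp => ?_⟩
  have hpc : Φ p ∈ LieAlgebra.center ℝ g := by
    rw [LieModule.mem_maxTrivSubmodule]
    intro u
    obtain ⟨q, rfl⟩ := Φ.surjective u
    rw [← lie_skew, hbr, hp, map_zero, neg_zero]
  have := hzC _ hpc
  rw [← hΦz, hΦ] at this
  simpa using this

end

/-! ### Flat Euclidean Lie algebras -/

section

variable {V : Type*} [NormedAddCommGroup V] [InnerProductSpace ℝ V] [FiniteDimensional ℝ V]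

/-- A product on a Euclidean space by skew operators whose curvature with respect to its own
commutator vanishes, that is, the Levi-Civita product of a flat Euclidean Lie algebra. -/
structure IsFlatEuclidean (P : V →ₗ[ℝ] V →ₗ[ℝ] V) : Prop where
  skew : ∀ a b c, inner ℝ (P a b) c = -inner ℝ b (P a c)
  flat : ∀ a b c, P (P a b - P b a) c = P a (P b c) - P b (P a c)

namespace IsFlatEuclidean

variable {P : V →ₗ[ℝ] V →ₗ[ℝ] V}

/-- The Gram operator `T` of the invariant form `-tr (P a P b)`. -/
theorem exists_gram_operator (hP : IsFlatEuclidean P) :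
    ∃ T : V →ₗ[ℝ] V, T.IsSymmetric ∧ (∀ a, 0 ≤ inner ℝ (T a) a) ∧
      (∀ a, inner ℝ (T a) a = 0 → P a = 0) ∧
      ∀ a b c, inner ℝ (T (P a b - P b a)) c = -inner ℝ (T (P a c - P c a)) b := by
  let e := stdOrthonormalBasis ℝ V
  let T : V →ₗ[ℝ] V := ∑ i, LinearMap.adjoint (P.flip (e i)) ∘ₗ P.flip (e i)
  have hT : ∀ a b, inner ℝ (T a) b = ∑ i, inner ℝ (P a (e i)) (P b (e i)) := fun a b => by
    simp [T, LinearMap.sum_apply, sum_inner, LinearMap.adjoint_inner_left]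
  have htr : ∀ a b, inner ℝ (T a) b = -LinearMap.trace ℝ V (P a * P b) := fun a b => by
    rw [hT, LinearMap.trace_eq_sum_inner _ e, ← Finset.sum_neg_distrib]
    refine Finset.sum_congr rfl fun i _ => ?_
    rw [Module.End.mul_apply, hP.skew]
  have hbr : ∀ a b, P (P a b - P b a) = P a * P b - P b * P a := fun a b => by
    ext c
    exact hP.flat a b c
  refine ⟨T, fun a b => ?_, fun a => ?_, fun a ha => ?_, fun a b c => ?_⟩
  · rw [hT, ← real_inner_comm a, hT]
    exact Finset.sum_congr rfl fun i _ => real_inner_comm _ _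
  · rw [hT]
    exact Finset.sum_nonneg fun i _ => real_inner_self_nonneg
  · rw [hT, Finset.sum_eq_zero_iff_of_nonneg fun i _ => real_inner_self_nonneg] at ha
    exact e.toBasis.ext fun i => by simpa using ha i (Finset.mem_univ i)
  · have hcyc : ∀ X Y Z : Module.End ℝ V,
        LinearMap.trace ℝ V (X * Y * Z) = LinearMap.trace ℝ V (Y * Z * X) := fun X Y Z => by
      rw [mul_assoc, LinearMap.trace_mul_comm]
    rw [htr, htr, hbr, hbr, sub_mul, sub_mul, map_sub, map_sub]
    linarith [hcyc (P b) (P a) (P c), hcyc (P c) (P a) (P b)]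

/-- In a flat Euclidean Lie algebra the product of a commutator vanishes. In an orthonormal
eigenbasis of the Gram operator of `-tr (P a P b)`, with eigenvalues `tᵢ`, the numbers
`ωᵢⱼₗ = tₗ ⟪[uᵢ, uⱼ], uₗ⟫` are alternating, and the vanishing of the Ricci curvature reads
`∑ⱼₗ ωᵢⱼₗ² (rᵢ² - (rⱼ - rₗ)²) = 0` with `r = 1 / t`. For the largest `rᵢ` that occurs in some
`ωᵢⱼₗ ≠ 0` all these terms are nonnegative, and one of them is positive. -/
theorem apply_commutator (hP : IsFlatEuclidean P) (a b : V) : P (P a b - P b a) = 0 := by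
  obtain ⟨T, hT, hT0, hTP, hTinv⟩ := hP.exists_gram_operator
  let u := hT.eigenvectorBasis rfl
  let t := hT.eigenvalues rfl
  have hu : ∀ i, T (u i) = t i • u i := fun i => hT.apply_eigenvectorBasis rfl i
  have ht0 : ∀ i, 0 ≤ t i := fun i => by
    have := hT0 (u i)
    rwa [hu, inner_smul_left, real_inner_self_eq_norm_sq, u.norm_eq_one, one_pow, mul_one] at this
  have htP : ∀ i, t i = 0 → P (u i) = 0 := fun i hi => hTP _ (by rw [hu, hi]; simp)
  let Γ : Fin (finrank ℝ V) → Fin (finrank ℝ V) → Fin (finrank ℝ V) → ℝ :=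
    fun i j l => inner ℝ (P (u i) (u j)) (u l)
  have hΓ : ∀ i j l, Γ i j l = -Γ i l j := fun i j l => by
    simp only [Γ]
    rw [hP.skew, real_inner_comm]
  let ω : Fin (finrank ℝ V) → Fin (finrank ℝ V) → Fin (finrank ℝ V) → ℝ :=
    fun i j l => t l * (Γ i j l - Γ j i l)
  have hω : ∀ i j l, ω i j l = inner ℝ (T (P (u i) (u j) - P (u j) (u i))) (u l) :=
    fun i j l => by
      rw [hT, hu, inner_smul_right, inner_sub_left]
  have hω1 : ∀ i j l, ω i j l = -ω j i l := fun i j l => by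
    simp only [ω]
    ring
  have hω2 : ∀ i j l, ω i j l = -ω i l j := fun i j l => by rw [hω, hω, hTinv]
  have hωt : ∀ i j l, t l = 0 → ω i j l = 0 := fun i j l hl => by simp [ω, hl]
  have hωt' : ∀ i j l, t j = 0 → ω i j l = 0 := fun i j l hl => by rw [hω2, hωt _ _ _ hl, neg_zero]
  have hωt'' : ∀ i j l, t i = 0 → ω i j l = 0 := fun i j l hl => by
    rw [hω1, hωt' _ _ _ hl, neg_zero]
  let r : Fin (finrank ℝ V) → ℝ := fun i => (t i)⁻¹
  have hΓω : ∀ i j l, t i ≠ 0 → t j ≠ 0 → 2 * Γ i j l = ω i j l * (r l + r j - r i) := by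
    intro i j l hi hj
    by_cases hl : t l = 0
    · rw [hωt _ _ _ hl, zero_mul]
      have h1 : t j * (Γ i l j - Γ l i j) = 0 := by
        change ω i l j = 0
        exact hωt' _ _ _ hl
      have h2 : Γ l i j = 0 := by simp [Γ, htP l hl]
      rw [h2, sub_zero] at h1
      rw [hΓ, (mul_eq_zero.1 h1).resolve_left hj]
      simp
    · have h1 : ω i j l * r l = Γ i j l - Γ j i l := by simp only [ω, r]; field_simp
      have h2 : ω l i j * r j = Γ l i j - Γ i l j := by simp only [ω, r]; field_simp
      have h3 : ω l j i * r i = Γ l j i - Γ j l i := by simp only [ω, r]; field_simp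
      rw [hω1 l i j, hω2 i l j, hΓ i l j] at h2
      rw [hω2 l j i, hω1 l i j, hω2 i l j, hΓ l j i, hΓ j l i] at h3
      linear_combination -h1 - h2 - h3
  -- The sectional curvature of the plane spanned by `u i` and `u j`.
  have hsec : ∀ i j, ∑ l, ω i j l ^ 2 *
      (3 * r l ^ 2 - 2 * r l * (r i + r j) - (r j - r i) ^ 2) = 0 := by
    intro i j
    by_cases hi : t i = 0
    · exact Finset.sum_eq_zero fun l _ => by rw [hωt'' _ _ _ hi]; ring
    by_cases hj : t j = 0
    · exact Finset.sum_eq_zero fun l _ => by rw [hωt' _ _ _ hj]; ring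
    have hjj : P (u j) (u j) = 0 := by
      refine InnerProductSpace.ext_inner_right_basis (𝕜 := ℝ) u.toBasis fun l => ?_
      have h1 := hΓω j j l hj hj
      have h2 : ω j j l = 0 := by linarith [hω1 j j l]
      rw [h2, zero_mul] at h1
      rw [inner_zero_left, OrthonormalBasis.coe_toBasis]
      change Γ j j l = 0
      linarith
    have hcurv := congrArg (fun x => inner ℝ x (u i)) (hP.flat (u i) (u j) (u j))
    simp only [hjj, map_zero, zero_sub, inner_neg_left, hP.skew (u j) (P (u i) (u j)),
      neg_neg] at hcurv
    have hl1 : inner ℝ (P (P (u i) (u j) - P (u j) (u i)) (u j)) (u i) =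
        ∑ l, (Γ i j l - Γ j i l) * Γ l j i := by
      conv_lhs => rw [← u.sum_repr (P (u i) (u j) - P (u j) (u i))]
      rw [map_sum, LinearMap.sum_apply, sum_inner]
      refine Finset.sum_congr rfl fun l _ => ?_
      rw [map_smul, LinearMap.smul_apply, inner_smul_left, u.repr_apply_apply, inner_sub_right,
        real_inner_comm, real_inner_comm (P (u j) (u i))]
      rfl
    have hl2 : inner ℝ (P (u i) (u j)) (P (u j) (u i)) = ∑ l, Γ i j l * Γ j i l := by
      rw [← u.sum_inner_mul_inner]
      exact Finset.sum_congr rfl fun l _ => by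
        rw [real_inner_comm (P (u j) (u i)) (u l)]
    rw [hl1, hl2, ← sub_eq_zero, ← Finset.sum_sub_distrib] at hcurv
    rw [← mul_zero (4 : ℝ), ← hcurv, Finset.mul_sum]
    refine Finset.sum_congr rfl fun l _ => ?_
    have h1 := hΓω i j l hi hj
    have h2 := hΓω j i l hj hi
    rw [hω1 j i l] at h2
    by_cases hl : t l = 0
    · have h0 := hωt i j l hl
      rw [h0] at h1 h2 ⊢
      have h3 : Γ i j l = 0 := by linarith
      have h4 : Γ j i l = 0 := by linarith
      rw [h3, h4]
      ring
    · have h3 := hΓω l j i hl hj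
      rw [hω1 l j i, hω2 j l i, hω1 j i l] at h3
      have e1 : Γ i j l = ω i j l * (r l + r j - r i) / 2 := by linarith
      have e2 : Γ j i l = -ω i j l * (r l + r i - r j) / 2 := by linarith
      have e3 : Γ l j i = -ω i j l * (r i + r j - r l) / 2 := by linarith
      rw [e1, e2, e3]
      ring
  have hric : ∀ i, ∑ j, ∑ l, ω i j l ^ 2 * (r i ^ 2 - (r j - r l) ^ 2) = 0 := by
    intro i
    have h1 : ∑ j, ∑ l, ω i j l ^ 2 * (3 * r l ^ 2 - 2 * r l * (r i + r j) - (r j - r i) ^ 2) = 0 :=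
      Finset.sum_eq_zero fun j _ => hsec i j
    have h2 := h1
    rw [Finset.sum_comm] at h2
    have h3 : ∀ j l, ω i j l ^ 2 = ω i l j ^ 2 := fun j l => by rw [hω2, neg_sq]
    have h4 : (-2 : ℝ) * ∑ j, ∑ l, ω i j l ^ 2 * (r i ^ 2 - (r j - r l) ^ 2) = 0 + 0 := by
      nth_rewrite 1 [← h1]
      rw [← h2, ← Finset.sum_add_distrib, Finset.mul_sum]
      refine Finset.sum_congr rfl fun j _ => ?_
      rw [← Finset.sum_add_distrib, Finset.mul_sum]
      refine Finset.sum_congr rfl fun l _ => ?_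
      rw [h3 l j]
      ring
    linarith
  have hω0 : ∀ i j l, ω i j l = 0 := by
    by_contra! hne
    obtain ⟨i₀, j₀, l₀, hne⟩ := hne
    let S := Finset.univ.filter fun i => ∃ j l, ω i j l ≠ 0
    have hi₀ : i₀ ∈ S := by
      simp only [S, Finset.mem_filter, Finset.mem_univ, true_and]
      exact ⟨j₀, l₀, hne⟩
    obtain ⟨i, hiS, hmax⟩ := S.exists_max_image r ⟨i₀, hi₀⟩
    have hiS' : ∃ j l, ω i j l ≠ 0 := by simpa [S] using hiS
    obtain ⟨j₁, l₁, h1⟩ := hiS'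
    have hrpos : ∀ i, t i ≠ 0 → 0 < r i := fun i hi => inv_pos.2 (lt_of_le_of_ne (ht0 i) hi.symm)
    have hbound : ∀ j l, ω i j l ≠ 0 → 0 < r i ^ 2 - (r j - r l) ^ 2 := by
      intro j l hjl
      have hj := hmax j (by
        simp only [S, Finset.mem_filter, Finset.mem_univ, true_and]
        exact ⟨i, l, by rw [hω1]; exact neg_ne_zero.2 hjl⟩)
      have hl := hmax l (by
        simp only [S, Finset.mem_filter, Finset.mem_univ, true_and]
        exact ⟨i, j, by rw [hω1, hω2]; simpa using hjl⟩)
      have hj0 := hrpos j fun h => hjl (hωt' _ _ _ h)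
      have hl0 := hrpos l fun h => hjl (hωt _ _ _ h)
      nlinarith
    have hnn : ∀ j l, 0 ≤ ω i j l ^ 2 * (r i ^ 2 - (r j - r l) ^ 2) := fun j l => by
      by_cases h : ω i j l = 0
      · simp [h]
      · exact mul_nonneg (sq_nonneg _) (hbound j l h).le
    have h2 := hric i
    rw [Finset.sum_eq_zero_iff_of_nonneg fun j _ => Finset.sum_nonneg fun l _ => hnn j l] at h2
    have h3 := h2 j₁ (Finset.mem_univ _)
    rw [Finset.sum_eq_zero_iff_of_nonneg fun l _ => hnn j₁ l] at h3
    have h4 := h3 l₁ (Finset.mem_univ _)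
    exact absurd h4 (mul_pos (by positivity) (hbound _ _ h1)).ne'
  -- `T` kills all commutators, as it kills those of the eigenvectors.
  have hT1 : ∀ i j, T (P (u i) (u j) - P (u j) (u i)) = 0 := fun i j => by
    refine InnerProductSpace.ext_inner_right_basis (𝕜 := ℝ) u.toBasis fun l => ?_
    rw [OrthonormalBasis.coe_toBasis, ← hω, hω0, inner_zero_left]
  have hT2 : P.compr₂ T - (P.compr₂ T).flip = 0 := by
    refine u.toBasis.ext fun i => u.toBasis.ext fun j => ?_
    have := hT1 i j
    rw [map_sub] at this
    simpa using this
  have hT3 : T (P a b - P b a) = 0 := by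
    have := LinearMap.congr_fun (LinearMap.congr_fun hT2 a) b
    rw [map_sub]
    simpa using this
  exact hTP _ (by rw [hT3, inner_zero_left])

/-- The product with a vector orthogonal to all commutators vanishes on the right. -/
theorem apply_eq_zero_of_orthogonal (hP : IsFlatEuclidean P) {a : V}
    (ha : ∀ b c, inner ℝ a (P b c - P c b) = 0) (x : V) : P x a = 0 := by
  let R := P.flip a
  have hR : ∀ x, R x = P x a := fun x => rfl
  have hRs : ∀ x y, inner ℝ (R x) y = inner ℝ x (R y) := fun x y => by
    have := ha x y
    rw [inner_sub_right, ← neg_inj, neg_sub, real_inner_comm, real_inner_comm (P x y)] at this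
    rw [hR, hR, hP.skew, real_inner_comm (P y a) x, hP.skew, real_inner_comm _ a,
      real_inner_comm _ a]
    linarith
  let e := stdOrthonormalBasis ℝ V
  have h1 : ∀ x, R (R x) = R (P a x) := fun x => by
    have := LinearMap.congr_fun (hP.apply_commutator a x) a
    rw [map_sub, LinearMap.sub_apply, LinearMap.zero_apply, sub_eq_zero] at this
    exact this.symm
  -- `tr R² = tr (R P a) = 0`, since `R` is symmetric and `P a` is skew.
  have h2 : ∑ i, inner ℝ (R (e i)) (R (e i)) = 0 := by
    have e1 : ∑ i, inner ℝ (R (e i)) (R (e i)) = LinearMap.trace ℝ V (R * P a) := by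
      rw [LinearMap.trace_eq_sum_inner _ e]
      exact Finset.sum_congr rfl fun i _ => by rw [hRs, h1]; rfl
    have e2 : LinearMap.trace ℝ V (R * P a) = -LinearMap.trace ℝ V (P a * R) := by
      rw [LinearMap.trace_eq_sum_inner _ e, LinearMap.trace_eq_sum_inner _ e,
        ← Finset.sum_neg_distrib]
      refine Finset.sum_congr rfl fun i _ => ?_
      rw [Module.End.mul_apply, Module.End.mul_apply, ← hRs, ← real_inner_comm, hP.skew]
    rw [LinearMap.trace_mul_comm] at e2
    rw [LinearMap.trace_mul_comm] at e1
    linarith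
  rw [Finset.sum_eq_zero_iff_of_nonneg fun i _ => real_inner_self_nonneg] at h2
  have h3 : R = 0 := e.toBasis.ext fun i => by simpa using h2 i (Finset.mem_univ i)
  rw [← hR, h3, LinearMap.zero_apply]

end IsFlatEuclidean
end

/-! ### Skew operators and flat Euclidean products in dimension at most four -/

section

variable {V : Type*} [NormedAddCommGroup V] [InnerProductSpace ℝ V]

/-- In a subspace of dimension greater than `k` there is a unit vector orthogonal to `k` given
ones. -/
theorem exists_unit_orthogonal (W : Submodule ℝ V) {k : ℕ} (v : Fin k → V)
    (h : k < finrank ℝ W) : ∃ d ∈ W, ‖d‖ = 1 ∧ ∀ i, inner ℝ (v i) d = 0 := by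
  let F : W →ₗ[ℝ] (Fin k → ℝ) := LinearMap.pi fun i => (innerₗ V (v i)) ∘ₗ W.subtype
  have hF : ¬ Function.Injective F := fun hi => by
    have := LinearMap.finrank_le_finrank_of_injective hi
    rw [finrank_fin_fun] at this
    omega
  rw [← LinearMap.ker_eq_bot, Submodule.eq_bot_iff] at hF
  push Not at hF
  obtain ⟨x, hx, hx0⟩ := hF
  have hxn : ‖(x : V)‖ ≠ 0 := by simpa using hx0
  refine ⟨‖(x : V)‖⁻¹ • (x : V), W.smul_mem _ x.2, ?_, fun i => ?_⟩
  · rw [norm_smul, norm_inv, norm_norm, inv_mul_cancel₀ hxn]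
  · have := congrFun (LinearMap.mem_ker.1 hx) i
    rw [inner_smul_right]
    simp only [F, LinearMap.pi_apply, LinearMap.comp_apply, Submodule.subtype_apply,
      innerₗ_apply_apply, Pi.zero_apply] at this
    rw [this, mul_zero]

theorem inner_self_of_skew {A : V →ₗ[ℝ] V}
    (hA : ∀ a b, inner ℝ (A a) b = -inner ℝ a (A b)) (a : V) :
    inner ℝ a (A a) = 0 := by
  have := hA a a
  rw [real_inner_comm] at this
  linarith

variable [FiniteDimensional ℝ V]

theorem Orthonormal.eq_zero_of_inner_eq_zero {W : Submodule ℝ V} {k : ℕ} {v : Fin k → V}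
    (hv : Orthonormal ℝ v) (hvW : ∀ i, v i ∈ W) (h : finrank ℝ W ≤ k) {x : V} (hx : x ∈ W)
    (hvx : ∀ i, inner ℝ (v i) x = 0) : x = 0 := by
  by_contra hne
  have hspan : Submodule.span ℝ (Set.range v) = W := by
    apply Submodule.eq_of_le_of_finrank_le (Submodule.span_le.2 (Set.range_subset_iff.2 hvW))
    rwa [finrank_span_eq_card hv.linearIndependent, Fintype.card_fin]
  rw [← hspan] at hx
  have : inner ℝ x x = 0 := by
    refine Submodule.span_induction (p := fun y _ => inner ℝ y x = 0) ?_ ?_ ?_ ?_ hx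
    · rintro _ ⟨i, rfl⟩
      exact hvx i
    · exact inner_zero_left x
    · intro a b _ _ ha hb
      rw [inner_add_left, ha, hb, add_zero]
    · intro r a _ ha
      rw [inner_smul_left, ha, mul_zero]
  exact hne (inner_self_eq_zero.1 this)

/-- An orthonormal family of `finrank ℝ V` vectors separates points. -/
theorem Orthonormal.ext_inner {k : ℕ} {v : Fin k → V} (hv : Orthonormal ℝ v)
    (h : finrank ℝ V ≤ k) {x y : V} (hvx : ∀ i, inner ℝ (v i) x = inner ℝ (v i) y) : x = y := by
  refine sub_eq_zero.1 (hv.eq_zero_of_inner_eq_zero (W := ⊤) (fun _ => trivial)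
    (by rwa [finrank_top]) trivial fun i => ?_)
  rw [inner_sub_right, hvx, sub_self]

/-- A nonzero skew operator has a plane on which it is a nonzero multiple of a rotation. -/
theorem exists_rotation_of_skew {A : V →ₗ[ℝ] V}
    (hA : ∀ a b, inner ℝ (A a) b = -inner ℝ a (A b)) (h0 : A ≠ 0) :
    ∃ (u v : V) (θ : ℝ), θ ≠ 0 ∧ Orthonormal ℝ ![u, v] ∧ A u = θ • v ∧ A v = -(θ • u) := by
  have hS : (A ∘ₗ A).IsSymmetric := fun x y => by
    rw [LinearMap.comp_apply, LinearMap.comp_apply, hA, hA, neg_neg]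
  let u := hS.eigenvectorBasis rfl
  have hex : ∃ i, A (u i) ≠ 0 := by
    by_contra! h
    exact h0 (u.toBasis.ext fun i => by simpa using h i)
  obtain ⟨i, hi⟩ := hex
  have hev : A (A (u i)) = hS.eigenvalues rfl i • u i := hS.apply_eigenvectorBasis rfl i
  have hμ : hS.eigenvalues rfl i = -‖A (u i)‖ ^ 2 := by
    have h1 : inner ℝ (u i) (A (A (u i))) = hS.eigenvalues rfl i := by
      rw [hev, inner_smul_right, real_inner_self_eq_norm_sq, u.norm_eq_one, one_pow, mul_one]
    rw [← h1, ← neg_inj, ← hA, real_inner_self_eq_norm_sq, neg_neg]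
  have hθ : ‖A (u i)‖ ≠ 0 := norm_ne_zero_iff.2 hi
  refine ⟨u i, ‖A (u i)‖⁻¹ • A (u i), ‖A (u i)‖, hθ, ?_, ?_, ?_⟩
  · rw [orthonormal_vecCons_iff, orthonormal_vecCons_iff]
    refine ⟨u.norm_eq_one i, fun j => ?_, ?_, fun j => j.elim0,
      ⟨fun j => j.elim0, fun j => j.elim0⟩⟩
    · fin_cases j
      change inner ℝ (u i) (‖A (u i)‖⁻¹ • A (u i)) = 0
      rw [inner_smul_right, inner_self_of_skew hA, mul_zero]
    · rw [norm_smul, norm_inv, norm_norm, inv_mul_cancel₀ hθ]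
  · rw [smul_smul, mul_inv_cancel₀ hθ, one_smul]
  · rw [map_smul, hev, hμ, smul_smul, ← neg_smul]
    congr 1
    field_simp

/-- On an invariant plane a skew operator is a multiple of a rotation. -/
theorem exists_rotation_of_skew_of_finrank_eq_two {A : V →ₗ[ℝ] V}
    (hA : ∀ a b, inner ℝ (A a) b = -inner ℝ a (A b)) {W : Submodule ℝ V}
    (hW : finrank ℝ W = 2) (hAW : ∀ a ∈ W, A a ∈ W) :
    ∃ u ∈ W, ∃ v ∈ W, ∃ θ : ℝ, Orthonormal ℝ ![u, v] ∧ A u = θ • v ∧ A v = -(θ • u) := by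
  obtain ⟨u, huW, hu, -⟩ := exists_unit_orthogonal W ![] (by omega)
  obtain ⟨v, hvW, hv, huv⟩ := exists_unit_orthogonal W ![u] (by omega)
  have huv : inner ℝ u v = 0 := huv 0
  have huu : inner ℝ u u = (1 : ℝ) := by rw [real_inner_self_eq_norm_sq, hu, one_pow]
  have hvv : inner ℝ v v = (1 : ℝ) := by rw [real_inner_self_eq_norm_sq, hv, one_pow]
  have hvu : inner ℝ v u = 0 := by rw [real_inner_comm, huv]
  have ho : Orthonormal ℝ ![u, v] := by
    rw [orthonormal_iff_ite]
    intro i j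
    fin_cases i <;> fin_cases j <;> simp [huv, hvu, hu, hv]
  have hmem : ∀ i, (![u, v] : Fin 2 → V) i ∈ W := by
    intro i
    fin_cases i <;> simpa
  have hsk : inner ℝ v (A u) = -inner ℝ u (A v) := by rw [← hA, real_inner_comm]
  refine ⟨u, huW, v, hvW, inner ℝ v (A u), ho, ?_, ?_⟩ <;> rw [← sub_eq_zero] <;>
    refine ho.eq_zero_of_inner_eq_zero hmem hW.le ?_ fun i => ?_
  · exact W.sub_mem (hAW _ huW) (W.smul_mem _ hvW)
  · fin_cases i <;> simp [inner_sub_right, inner_smul_right, inner_self_of_skew hA, huv, hv]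
  · exact W.sub_mem (hAW _ hvW) (W.neg_mem (W.smul_mem _ huW))
  · fin_cases i <;>
      simp [inner_sub_right, inner_smul_right, inner_self_of_skew hA, hvu, hu, hsk]

namespace IsFlatEuclidean

variable {P : V →ₗ[ℝ] V →ₗ[ℝ] V}

/-- Milnor's description of flat Euclidean Lie algebras, in dimension at most four: the product is
zero, or it is the action of one line by rotations of one plane orthogonal to it. -/
theorem eq_zero_or_exists (hP : IsFlatEuclidean P) (hV : finrank ℝ V ≤ 4) :
    P = 0 ∨ ∃ (s e f : V) (r : ℝ), r ≠ 0 ∧ Orthonormal ℝ ![s, e, f] ∧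
      ∀ a b, P a b = (r * inner ℝ s a) • (inner ℝ e b • f - (inner ℝ f b : ℝ) • e) := by
  rw [or_iff_not_imp_left]
  intro hne
  let D : Submodule ℝ V := Submodule.span ℝ {x | ∃ a b, x = P a b - P b a}
  have hPD : ∀ d ∈ D, P d = 0 := fun d hd => by
    have : D ≤ LinearMap.ker P := Submodule.span_le.2 <| by
      rintro _ ⟨a, b, rfl⟩
      exact hP.apply_commutator a b
    exact this hd
  have hperp : ∀ a ∈ Dᗮ, ∀ x, P x a = 0 := fun a ha x =>
    hP.apply_eq_zero_of_orthogonal (fun b c =>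
      Submodule.inner_left_of_mem_orthogonal (Submodule.subset_span
        (s := {x | ∃ a b, x = P a b - P b a}) ⟨b, c, rfl⟩) ha) x
  have hmem : ∀ x b, P x b ∈ D := fun x b => by
    rw [← Submodule.orthogonal_orthogonal D, Submodule.mem_orthogonal']
    intro a ha
    rw [hP.skew, hperp a ha, inner_zero_right, neg_zero]
  have hskew : ∀ x a b, inner ℝ (P x a) b = -inner ℝ a (P x b) := hP.skew
  -- Some `s` orthogonal to all commutators acts nontrivially.
  obtain ⟨s, hsD, hs⟩ : ∃ s ∈ Dᗮ, P s ≠ 0 := by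
    by_contra! h
    refine hne (LinearMap.ext fun x => ?_)
    obtain ⟨y, hy, w, hw, rfl⟩ := D.exists_add_mem_mem_orthogonal x
    rw [map_add, hPD y hy, h w hw, add_zero, LinearMap.zero_apply]
  -- The plane rotated by `s` consists of commutators.
  obtain ⟨e, f, θ, hθ, hef, hse, hsf⟩ := exists_rotation_of_skew (hskew s) hs
  have hee : inner ℝ e e = (1 : ℝ) := by simpa using (orthonormal_iff_ite.1 hef) 0 0
  have hff : inner ℝ f f = (1 : ℝ) := by simpa using (orthonormal_iff_ite.1 hef) 1 1
  have hef0 : inner ℝ e f = (0 : ℝ) := by simpa using (orthonormal_iff_ite.1 hef) 0 1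
  have hfe0 : inner ℝ f e = (0 : ℝ) := by simpa using (orthonormal_iff_ite.1 hef) 1 0
  have hfD : f ∈ D := by
    have : f = θ⁻¹ • P s e := by rw [hse, smul_smul, inv_mul_cancel₀ hθ, one_smul]
    rw [this]
    exact D.smul_mem _ (hmem s e)
  have heD : e ∈ D := by
    have : e = -(θ⁻¹ • P s f) := by rw [hsf, smul_neg, smul_smul, inv_mul_cancel₀ hθ, one_smul,
      neg_neg]
    rw [this]
    exact D.neg_mem (D.smul_mem _ (hmem s f))
  have hs0 : s ≠ 0 := fun h => hs (by rw [h, map_zero])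
  have hdim := D.finrank_add_finrank_orthogonal
  have hmem2 : ∀ i, (![e, f] : Fin 2 → V) i ∈ D := by
    intro i
    fin_cases i <;> simpa
  -- A third direction `d` in the span `D` of the commutators would leave only the line of `s` for
  -- `Dᗮ`; then all products with `d` vanish, and `d` is orthogonal to all commutators.
  have hD2 : finrank ℝ D ≤ 2 := by
    by_contra! hD3
    obtain ⟨d, hd, hd1, hdo⟩ := exists_unit_orthogonal D ![e, f] hD3
    have hed : inner ℝ e d = 0 := hdo 0
    have hfd : inner ℝ f d = 0 := hdo 1
    have hdd : inner ℝ d d = (1 : ℝ) := by rw [real_inner_self_eq_norm_sq, hd1, one_pow]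
    have ho : Orthonormal ℝ ![d, e, f] := by
      rw [orthonormal_vecCons_iff]
      refine ⟨hd1, fun i => ?_, hef⟩
      rw [real_inner_comm]
      exact hdo i
    have hDs : 1 ≤ finrank ℝ Dᗮ := by
      rw [Nat.one_le_iff_ne_zero]
      intro h0
      rw [Submodule.finrank_eq_zero] at h0
      rw [h0] at hsD
      exact hs0 ((Submodule.mem_bot ℝ).1 hsD)
    have hsd : P s d = 0 := by
      refine ho.eq_zero_of_inner_eq_zero (W := D) (fun i => ?_) (by omega) (hmem s d) fun i => ?_
      · fin_cases i <;> simpa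
      · fin_cases i
        · exact inner_self_of_skew (hskew s) d
        · change inner ℝ e (P s d) = 0
          rw [← neg_inj, ← hskew, hse, inner_smul_left, hfd, mul_zero, neg_zero]
        · change inner ℝ f (P s d) = 0
          rw [← neg_inj, ← hskew, hsf, inner_neg_left, inner_smul_left, hed, mul_zero]
    have hxd : ∀ x, P x d = 0 := fun x => by
      obtain ⟨y, hy, w, hw, rfl⟩ := D.exists_add_mem_mem_orthogonal x
      have hls : Submodule.span ℝ {s} = Dᗮ := by
        apply Submodule.eq_of_le_of_finrank_le ((Submodule.span_singleton_le_iff_mem _ _).2 hsD)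
        rw [finrank_span_singleton hs0]
        omega
      rw [← hls, Submodule.mem_span_singleton] at hw
      obtain ⟨c, rfl⟩ := hw
      rw [map_add, hPD y hy, zero_add, map_smul, LinearMap.smul_apply, hsd, smul_zero]
    have hdperp : d ∈ Dᗮ := by
      rw [Submodule.mem_orthogonal']
      intro x hx
      refine Submodule.span_induction (p := fun y _ => inner ℝ d y = 0) ?_ ?_ ?_ ?_ hx
      · rintro _ ⟨a, b, rfl⟩
        have h1 := hskew a d b
        have h2 := hskew b d a
        rw [hxd, inner_zero_left] at h1 h2
        rw [inner_sub_right]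
        linarith
      · exact inner_zero_right d
      · intro a b _ _ ha hb
        rw [inner_add_right, ha, hb, add_zero]
      · intro r a _ ha
        rw [inner_smul_right, ha, mul_zero]
    have := Submodule.inner_left_of_mem_orthogonal hd hdperp
    rw [hdd] at this
    exact one_ne_zero this
  have hext : ∀ {x y : V}, x ∈ D → y ∈ D → inner ℝ e x = (inner ℝ e y : ℝ) →
      inner ℝ f x = (inner ℝ f y : ℝ) → x = y := fun {x y} hx hy h1 h2 => by
    refine sub_eq_zero.1 (hef.eq_zero_of_inner_eq_zero hmem2 hD2 (D.sub_mem hx hy) fun i => ?_)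
    fin_cases i <;> simp [inner_sub_right, h1, h2]
  -- Hence every `P a` is a multiple `⟪σ, a⟫` of the rotation of the plane of `e` and `f`.
  let φ : V →ₗ[ℝ] ℝ := innerₗ V f ∘ₗ P.flip e
  let σ := (InnerProductSpace.toDual ℝ V).symm φ.toContinuousLinearMap
  have hσ : ∀ a, inner ℝ σ a = inner ℝ f (P a e) := fun a => by
    rw [InnerProductSpace.toDual_symm_apply]
    rfl
  have hformula : ∀ a b, P a b = (inner ℝ σ a : ℝ) • (inner ℝ e b • f - (inner ℝ f b : ℝ) • e) := by
    intro a b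
    have hb : b = (b - ((inner ℝ e b : ℝ) • e + (inner ℝ f b : ℝ) • f)) +
        ((inner ℝ e b : ℝ) • e + (inner ℝ f b : ℝ) • f) := by abel
    have hb0 : P a (b - ((inner ℝ e b : ℝ) • e + (inner ℝ f b : ℝ) • f)) = 0 := by
      apply hperp
      rw [Submodule.mem_orthogonal]
      intro y hy
      have hy' : y = (inner ℝ e y : ℝ) • e + (inner ℝ f y : ℝ) • f := by
        apply hext hy (D.add_mem (D.smul_mem _ heD) (D.smul_mem _ hfD)) <;>
          simp only [inner_add_right, inner_smul_right, hef0, hfe0, hee, hff, mul_one, mul_zero,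
            add_zero, zero_add]
      rw [hy']
      simp only [inner_add_left, inner_smul_left, inner_sub_right, inner_add_right,
        inner_smul_right, hef0, hfe0, hee, hff, conj_trivial]
      ring
    have he : P a e = (inner ℝ σ a : ℝ) • f := by
      apply hext (hmem a e) (D.smul_mem _ hfD)
      · rw [inner_self_of_skew (hskew a), inner_smul_right, hef0, mul_zero]
      · rw [inner_smul_right, hff, mul_one, hσ]
    have hf : P a f = -((inner ℝ σ a : ℝ) • e) := by
      apply hext (hmem a f) (D.neg_mem (D.smul_mem _ heD))
      · rw [inner_neg_right, inner_smul_right, hee, mul_one, hσ, real_inner_comm _ f, hskew,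
          neg_neg]
      · rw [inner_self_of_skew (hskew a), inner_neg_right, inner_smul_right, hfe0, mul_zero,
          neg_zero]
    conv_lhs => rw [hb, map_add, hb0, zero_add, map_add, map_smul, map_smul, he, hf]
    module
  have hσ0 : ‖σ‖ ≠ 0 := fun h => hne (LinearMap.ext fun a => LinearMap.ext fun b => by
    rw [hformula, norm_eq_zero.1 h, inner_zero_left, zero_smul, LinearMap.zero_apply,
      LinearMap.zero_apply])
  have hσD : ∀ d ∈ D, inner ℝ σ d = 0 := fun d hd => by
    rw [hσ, hPD d hd, LinearMap.zero_apply, inner_zero_right]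
  refine ⟨‖σ‖⁻¹ • σ, e, f, ‖σ‖, hσ0, ?_, fun a b => ?_⟩
  · rw [orthonormal_vecCons_iff]
    refine ⟨by rw [norm_smul, norm_inv, norm_norm, inv_mul_cancel₀ hσ0], fun i => ?_, hef⟩
    rw [inner_smul_left, hσD _ (hmem2 i), mul_zero]
  · rw [hformula, inner_smul_left, ← mul_assoc, conj_trivial, mul_inv_cancel₀ hσ0, one_mul]

end IsFlatEuclidean
end

/-! ### Bases realizing the entries with abelian quotient -/

section

set_option linter.unusedSimpArgs false

variable {g : Type*} [LieRing g] [LieAlgebra ℝ g] {B : LinearMap.BilinForm ℝ g}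
variable {V : Type*} [NormedAddCommGroup V] [InnerProductSpace ℝ V]
  {P : V →ₗ[ℝ] V →ₗ[ℝ] V} {A ξ : V →ₗ[ℝ] V} {b₀ : V} {z w : g} {ι : V →ₗ[ℝ] g}

/-- The vectors `z`, `w` and the isometric embedding `ι` of the Euclidean space `V` split the metric
Lie algebra `g`, and its brackets are those of the extension of `V` with the data `P`, `A`, `ξ`,
`b₀`. -/
structure IsFlatFrame (B : LinearMap.BilinForm ℝ g) (P : V →ₗ[ℝ] V →ₗ[ℝ] V) (A ξ : V →ₗ[ℝ] V)
    (b₀ : V) (z w : g) (ι : V →ₗ[ℝ] g) : Prop where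
  symm : ∀ u v, B u v = B v u
  lie_z : ∀ u : g, ⁅z, u⁆ = 0
  lie_w : ∀ a, ⁅w, ι a⁆ = ι (A a - ξ a) - (inner ℝ b₀ a : ℝ) • z
  lie_ι : ∀ a b, ⁅ι a, ι b⁆ =
    ι (P a b - P b a) + (inner ℝ a (ξ b) - inner ℝ b (ξ a) : ℝ) • z
  apply_z_z : B z z = 0
  apply_z_w : B z w = 1
  apply_w_w : B w w = 0
  apply_z_ι : ∀ a, B z (ι a) = 0
  apply_w_ι : ∀ a, B w (ι a) = 0
  apply_ι_ι : ∀ a b, B (ι a) (ι b) = inner ℝ a b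

/-- In some basis of `g` the brackets and the form are those of an entry of the tables. -/
def HasListedBasis (B : LinearMap.BilinForm ℝ g) : Prop :=
  ∃ (n : ℕ) (E : Entry n), IsListed n E ∧ ∃ b : Basis (Fin n) ℝ g, E.Realizes B b

namespace IsFlatFrame

theorem lie_z' (h : IsFlatFrame B P A ξ b₀ z w ι) (u : g) : ⁅u, z⁆ = 0 := by
  rw [← lie_skew, h.lie_z, neg_zero]

theorem lie_w' (h : IsFlatFrame B P A ξ b₀ z w ι) (a : V) :
    ⁅ι a, w⁆ = (inner ℝ b₀ a : ℝ) • z - ι (A a - ξ a) := by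
  rw [← lie_skew, h.lie_w, neg_sub]

theorem apply_w_z (h : IsFlatFrame B P A ξ b₀ z w ι) : B w z = 1 := by rw [h.symm, h.apply_z_w]

theorem apply_ι_z (h : IsFlatFrame B P A ξ b₀ z w ι) (a : V) : B (ι a) z = 0 := by
  rw [h.symm, h.apply_z_ι]

theorem apply_ι_w (h : IsFlatFrame B P A ξ b₀ z w ι) (a : V) : B (ι a) w = 0 := by
  rw [h.symm, h.apply_w_ι]

/-- Rescaling `w` by `r⁻¹` and `z` by `r`. -/
theorem rescale (h : IsFlatFrame B P A ξ b₀ z w ι) {r : ℝ} (hr : r ≠ 0) :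
    IsFlatFrame B P (r⁻¹ • A) (r⁻¹ • ξ) (r⁻¹ ^ 2 • b₀) (r • z) (r⁻¹ • w) ι where
  symm := h.symm
  lie_z u := by rw [smul_lie, h.lie_z, smul_zero]
  lie_w a := by
    rw [smul_lie, h.lie_w, inner_smul_left, LinearMap.smul_apply, LinearMap.smul_apply, ← smul_sub,
      map_smul, smul_sub, smul_smul, smul_smul, conj_trivial]
    congr 2
    field_simp
  lie_ι a b := by
    rw [h.lie_ι, LinearMap.smul_apply, LinearMap.smul_apply, inner_smul_right, inner_smul_right,
      smul_smul]
    congr 2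
    field_simp
  apply_z_z := by simp [h.apply_z_z]
  apply_z_w := by simp [h.apply_z_w, hr]
  apply_w_w := by simp [h.apply_w_w]
  apply_z_ι a := by simp [h.apply_z_ι]
  apply_w_ι a := by simp [h.apply_w_ι]
  apply_ι_ι := h.apply_ι_ι

variable [FiniteDimensional ℝ g]

/-- If `P`, `A` and `ξ` vanish, then `g` is the sum of the Heisenberg algebra and an abelian one;
the vector `u 0` is chosen in the direction of `-b₀`. -/
theorem hasListedBasis_heisenberg_dim3 (h : IsFlatFrame B 0 A ξ b₀ z w ι) (hg : finrank ℝ g = 3)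
    {u : Fin 1 → V} (hu : Orthonormal ℝ u) {κ : ℝ} (hκ : 0 < κ) (hA : A = 0) (hξ : ξ = 0)
    (hb₀ : b₀ = -(κ • u 0)) :
    HasListedBasis B := by
  have hin := orthonormal_iff_ite.1 hu
  have hE := IsListed.dim3 κ hκ
  refine ⟨3, _, hE, hE.exists_realizes h.symm hg ![κ • z, w, ι (u 0)] ?_ ?_⟩
  · intro i j hij
    fin_cases i <;> fin_cases j <;> first
      | exact absurd hij (by decide)
      | (simp [Entry.structureConst, Fin.sum_univ_succ, h.lie_z, h.lie_z', h.lie_w, h.lie_w',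
          h.lie_ι, hA, hξ, hb₀, inner_smul_left, inner_smul_right, hin, hu.1]
         try module)
  · intro i j hij
    fin_cases i <;> fin_cases j <;> first
      | exact absurd hij (by decide)
      | (simp [h.apply_z_z, h.apply_z_w, h.apply_w_w, h.apply_w_z, h.apply_ι_z, h.apply_ι_w,
          h.apply_z_ι, h.apply_w_ι, h.apply_ι_ι, inner_smul_right, hin, hu.1]
         try ring)

theorem hasListedBasis_heisenberg_dim4 (h : IsFlatFrame B 0 A ξ b₀ z w ι) (hg : finrank ℝ g = 4)
    {u : Fin 2 → V} (hu : Orthonormal ℝ u) {κ : ℝ} (hκ : 0 < κ) (hA : A = 0) (hξ : ξ = 0)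
    (hb₀ : b₀ = -(κ • u 0)) :
    HasListedBasis B := by
  have hin := orthonormal_iff_ite.1 hu
  have hE := IsListed.dim4_a κ 0 hκ
  refine ⟨4, _, hE, hE.exists_realizes h.symm hg ![κ • z, w, ι (u 0), ι (u 1)] ?_ ?_⟩
  · intro i j hij
    fin_cases i <;> fin_cases j <;> first
      | exact absurd hij (by decide)
      | (simp [Entry.structureConst, Fin.sum_univ_succ, h.lie_z, h.lie_z', h.lie_w, h.lie_w',
          h.lie_ι, hA, hξ, hb₀, inner_smul_left, inner_smul_right, hin, hu.1]
         try module)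
  · intro i j hij
    fin_cases i <;> fin_cases j <;> first
      | exact absurd hij (by decide)
      | (simp [h.apply_z_z, h.apply_z_w, h.apply_w_w, h.apply_w_z, h.apply_ι_z, h.apply_ι_w,
          h.apply_z_ι, h.apply_w_ι, h.apply_ι_ι, inner_smul_right, hin, hu.1]
         try ring)

theorem hasListedBasis_heisenberg_dim5 (h : IsFlatFrame B 0 A ξ b₀ z w ι) (hg : finrank ℝ g = 5)
    {u : Fin 3 → V} (hu : Orthonormal ℝ u) {κ : ℝ} (hκ : 0 < κ) (hA : A = 0) (hξ : ξ = 0)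
    (hb₀ : b₀ = -(κ • u 0)) :
    HasListedBasis B := by
  have hin := orthonormal_iff_ite.1 hu
  have hE := IsListed.dim5_a κ 0 0 hκ
  refine ⟨5, _, hE, hE.exists_realizes h.symm hg ![κ • z, w, ι (u 0), ι (u 1), ι (u 2)] ?_ ?_⟩
  · intro i j hij
    fin_cases i <;> fin_cases j <;> first
      | exact absurd hij (by decide)
      | (simp [Entry.structureConst, Fin.sum_univ_succ, h.lie_z, h.lie_z', h.lie_w, h.lie_w',
          h.lie_ι, hA, hξ, hb₀, inner_smul_left, inner_smul_right, hin, hu.1]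
         try module)
  · intro i j hij
    fin_cases i <;> fin_cases j <;> first
      | exact absurd hij (by decide)
      | (simp [h.apply_z_z, h.apply_z_w, h.apply_w_w, h.apply_w_z, h.apply_ι_z, h.apply_ι_w,
          h.apply_z_ι, h.apply_w_ι, h.apply_ι_ι, inner_smul_right, hin, hu.1]
         try ring)

theorem hasListedBasis_heisenberg_dim6 (h : IsFlatFrame B 0 A ξ b₀ z w ι) (hg : finrank ℝ g = 6)
    {u : Fin 4 → V} (hu : Orthonormal ℝ u) {κ : ℝ} (hκ : 0 < κ) (hA : A = 0) (hξ : ξ = 0)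
    (hb₀ : b₀ = -(κ • u 0)) :
    HasListedBasis B := by
  have hin := orthonormal_iff_ite.1 hu
  have hE := IsListed.dim6_a κ 0 0 0 hκ
  refine ⟨6, _, hE, hE.exists_realizes h.symm hg
    ![κ • z, w, ι (u 0), ι (u 1), ι (u 2), ι (u 3)] ?_ ?_⟩
  · intro i j hij
    fin_cases i <;> fin_cases j <;> first
      | exact absurd hij (by decide)
      | (simp [Entry.structureConst, Fin.sum_univ_succ, h.lie_z, h.lie_z', h.lie_w, h.lie_w',
          h.lie_ι, hA, hξ, hb₀, inner_smul_left, inner_smul_right, hin, hu.1]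
         try module)
  · intro i j hij
    fin_cases i <;> fin_cases j <;> first
      | exact absurd hij (by decide)
      | (simp [h.apply_z_z, h.apply_z_w, h.apply_w_w, h.apply_w_z, h.apply_ι_z, h.apply_ι_w,
          h.apply_z_ι, h.apply_w_ι, h.apply_ι_ι, inner_smul_right, hin, hu.1]
         try ring)

/-- The case `P = 0`, `ξ = 0` with `A` a rotation of one plane. The shifts of `ι (u 0)` and
`ι (u 1)` by multiples of `z` absorb the components of `b₀` in that plane. -/
theorem hasListedBasis_rotation_dim4 (h : IsFlatFrame B 0 A ξ b₀ z w ι) (hg : finrank ℝ g = 4)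
    {u : Fin 2 → V} (hu : Orthonormal ℝ u) (hA0 : A (u 0) = u 1) (hA1 : A (u 1) = -u 0)
    (hξ : ξ = 0) :
    HasListedBasis B := by
  have hin := orthonormal_iff_ite.1 hu
  let x := inner ℝ b₀ (u 1)
  let y := -inner ℝ b₀ (u 0)
  have hE := IsListed.dim4_c 1 x y one_ne_zero
  refine ⟨4, _, hE, hE.exists_realizes h.symm hg ![z, w, ι (u 0) + x • z, ι (u 1) + y • z] ?_ ?_⟩
  · intro i j hij
    fin_cases i <;> fin_cases j <;> first
      | exact absurd hij (by decide)
      | (simp [Entry.structureConst, Fin.sum_univ_succ, h.lie_z, h.lie_z', h.lie_w, h.lie_w',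
          h.lie_ι, hA0, hA1, hξ, inner_smul_right, hin, hu.1, x, y]
         try module)
  · intro i j hij
    fin_cases i <;> fin_cases j <;> first
      | exact absurd hij (by decide)
      | (simp [h.apply_z_z, h.apply_z_w, h.apply_w_w, h.apply_w_z, h.apply_ι_z, h.apply_ι_w,
          h.apply_z_ι, h.apply_w_ι, h.apply_ι_ι, inner_smul_right, hin, hu.1, x, y]
         try ring)

theorem hasListedBasis_rotation_dim5 (h : IsFlatFrame B 0 A ξ b₀ z w ι) (hg : finrank ℝ g = 5)
    {u : Fin 3 → V} (hu : Orthonormal ℝ u) (hA0 : A (u 0) = u 1) (hA1 : A (u 1) = -u 0)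
    (hA2 : A (u 2) = 0) (hξ : ξ = 0) :
    HasListedBasis B := by
  have hin := orthonormal_iff_ite.1 hu
  let x := inner ℝ b₀ (u 1)
  let y := -inner ℝ b₀ (u 0)
  have hE := IsListed.dim5_c 1 x y (-inner ℝ b₀ (u 2)) one_pos
  refine ⟨5, _, hE, hE.exists_realizes h.symm hg ![z, w, ι (u 0) + x • z, ι (u 1) + y • z, ι (u 2)]
    ?_ ?_⟩
  · intro i j hij
    fin_cases i <;> fin_cases j <;> first
      | exact absurd hij (by decide)
      | (simp [Entry.structureConst, Fin.sum_univ_succ, h.lie_z, h.lie_z', h.lie_w, h.lie_w',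
          h.lie_ι, hA0, hA1, hA2, hξ, inner_smul_right, hin, hu.1, x, y]
         try module)
  · intro i j hij
    fin_cases i <;> fin_cases j <;> first
      | exact absurd hij (by decide)
      | (simp [h.apply_z_z, h.apply_z_w, h.apply_w_w, h.apply_w_z, h.apply_ι_z, h.apply_ι_w,
          h.apply_z_ι, h.apply_w_ι, h.apply_ι_ι, inner_smul_right, hin, hu.1, x, y]
         try ring)

theorem hasListedBasis_rotation_dim6 (h : IsFlatFrame B 0 A ξ b₀ z w ι) (hg : finrank ℝ g = 6)
    {u : Fin 4 → V} (hu : Orthonormal ℝ u) (hA0 : A (u 0) = u 1) (hA1 : A (u 1) = -u 0)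
    (hA2 : A (u 2) = 0) (hA3 : A (u 3) = 0) (hξ : ξ = 0) :
    HasListedBasis B := by
  have hin := orthonormal_iff_ite.1 hu
  let x := inner ℝ b₀ (u 1)
  let y := -inner ℝ b₀ (u 0)
  have hE := IsListed.dim6_c 1 x y (-inner ℝ b₀ (u 2)) (-inner ℝ b₀ (u 3)) one_ne_zero
  refine ⟨6, _, hE, hE.exists_realizes h.symm hg ![z, w, ι (u 0) + x • z, ι (u 1) + y • z, ι (u 2),
    ι (u 3)] ?_ ?_⟩
  · intro i j hij
    fin_cases i <;> fin_cases j <;> first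
      | exact absurd hij (by decide)
      | (simp [Entry.structureConst, Fin.sum_univ_succ, h.lie_z, h.lie_z', h.lie_w, h.lie_w',
          h.lie_ι, hA0, hA1, hA2, hA3, hξ, inner_smul_right, hin, hu.1, x, y]
         try module)
  · intro i j hij
    fin_cases i <;> fin_cases j <;> first
      | exact absurd hij (by decide)
      | (simp [h.apply_z_z, h.apply_z_w, h.apply_w_w, h.apply_w_z, h.apply_ι_z, h.apply_ι_w,
          h.apply_z_ι, h.apply_w_ι, h.apply_ι_ι, inner_smul_right, hin, hu.1, x, y]
         try ring)

/-- The case `P = 0`, `ξ = 0` with `A` rotating two orthogonal planes. The second pair of basis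
vectors is scaled by `κ`, which makes its length the one in the list. -/
theorem hasListedBasis_rotation_rotation (h : IsFlatFrame B 0 A ξ b₀ z w ι) (hg : finrank ℝ g = 6)
    {u : Fin 4 → V} (hu : Orthonormal ℝ u) {κ : ℝ} (hκ : κ ≠ 0) (hA0 : A (u 0) = u 1)
    (hA1 : A (u 1) = -u 0) (hA2 : A (u 2) = κ • u 3) (hA3 : A (u 3) = -(κ • u 2)) (hξ : ξ = 0) :
    HasListedBasis B := by
  have hin := orthonormal_iff_ite.1 hu
  let x := inner ℝ b₀ (u 1)
  let y := -inner ℝ b₀ (u 0)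
  let x' := inner ℝ b₀ (u 3)
  let y' := -inner ℝ b₀ (u 2)
  have hE := IsListed.dim6_b 1 x y x' y' κ one_ne_zero hκ
  refine ⟨6, _, hE, hE.exists_realizes h.symm hg ![z, w, ι (u 0) + x • z, ι (u 1) + y • z,
    κ • ι (u 2) + x' • z, κ • ι (u 3) + y' • z] ?_ ?_⟩
  · intro i j hij
    fin_cases i <;> fin_cases j <;> first
      | exact absurd hij (by decide)
      | (simp [Entry.structureConst, Fin.sum_univ_succ, h.lie_z, h.lie_z', h.lie_w, h.lie_w',
          h.lie_ι, hA0, hA1, hA2, hA3, hξ, inner_smul_right, hin, hu.1, x, y, x', y']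
         try module)
  · intro i j hij
    fin_cases i <;> fin_cases j <;> first
      | exact absurd hij (by decide)
      | (simp [h.apply_z_z, h.apply_z_w, h.apply_w_w, h.apply_w_z, h.apply_ι_z, h.apply_ι_w,
          h.apply_z_ι, h.apply_w_ι, h.apply_ι_ι, inner_smul_right, hin, hu.1, x, y, x', y']
         try ring)

/-- The case `P = 0`, `A = 0` with `ξ` of rank one. The third basis vector is the bracket of `w`
with `ι (u 1)`, so that it carries the component of `b₀` along `u 1`. -/
theorem hasListedBasis_nilpotent_dim4 (h : IsFlatFrame B 0 A ξ b₀ z w ι) (hg : finrank ℝ g = 4)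
    {u : Fin 2 → V} (hu : Orthonormal ℝ u) {r : ℝ} (hr : r ≠ 0) (hξ0 : ξ (u 0) = 0)
    (hξ1 : ξ (u 1) = r • u 0) (hA : A = 0) :
    HasListedBasis B := by
  have hin := orthonormal_iff_ite.1 hu
  obtain ⟨a, ha⟩ : ∃ a, inner ℝ b₀ (u 0) = a * r := ⟨_, (div_mul_cancel₀ _ hr).symm⟩
  have hr2 : 0 < r ^ 2 := by positivity
  have hE := IsListed.dim4_b (r ^ 2) (-inner ℝ b₀ (u 1)) a hr2
  refine ⟨4, _, hE, hE.exists_realizes h.symm hg ![r ^ 2 • z, w, -(r • ι (u 0)) -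
    (inner ℝ b₀ (u 1) : ℝ) • z, ι (u 1)] ?_ ?_⟩
  · intro i j hij
    fin_cases i <;> fin_cases j <;> first
      | exact absurd hij (by decide)
      | (simp [Entry.structureConst, Fin.sum_univ_succ, h.lie_z, h.lie_z', h.lie_w, h.lie_w',
          h.lie_ι, hA, hξ0, hξ1, inner_smul_right, hin, hu.1, ha]
         try module)
  · intro i j hij
    fin_cases i <;> fin_cases j <;> first
      | exact absurd hij (by decide)
      | (simp [h.apply_z_z, h.apply_z_w, h.apply_w_w, h.apply_w_z, h.apply_ι_z, h.apply_ι_w,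
          h.apply_z_ι, h.apply_w_ι, h.apply_ι_ι, inner_smul_right, hin, hu.1, ha]
         try ring)

theorem hasListedBasis_nilpotent_dim5 (h : IsFlatFrame B 0 A ξ b₀ z w ι) (hg : finrank ℝ g = 5)
    {u : Fin 3 → V} (hu : Orthonormal ℝ u) {r : ℝ} (hr : r ≠ 0) (hξ0 : ξ (u 0) = 0)
    (hξ1 : ξ (u 1) = r • u 0) (hξ2 : ξ (u 2) = 0) (hA : A = 0) :
    HasListedBasis B := by
  have hin := orthonormal_iff_ite.1 hu
  obtain ⟨a, ha⟩ : ∃ a, inner ℝ b₀ (u 0) = a * r := ⟨_, (div_mul_cancel₀ _ hr).symm⟩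
  have hr2 : 0 < r ^ 2 := by positivity
  obtain ⟨b, hb⟩ : ∃ b, inner ℝ b₀ (u 2) = -(b * r ^ 2) :=
    ⟨-(inner ℝ b₀ (u 2) / r ^ 2), by field_simp⟩
  have hE := IsListed.dim5_b (r ^ 2) (-inner ℝ b₀ (u 1)) a b 0 hr2 (by simp)
  refine ⟨5, _, hE, hE.exists_realizes h.symm hg ![r ^ 2 • z, w, -(r • ι (u 0)) -
    (inner ℝ b₀ (u 1) : ℝ) • z, ι (u 2), ι (u 1)] ?_ ?_⟩
  · intro i j hij
    fin_cases i <;> fin_cases j <;> first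
      | exact absurd hij (by decide)
      | (simp [Entry.structureConst, Fin.sum_univ_succ, h.lie_z, h.lie_z', h.lie_w, h.lie_w',
          h.lie_ι, hA, hξ0, hξ1, hξ2, inner_smul_right, hin, hu.1, ha, hb]
         try module)
  · intro i j hij
    fin_cases i <;> fin_cases j <;> first
      | exact absurd hij (by decide)
      | (simp [h.apply_z_z, h.apply_z_w, h.apply_w_w, h.apply_w_z, h.apply_ι_z, h.apply_ι_w,
          h.apply_z_ι, h.apply_w_ι, h.apply_ι_ι, inner_smul_right, hin, hu.1, ha, hb]
         try ring)

theorem hasListedBasis_nilpotent_dim6 (h : IsFlatFrame B 0 A ξ b₀ z w ι) (hg : finrank ℝ g = 6)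
    {u : Fin 4 → V} (hu : Orthonormal ℝ u) {r : ℝ} (hr : r ≠ 0) (hξ0 : ξ (u 0) = 0)
    (hξ1 : ξ (u 1) = r • u 0) (hξ2 : ξ (u 2) = 0) (hξ3 : ξ (u 3) = 0) (hA : A = 0) :
    HasListedBasis B := by
  have hin := orthonormal_iff_ite.1 hu
  obtain ⟨a, ha⟩ : ∃ a, inner ℝ b₀ (u 0) = a * r := ⟨_, (div_mul_cancel₀ _ hr).symm⟩
  have hr2 : 0 < r ^ 2 := by positivity
  obtain ⟨b, hb⟩ : ∃ b, inner ℝ b₀ (u 2) = -(b * r ^ 2) :=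
    ⟨-(inner ℝ b₀ (u 2) / r ^ 2), by field_simp⟩
  obtain ⟨c, hc⟩ : ∃ c, inner ℝ b₀ (u 3) = -(c * r ^ 2) :=
    ⟨-(inner ℝ b₀ (u 3) / r ^ 2), by field_simp⟩
  have hE := IsListed.dim6_e (r ^ 2) (-inner ℝ b₀ (u 1)) a b c 0 0 hr2 (by simp)
  refine ⟨6, _, hE, hE.exists_realizes h.symm hg ![r ^ 2 • z, w, -(r • ι (u 0)) -
    (inner ℝ b₀ (u 1) : ℝ) • z, ι (u 2), ι (u 3), ι (u 1)] ?_ ?_⟩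
  · intro i j hij
    fin_cases i <;> fin_cases j <;> first
      | exact absurd hij (by decide)
      | (simp [Entry.structureConst, Fin.sum_univ_succ, h.lie_z, h.lie_z', h.lie_w, h.lie_w',
          h.lie_ι, hA, hξ0, hξ1, hξ2, hξ3, inner_smul_right, hin, hu.1, ha, hb, hc]
         try module)
  · intro i j hij
    fin_cases i <;> fin_cases j <;> first
      | exact absurd hij (by decide)
      | (simp [h.apply_z_z, h.apply_z_w, h.apply_w_w, h.apply_w_z, h.apply_ι_z, h.apply_ι_w,
          h.apply_z_ι, h.apply_w_ι, h.apply_ι_ι, inner_smul_right, hin, hu.1, ha, hb, hc]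
         try ring)

/-- The case `P = 0` with `ξ` of rank one and `A` a rotation of the plane orthogonal to `u 0` and
`u 1`. -/
theorem hasListedBasis_nilpotent_rotation (h : IsFlatFrame B 0 A ξ b₀ z w ι) (hg : finrank ℝ g = 6)
    {u : Fin 4 → V} (hu : Orthonormal ℝ u) {r : ℝ} (hr : r ≠ 0) (hξ0 : ξ (u 0) = 0)
    (hξ1 : ξ (u 1) = r • u 0) (hξ2 : ξ (u 2) = 0) (hξ3 : ξ (u 3) = 0) (hA0 : A (u 0) = 0)
    (hA1 : A (u 1) = 0) (hA2 : A (u 2) = u 3) (hA3 : A (u 3) = -u 2) :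
    HasListedBasis B := by
  have hin := orthonormal_iff_ite.1 hu
  obtain ⟨a, ha⟩ : ∃ a, inner ℝ b₀ (u 0) = a * r := ⟨_, (div_mul_cancel₀ _ hr).symm⟩
  have hr2 : 0 < r ^ 2 := by positivity
  let x := inner ℝ b₀ (u 3)
  let y := -inner ℝ b₀ (u 2)
  have hE := IsListed.dim6_f (r ^ 2) 1 x y (-inner ℝ b₀ (u 1)) a hr2 one_pos
  refine ⟨6, _, hE, hE.exists_realizes h.symm hg ![r ^ 2 • z, w, ι (u 2) + x • z, ι (u 3) + y • z,
    -(r • ι (u 0)) - (inner ℝ b₀ (u 1) : ℝ) • z, ι (u 1)] ?_ ?_⟩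
  · intro i j hij
    fin_cases i <;> fin_cases j <;> first
      | exact absurd hij (by decide)
      | (simp [Entry.structureConst, Fin.sum_univ_succ, h.lie_z, h.lie_z', h.lie_w, h.lie_w',
          h.lie_ι, hA0, hA1, hA2, hA3, hξ0, hξ1, hξ2, hξ3, inner_smul_right, hin, hu.1, ha, x, y]
         try module)
  · intro i j hij
    fin_cases i <;> fin_cases j <;> first
      | exact absurd hij (by decide)
      | (simp [h.apply_z_z, h.apply_z_w, h.apply_w_w, h.apply_w_z, h.apply_ι_z, h.apply_ι_w,
          h.apply_z_ι, h.apply_w_ι, h.apply_ι_ι, inner_smul_right, hin, hu.1, ha, x, y]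
         try ring)

/-- The case `P = 0` with `ξ` of rank two and `A` acting as the same rotation on the image of `ξ`
and on its orthogonal complement. The listed entry has angle zero and length `ρ`; its basis is not
orthogonal, since multiples of the first two vectors are added to the other two. The multiples of
`z` absorb `b₀`. -/
theorem hasListedBasis_rank_two_rotation (h : IsFlatFrame B 0 A ξ b₀ z w ι) (hg : finrank ℝ g = 6)
    {u : Fin 4 → V} (hu : Orthonormal ℝ u) {ρ : ℝ} (hρ : 0 < ρ) (hA0 : A (u 0) = u 1)
    (hA1 : A (u 1) = -u 0) (hA2 : A (u 2) = u 3) (hA3 : A (u 3) = -u 2) (hξ0 : ξ (u 0) = 0)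
    (hξ1 : ξ (u 1) = 0) (hξ2 : ξ (u 2) = -(ρ • u 0)) (hξ3 : ξ (u 3) = -(ρ • u 1)) :
    HasListedBasis B := by
  have hin := orthonormal_iff_ite.1 hu
  let x := inner ℝ b₀ (u 1)
  let y := -inner ℝ b₀ (u 0)
  let p := inner ℝ b₀ (u 3) + ρ * y
  let q := -inner ℝ b₀ (u 2) - ρ * x
  have hE := IsListed.dim6_g ρ 0 ρ 0 x y (p - ρ * y) (q + ρ * x) hρ (by simp) (by simp)
  refine ⟨6, _, hE, hE.exists_realizes h.symm hg ![z, w, ι (u 0) + x • z, ι (u 1) + y • z,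
    ι (u 2) + p • z - ρ • (ι (u 1) + y • z), ι (u 3) + q • z + ρ • (ι (u 0) + x • z)] ?_ ?_⟩
  · intro i j hij
    fin_cases i <;> fin_cases j <;> first
      | exact absurd hij (by decide)
      | (simp [Entry.structureConst, Fin.sum_univ_succ, h.lie_z, h.lie_z', h.lie_w, h.lie_w',
          h.lie_ι, hA0, hA1, hA2, hA3, hξ0, hξ1, hξ2, hξ3, inner_smul_right, hin, hu.1, x, y, p, q]
         try module)
  · intro i j hij
    fin_cases i <;> fin_cases j <;> first
      | exact absurd hij (by decide)
      | (simp [h.apply_z_z, h.apply_z_w, h.apply_w_w, h.apply_w_z, h.apply_ι_z, h.apply_ι_w,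
          h.apply_z_ι, h.apply_w_ι, h.apply_ι_ι, inner_smul_right, hin, hu.1, x, y, p, q]
         try ring)

end IsFlatFrame
end

/-! ### Bases realizing the remaining entries -/

section

set_option linter.unusedSimpArgs false

variable {g : Type*} [LieRing g] [LieAlgebra ℝ g] {B : LinearMap.BilinForm ℝ g}
variable {V : Type*} [NormedAddCommGroup V] [InnerProductSpace ℝ V]
  {P : V →ₗ[ℝ] V →ₗ[ℝ] V} {A ξ : V →ₗ[ℝ] V} {b₀ : V} {z w : g} {ι : V →ₗ[ℝ] g}

namespace IsFlatFrame

variable [FiniteDimensional ℝ g]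

/-- The case `P = 0`, `A = 0` with `ξ` of rank two. The entry depends on the two angles only
through their difference, the angle between `p₁` and `p₂`. -/
theorem hasListedBasis_rank_two (h : IsFlatFrame B 0 A ξ b₀ z w ι) (hg : finrank ℝ g = 6)
    {w₁ w₂ p₁ p₂ : V} (hw : Orthonormal ℝ ![w₁, w₂]) (hp : LinearIndependent ℝ ![p₁, p₂])
    (h11 : inner ℝ w₁ p₁ = 0) (h12 : inner ℝ w₁ p₂ = 0) (h21 : inner ℝ w₂ p₁ = 0)
    (h22 : inner ℝ w₂ p₂ = 0) (hA : A = 0) (hξ1 : ξ w₁ = p₁) (hξ2 : ξ w₂ = p₂)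
    (hξ3 : ξ p₁ = 0) (hξ4 : ξ p₂ = 0) : HasListedBasis B := by
  have hw1 : ‖w₁‖ = 1 := hw.1 0
  have hw2 : ‖w₂‖ = 1 := hw.1 1
  have hw12 : inner ℝ w₁ w₂ = 0 := hw.2 (i := 0) (j := 1) (by decide)
  have hw21 : inner ℝ w₂ w₁ = 0 := hw.2 (i := 1) (j := 0) (by decide)
  have hp1 : p₁ ≠ 0 := hp.ne_zero 0
  have hp2 : p₂ ≠ 0 := hp.ne_zero 1
  have h11' : inner ℝ p₁ w₁ = 0 := by rw [real_inner_comm, h11]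
  have h12' : inner ℝ p₂ w₁ = 0 := by rw [real_inner_comm, h12]
  have h21' : inner ℝ p₁ w₂ = 0 := by rw [real_inner_comm, h21]
  have h22' : inner ℝ p₂ w₂ = 0 := by rw [real_inner_comm, h22]
  have hcos : inner ℝ p₁ p₂ =
      ‖p₁‖ * ‖p₂‖ * Real.cos (InnerProductGeometry.angle p₁ p₂ - 0) := by
    rw [sub_zero, mul_comm, InnerProductGeometry.cos_angle_mul_norm_mul_norm]
  have hpp : inner ℝ p₂ p₁ = (inner ℝ p₁ p₂ : ℝ) := real_inner_comm _ _
  have hsin : Real.sin (InnerProductGeometry.angle p₁ p₂ - 0) ≠ 0 := by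
    rw [sub_zero]
    intro h0
    have hdep : ∀ r : ℝ, p₂ ≠ r • p₁ := fun r hr => by
      rw [LinearIndependent.pair_iff] at hp
      have := hp r (-1) (by rw [hr]; module)
      norm_num at this
    rcases InnerProductGeometry.sin_eq_zero_iff_angle_eq_zero_or_angle_eq_pi.1 h0 with h1 | h1
    · obtain ⟨-, r, -, hr⟩ := InnerProductGeometry.angle_eq_zero_iff.1 h1
      exact hdep r hr
    · obtain ⟨-, r, -, hr⟩ := InnerProductGeometry.angle_eq_pi_iff.1 h1
      exact hdep r hr
  have hE := IsListed.dim6_d ‖p₁‖ ‖p₂‖ (InnerProductGeometry.angle p₁ p₂) 0 (inner ℝ p₁ p₂)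
    (-inner ℝ b₀ w₁) (-inner ℝ b₀ w₂) (inner ℝ b₀ p₁) (inner ℝ b₀ p₂) (norm_pos_iff.2 hp1)
    (norm_pos_iff.2 hp2) hsin hcos
  refine ⟨6, _, hE, hE.exists_realizes h.symm hg ![z, w, -ι p₁ - (inner ℝ b₀ w₁ : ℝ) • z,
    -ι p₂ - (inner ℝ b₀ w₂ : ℝ) • z, ι w₁, ι w₂] ?_ ?_⟩
  · intro i j hij
    fin_cases i <;> fin_cases j <;> first
      | exact absurd hij (by decide)
      | (simp [Entry.structureConst, Fin.sum_univ_succ, h.lie_z, h.lie_z', h.lie_w, h.lie_w',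
          h.lie_ι, hA, hξ1, hξ2, hξ3, hξ4, hpp, h11, h12, h21, h22]
         try module)
  · intro i j hij
    fin_cases i <;> fin_cases j <;> first
      | exact absurd hij (by decide)
      | (simp [h.apply_z_z, h.apply_z_w, h.apply_w_w, h.apply_w_z, h.apply_ι_z, h.apply_ι_w,
          h.apply_z_ι, h.apply_w_ι, h.apply_ι_ι, hw1, hw2, hw12, h11', h12', h21', h22']
         try ring)

/-- The case `P ≠ 0` and `finrank ℝ V = 3`. The vector `u 0` is scaled by `r⁻¹`, so that its
bracket is a rotation by a right angle. The shifts by multiples of `z` remove the `z`-components of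
the brackets of `ι (u 0)` with the rotated plane; those of `w` with the plane then vanish as well,
because of the values of `b₀` on the plane. -/
theorem hasListedBasis_nonabelian_dim5 (h : IsFlatFrame B P A ξ b₀ z w ι) (hg : finrank ℝ g = 5)
    {u : Fin 3 → V} (hu : Orthonormal ℝ u) {r θ w₁ w₂ β : ℝ} (hr : r ≠ 0) (hβ : β ≠ 0)
    (hP : ∀ a b, P a b = (r * inner ℝ (u 0) a) •
      (inner ℝ (u 1) b • u 2 - (inner ℝ (u 2) b : ℝ) • u 1))
    (hA0 : A (u 0) = 0) (hA1 : A (u 1) = θ • u 2) (hA2 : A (u 2) = -(θ • u 1))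
    (hξ0 : ξ (u 0) = w₁ • u 1 + w₂ • u 2) (hξ1 : ξ (u 1) = 0) (hξ2 : ξ (u 2) = 0)
    (hb0 : inner ℝ b₀ (u 0) = β) (hb1 : inner ℝ b₀ (u 1) = θ / r * w₁)
    (hb2 : inner ℝ b₀ (u 2) = θ / r * w₂) : HasListedBasis B := by
  have hin := orthonormal_iff_ite.1 hu
  have hE := IsListed.dim5_d (r ^ 2) (-(w₁ / r ^ 2)) (-(w₂ / r ^ 2)) (-(β / r)) θ (by positivity)
    (by simp [hr, hβ])
  refine ⟨5, _, hE, hE.exists_realizes h.symm hg ![z, w, r⁻¹ • ι (u 0), r • ι (u 1) + w₂ • z,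
    r • ι (u 2) - w₁ • z] ?_ ?_⟩
  · intro i j hij
    fin_cases i <;> fin_cases j <;> first
      | exact absurd hij (by decide)
      | (simp [Entry.structureConst, Fin.sum_univ_succ, h.lie_z, h.lie_z', h.lie_w, h.lie_w',
          h.lie_ι, hP, hA0, hA1, hA2, hξ0, hξ1, hξ2, hb0, hb1, hb2, hin, hu.1, inner_add_right,
          inner_smul_right, hr]
         try (match_scalars <;> field_simp <;> ring))
  · intro i j hij
    fin_cases i <;> fin_cases j <;> first
      | exact absurd hij (by decide)
      | (simp [h.apply_z_z, h.apply_z_w, h.apply_w_w, h.apply_w_z, h.apply_ι_z, h.apply_ι_w,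
          h.apply_z_ι, h.apply_w_ι, h.apply_ι_ι, hin, hu.1]
         try field_simp)

/-- The case `P ≠ 0` and `finrank ℝ V = 4`. The vectors `u 0` and `u 3` are scaled by inverse
factors, which realizes the condition `α β - γ ^ 2 = 1` with `γ = 0`. -/
theorem hasListedBasis_nonabelian_dim6 (h : IsFlatFrame B P A ξ b₀ z w ι) (hg : finrank ℝ g = 6)
    {u : Fin 4 → V} (hu : Orthonormal ℝ u) {r θ w₁ w₂ β δ q : ℝ} (hr : r ≠ 0)
    (hβ : ¬ (q = 0 ∧ β = 0 ∧ δ = 0))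
    (hP : ∀ a b, P a b = (r * inner ℝ (u 0) a) •
      (inner ℝ (u 1) b • u 2 - (inner ℝ (u 2) b : ℝ) • u 1))
    (hA0 : A (u 0) = 0) (hA1 : A (u 1) = θ • u 2) (hA2 : A (u 2) = -(θ • u 1))
    (hA3 : A (u 3) = 0) (hξ0 : ξ (u 0) = q • u 3 + w₁ • u 1 + w₂ • u 2) (hξ1 : ξ (u 1) = 0)
    (hξ2 : ξ (u 2) = 0) (hξ3 : ξ (u 3) = 0) (hb0 : inner ℝ b₀ (u 0) = β)
    (hb1 : inner ℝ b₀ (u 1) = θ / r * w₁) (hb2 : inner ℝ b₀ (u 2) = θ / r * w₂)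
    (hb3 : inner ℝ b₀ (u 3) = δ) : HasListedBasis B := by
  have hin := orthonormal_iff_ite.1 hu
  have hE := IsListed.dim6_h (r ^ 2) (r⁻¹ ^ 2) 0 (-(q / r ^ 2)) (-(w₁ / r)) (-(w₂ / r))
    (-(β / r ^ 3)) (-(δ / r)) θ (by positivity) (by positivity) (by simp [hr])
    (by simpa [hr] using hβ)
  refine ⟨6, _, hE, hE.exists_realizes h.symm hg ![r ^ 2 • z, w, r⁻¹ • ι (u 0), r • ι (u 3),
    ι (u 1) + (w₂ / r) • z, ι (u 2) - (w₁ / r) • z] ?_ ?_⟩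
  · intro i j hij
    fin_cases i <;> fin_cases j <;> first
      | exact absurd hij (by decide)
      | (simp [Entry.structureConst, Fin.sum_univ_succ, h.lie_z, h.lie_z', h.lie_w, h.lie_w',
          h.lie_ι, hP, hA0, hA1, hA2, hA3, hξ0, hξ1, hξ2, hξ3, hb0, hb1, hb2, hb3, hin, hu.1,
          inner_add_right, inner_smul_right, hr]
         try (match_scalars <;> field_simp <;> ring))
  · intro i j hij
    fin_cases i <;> fin_cases j <;> first
      | exact absurd hij (by decide)
      | (simp [h.apply_z_z, h.apply_z_w, h.apply_w_w, h.apply_w_z, h.apply_ι_z, h.apply_ι_w,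
          h.apply_z_ι, h.apply_w_ι, h.apply_ι_ι, hin, hu.1]
         try field_simp)

end IsFlatFrame
end

/-! ### Operators whose commutator with a skew operator is minus their square -/

section

variable {V : Type*} [NormedAddCommGroup V] [InnerProductSpace ℝ V] [FiniteDimensional ℝ V]
variable {A ξ : Module.End ℝ V}

theorem commutator_pow_of_commutator_eq_neg_sq {R : Type*} [Ring R] {a x : R}
    (h : a * x - x * a = -x ^ 2) (k : ℕ) : a * x ^ k - x ^ k * a = -(k * x ^ (k + 1)) := by
  induction k with
  | zero => simp
  | succ k ih =>
    have : a * x ^ (k + 1) - x ^ (k + 1) * a =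
        (a * x ^ k - x ^ k * a) * x + x ^ k * (a * x - x * a) := by
      rw [pow_succ]
      noncomm_ring
    rw [this, ih, h]
    push_cast
    rw [pow_succ x (k + 1), pow_succ x k]
    noncomm_ring

open Polynomial in
theorem commutator_aeval_of_commutator_eq_neg_sq {R : Type*} [Ring R] [Algebra ℝ R] {a x : R}
    (h : a * x - x * a = -x ^ 2) (p : ℝ[X]) :
    a * aeval x p - aeval x p * a = -(x ^ 2 * aeval x (derivative p)) := by
  induction p using Polynomial.induction_on' with
  | add p q hp hq =>
    rw [map_add, map_add, map_add, mul_add, mul_add, add_mul, neg_add, ← hp, ← hq]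
    abel
  | monomial n r =>
    rw [derivative_monomial, aeval_monomial, aeval_monomial, ← Algebra.smul_def,
      ← Algebra.smul_def, mul_smul_comm, smul_mul_assoc, ← smul_sub, mul_smul_comm, mul_smul,
      ← smul_neg, commutator_pow_of_commutator_eq_neg_sq h]
    congr 2
    cases n with
    | zero => simp
    | succ n =>
      rw [Nat.add_sub_cancel, ← pow_add, ← nsmul_eq_mul, Nat.cast_smul_eq_nsmul, add_comm 2 n]

open Polynomial in
/-- The relation makes the ideal of the minimal polynomial `p` stable under `X ^ 2 * d/dX`, so that
`p` divides `X ^ 2 * p'` and is a power of `X`. -/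
theorem isNilpotent_of_commutator_eq_neg_sq (h : A * ξ - ξ * A = -ξ ^ 2) : IsNilpotent ξ := by
  set p := minpoly ℝ ξ with hp
  have hp0 : p ≠ 0 := minpoly.ne_zero (Algebra.IsIntegral.isIntegral ξ)
  have hdvd : p ∣ X ^ 2 * derivative p := by
    apply minpoly.dvd
    have := commutator_aeval_of_commutator_eq_neg_sq h p
    rw [hp, minpoly.aeval, mul_zero, zero_mul, sub_zero, eq_comm, neg_eq_zero] at this
    rwa [map_mul, map_pow, aeval_X]
  obtain ⟨q, hq, hqX⟩ := exists_eq_pow_rootMultiplicity_mul_and_not_dvd p hp0 0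
  rw [C_0, sub_zero] at hq hqX
  generalize rootMultiplicity 0 p = k at hq
  have hq0 : q ≠ 0 := fun h0 => hqX (h0 ▸ dvd_zero X)
  have hder : X ^ 2 * derivative p = X ^ k * (X * (C (k : ℝ) * q + X * derivative q)) := by
    rw [hq, derivative_mul, derivative_X_pow]
    cases k with
    | zero =>
      simp
      ring
    | succ k =>
      rw [Nat.add_sub_cancel]
      ring
  rw [hder, hq] at hdvd
  have h1 : q ∣ X * (C (k : ℝ) * q + X * derivative q) :=
    (mul_dvd_mul_iff_left (pow_ne_zero k X_ne_zero)).1 hdvd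
  have hcop : IsCoprime q X := ((irreducible_X (R := ℝ)).coprime_iff_not_dvd.2 hqX).symm
  have h2 : q ∣ X * derivative q :=
    (dvd_add_right (Dvd.intro_left _ rfl)).1 (hcop.dvd_of_dvd_mul_left h1)
  have h3 : q ∣ derivative q := hcop.dvd_of_dvd_mul_left h2
  have h4 : derivative q = 0 := by
    by_contra hne
    have := degree_le_of_dvd h3 hne
    exact absurd (degree_derivative_lt hq0) (not_lt.2 this)
  have h5 : q = C (q.coeff 0) :=
    eq_C_of_natDegree_eq_zero (derivative_eq_zero.1 h4)
  have hc : q.coeff 0 ≠ 0 := fun h0 => hq0 (by rw [h5, h0, C_0])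
  refine ⟨k, ?_⟩
  have h6 := minpoly.aeval ℝ ξ
  rw [← hp, hq, h5, map_mul, map_pow, aeval_X, aeval_C, ← Algebra.commutes,
    ← Algebra.smul_def] at h6
  exact (smul_eq_zero.1 h6).resolve_left hc

/-- If `A` is skew and `[A, ξ] = -ξ²` then `ξ² = 0`. Indeed `ξ` is nilpotent. If `k ≥ 2` is maximal
with `ξᵏ ≠ 0`, then `ad A` is skew for the Hilbert-Schmidt product and maps `ξᵏ⁻¹` to a nonzero
multiple of `ξᵏ` and `ξᵏ` to `0`, so that `ξᵏ` is orthogonal to itself. -/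
theorem sq_eq_zero_of_commutator_eq_neg_sq (hA : ∀ a b, inner ℝ (A a) b = -inner ℝ a (A b))
    (h : A * ξ - ξ * A = -ξ ^ 2) : ξ ^ 2 = 0 := by
  by_contra hne
  have hnil := isNilpotent_of_commutator_eq_neg_sq h
  classical
  have hk2 : 2 < Nat.find hnil := by
    by_contra! hle
    exact hne (pow_eq_zero_of_le hle (Nat.find_spec hnil))
  obtain ⟨k, hk⟩ : ∃ k, Nat.find hnil = k + 3 := ⟨_, (Nat.sub_add_cancel hk2).symm⟩
  have hX0 : ξ ^ (k + 2) ≠ 0 := Nat.find_min hnil (by omega)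
  have hX1 : ξ ^ (k + 3) = 0 := hk ▸ Nat.find_spec hnil
  have c1 := commutator_pow_of_commutator_eq_neg_sq h (k + 1)
  have c2 := commutator_pow_of_commutator_eq_neg_sq h (k + 2)
  rw [hX1, mul_zero, neg_zero, sub_eq_zero] at c2
  have hadj : LinearMap.adjoint A = -A := by
    symm
    rw [LinearMap.eq_adjoint_iff]
    intro a b
    rw [LinearMap.neg_apply, inner_neg_left, hA, neg_neg]
  have c3 : LinearMap.adjoint (ξ ^ (k + 2)) * A = A * LinearMap.adjoint (ξ ^ (k + 2)) := by
    have := congrArg LinearMap.adjoint c2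
    rw [Module.End.mul_eq_comp, Module.End.mul_eq_comp, LinearMap.adjoint_comp,
      LinearMap.adjoint_comp, hadj, ← Module.End.mul_eq_comp, ← Module.End.mul_eq_comp, mul_neg,
      neg_mul, neg_inj] at this
    exact this
  have htr : LinearMap.trace ℝ V (LinearMap.adjoint (ξ ^ (k + 2)) * ξ ^ (k + 2)) = 0 := by
    have h1 : LinearMap.trace ℝ V (LinearMap.adjoint (ξ ^ (k + 2)) *
        (A * ξ ^ (k + 1) - ξ ^ (k + 1) * A)) = 0 := by
      rw [mul_sub, map_sub, ← mul_assoc, c3, ← mul_assoc, LinearMap.trace_mul_comm _ _ A,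
        ← mul_assoc, sub_self]
    rw [c1, ← nsmul_eq_mul, mul_neg, mul_smul_comm, map_neg, map_nsmul, neg_eq_zero,
      nsmul_eq_mul] at h1
    exact (mul_eq_zero.1 h1).resolve_left (by positivity)
  let e := stdOrthonormalBasis ℝ V
  rw [LinearMap.trace_eq_sum_inner _ e] at htr
  simp only [Module.End.mul_apply, LinearMap.adjoint_inner_right] at htr
  rw [Finset.sum_eq_zero_iff_of_nonneg fun i _ => real_inner_self_nonneg] at htr
  exact hX0 (e.toBasis.ext fun i => by simpa using htr i (Finset.mem_univ i))

end

/-! ### Classification for abelian quotient -/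

section

variable {V : Type*} [NormedAddCommGroup V] [InnerProductSpace ℝ V]

theorem orthonormal_pair {a b : V} (ha : ‖a‖ = 1) (hb : ‖b‖ = 1) (hab : inner ℝ a b = 0) :
    Orthonormal ℝ ![a, b] := by
  rw [orthonormal_vecCons_iff, orthonormal_vecCons_iff]
  refine ⟨ha, fun i => ?_, hb, fun i => i.elim0, fun i => i.elim0, fun i => i.elim0⟩
  fin_cases i
  exact hab

theorem orthonormal_triple {a b c : V} (h : Orthonormal ℝ ![a, b]) (hc : ‖c‖ = 1)
    (hac : inner ℝ a c = 0) (hbc : inner ℝ b c = 0) : Orthonormal ℝ ![a, b, c] := by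
  simp only [orthonormal_vecCons_iff] at h ⊢
  simp_all [Fin.forall_fin_succ]

theorem orthonormal_quadruple {a b c d : V} (h : Orthonormal ℝ ![a, b])
    (h' : Orthonormal ℝ ![c, d]) (hac : inner ℝ a c = 0) (hbc : inner ℝ b c = 0)
    (had : inner ℝ a d = 0) (hbd : inner ℝ b d = 0) : Orthonormal ℝ ![a, b, c, d] := by
  simp only [orthonormal_vecCons_iff] at h h' ⊢
  simp_all [Fin.forall_fin_succ]

theorem mem_orthogonal_span_range {k : ℕ} {v : Fin k → V} {x : V} :
    x ∈ (Submodule.span ℝ (Set.range v))ᗮ ↔ ∀ i, inner ℝ (v i) x = 0 := by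
  constructor
  · intro hx i
    exact Submodule.inner_right_of_mem_orthogonal (Submodule.subset_span (Set.mem_range_self i)) hx
  · intro hx
    rw [Submodule.mem_orthogonal]
    intro y hy
    refine Submodule.span_induction (p := fun y _ => inner ℝ y x = 0) ?_ ?_ ?_ ?_ hy
    · rintro _ ⟨i, rfl⟩
      exact hx i
    · exact inner_zero_left x
    · intro a b _ _ ha hb
      rw [inner_add_left, ha, hb, add_zero]
    · intro r a _ ha
      rw [inner_smul_left, ha, mul_zero]

theorem apply_mem_orthogonal_of_skew {A : V →ₗ[ℝ] V}
    (hA : ∀ a b, inner ℝ (A a) b = -inner ℝ a (A b)) {W : Submodule ℝ V}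
    (hW : ∀ a ∈ W, A a ∈ W) {x : V} (hx : x ∈ Wᗮ) : A x ∈ Wᗮ := by
  rw [Submodule.mem_orthogonal] at hx ⊢
  intro y hy
  rw [← neg_inj, ← hA, hx _ (hW y hy), neg_zero]

theorem apply_mem_span_range {A : V →ₗ[ℝ] V} {k : ℕ} {v : Fin k → V}
    (h : ∀ i, A (v i) ∈ Submodule.span ℝ (Set.range v)) {x : V}
    (hx : x ∈ Submodule.span ℝ (Set.range v)) : A x ∈ Submodule.span ℝ (Set.range v) := by
  have : Submodule.span ℝ (Set.range v) ≤ (Submodule.span ℝ (Set.range v)).comap A := by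
    rw [Submodule.span_le]
    rintro _ ⟨i, rfl⟩
    exact h i
  exact this hx

variable [FiniteDimensional ℝ V]

theorem Orthonormal.linearMap_eq_zero {k : ℕ} {v : Fin k → V} (hv : Orthonormal ℝ v)
    {W : Submodule ℝ V} (hvW : ∀ i, v i ∈ W) (h : finrank ℝ W ≤ k) {M : Type*} [AddCommGroup M]
    [Module ℝ M] {A : V →ₗ[ℝ] M}
    (hA : ∀ i, A (v i) = 0) {x : V} (hx : x ∈ W) : A x = 0 := by
  have hin := orthonormal_iff_ite.1 hv
  have hx' : x - ∑ i, (inner ℝ (v i) x : ℝ) • v i = 0 := by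
    refine hv.eq_zero_of_inner_eq_zero hvW h
      (W.sub_mem hx (W.sum_mem fun i _ => W.smul_mem _ (hvW i))) fun i => ?_
    simp [inner_sub_right, inner_sum, inner_smul_right, hin]
  rw [sub_eq_zero.1 hx', map_sum]
  exact Finset.sum_eq_zero fun i _ => by rw [map_smul, hA, smul_zero]

theorem Orthonormal.finrank_orthogonal {k : ℕ} {v : Fin k → V} (hv : Orthonormal ℝ v) :
    k + finrank ℝ (Submodule.span ℝ (Set.range v))ᗮ = finrank ℝ V := by
  rw [← Submodule.finrank_add_finrank_orthogonal (Submodule.span ℝ (Set.range v)),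
    finrank_span_eq_card hv.linearIndependent, Fintype.card_fin]

/-- A skew operator vanishes on an invariant line. -/
theorem exists_unit_of_skew_of_finrank_eq_one {A : V →ₗ[ℝ] V}
    (hA : ∀ a b, inner ℝ (A a) b = -inner ℝ a (A b)) {W : Submodule ℝ V}
    (hW : finrank ℝ W = 1) (hAW : ∀ a ∈ W, A a ∈ W) : ∃ u ∈ W, ‖u‖ = 1 ∧ A u = 0 := by
  obtain ⟨u, huW, hu, -⟩ := exists_unit_orthogonal W ![] (by omega)
  refine ⟨u, huW, hu, ?_⟩
  have ho : Orthonormal ℝ ![u] := by simp [hu, Orthonormal]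
  refine ho.eq_zero_of_inner_eq_zero (W := W) (fun i => ?_) hW.le (hAW u huW) fun i => ?_
  · fin_cases i
    exact huW
  · fin_cases i
    exact inner_self_of_skew hA u

end

section

variable {g : Type*} [LieRing g] [LieAlgebra ℝ g] {B : LinearMap.BilinForm ℝ g}
variable {V : Type*} [NormedAddCommGroup V] [InnerProductSpace ℝ V]
  {P : V →ₗ[ℝ] V →ₗ[ℝ] V} {A ξ : V →ₗ[ℝ] V} {b₀ : V} {z w : g} {ι : V →ₗ[ℝ] g}

namespace IsFlatFrame

variable [FiniteDimensional ℝ g]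

/-- Here `w₁`, `w₂` span the complement of the kernel of `ξ`. As `A` commutes with `ξ`, the images
of `w₁` and `w₂` are orthogonal to each other and of equal length, and `A` rotates them as well. -/
theorem hasListedBasis_of_rank_two_of_rotation (h : IsFlatFrame B 0 A ξ b₀ z w ι)
    (hg : finrank ℝ g = 6) (hA : ∀ a b, inner ℝ (A a) b = -inner ℝ a (A b))
    (hAξ : ∀ a, A (ξ a) = ξ (A a)) (hξ2 : ∀ a, ξ (ξ a) = 0) {w₁ w₂ : V}
    (ho : Orthonormal ℝ ![w₁, w₂]) (h1 : A w₁ = w₂) (h2 : A w₂ = -w₁)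
    (hperp : ∀ x, inner ℝ w₁ (ξ x) = 0 ∧ inner ℝ w₂ (ξ x) = 0) (h0 : ξ w₁ ≠ 0) :
    HasListedBasis B := by
  have hρ : 0 < ‖ξ w₁‖ := norm_pos_iff.2 h0
  set ρ := ‖ξ w₁‖ with hρdef
  obtain ⟨u₁, hu1⟩ : ∃ u₁, u₁ = -(ρ⁻¹ • ξ w₁) := ⟨_, rfl⟩
  obtain ⟨u₂, hu2⟩ : ∃ u₂, u₂ = -(ρ⁻¹ • ξ w₂) := ⟨_, rfl⟩
  have hAu1 : A u₁ = u₂ := by rw [hu1, hu2, map_neg, map_smul, hAξ, h1]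
  have hAu2 : A u₂ = -u₁ := by rw [hu1, hu2, map_neg, map_smul, hAξ, h2, map_neg, smul_neg]
  have hn1 : ‖u₁‖ = 1 := by
    rw [hu1, norm_neg, norm_smul, norm_inv, Real.norm_of_nonneg hρ.le, inv_mul_cancel₀ hρ.ne']
  have hn2 : ‖u₂‖ = 1 := by
    have : inner ℝ u₂ u₂ = (1 : ℝ) := by
      nth_rewrite 1 [← hAu1]
      rw [hA, hAu2, inner_neg_right, neg_neg, real_inner_self_eq_norm_sq, hn1, one_pow]
    rw [real_inner_self_eq_norm_sq] at this
    nlinarith [norm_nonneg u₂]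
  have h12 : inner ℝ u₁ u₂ = 0 := by rw [← hAu1, inner_self_of_skew hA]
  have hw : ∀ x, inner ℝ (-(ρ⁻¹ • ξ x)) w₁ = 0 ∧ inner ℝ (-(ρ⁻¹ • ξ x)) w₂ = 0 := fun x => by
    rw [real_inner_comm, real_inner_comm w₂, inner_neg_right, inner_neg_right, inner_smul_right,
      inner_smul_right, (hperp x).1, (hperp x).2]
    simp
  refine h.hasListedBasis_rank_two_rotation hg (u := ![u₁, u₂, w₁, w₂])
    (orthonormal_quadruple (orthonormal_pair hn1 hn2 h12) ho (hu1 ▸ (hw w₁).1) (hu2 ▸ (hw w₂).1)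
      (hu1 ▸ (hw w₁).2) (hu2 ▸ (hw w₂).2)) hρ hAu1 hAu2 h1 h2 ?_ ?_ ?_ ?_
  · change ξ u₁ = 0
    rw [hu1, map_neg, map_smul, hξ2, smul_zero, neg_zero]
  · change ξ u₂ = 0
    rw [hu2, map_neg, map_smul, hξ2, smul_zero, neg_zero]
  · change ξ w₁ = -(ρ • u₁)
    rw [hu1, smul_neg, smul_smul, mul_inv_cancel₀ hρ.ne', one_smul, neg_neg]
  · change ξ w₂ = -(ρ • u₂)
    rw [hu2, smul_neg, smul_smul, mul_inv_cancel₀ hρ.ne', one_smul, neg_neg]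

variable [FiniteDimensional ℝ V]

theorem hasListedBasis_of_all_eq_zero (h : IsFlatFrame B 0 0 0 b₀ z w ι)
    (hg : finrank ℝ g = finrank ℝ V + 2) (hV : finrank ℝ V ≤ 4) (hb₀ : b₀ ≠ 0) :
    HasListedBasis B := by
  have hκ : 0 < ‖b₀‖ := norm_pos_iff.2 hb₀
  obtain ⟨u, hu, hbu⟩ : ∃ u : V, ‖u‖ = 1 ∧ b₀ = -(‖b₀‖ • u) :=
    ⟨-(‖b₀‖⁻¹ • b₀), by rw [norm_neg, norm_smul, norm_inv, norm_norm, inv_mul_cancel₀ hκ.ne'],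
      by rw [smul_neg, neg_neg, smul_smul, mul_inv_cancel₀ hκ.ne', one_smul]⟩
  have ho : Orthonormal ℝ ![u] := by simp [hu, Orthonormal]
  have hf := ho.finrank_orthogonal
  have hdim : finrank ℝ V = 1 ∨ finrank ℝ V = 2 ∨ finrank ℝ V = 3 ∨ finrank ℝ V = 4 := by omega
  have hex : ∀ {k : ℕ} (v : Fin k → V), k < finrank ℝ V → ∃ d, ‖d‖ = 1 ∧ ∀ i, inner ℝ (v i) d = 0 :=
    fun v hv => by
      obtain ⟨d, -, hd⟩ := exists_unit_orthogonal ⊤ v (by rwa [finrank_top])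
      exact ⟨d, hd⟩
  rcases hdim with hm | hm | hm | hm <;> rw [hm] at hg hex
  · exact h.hasListedBasis_heisenberg_dim3 hg ho hκ rfl rfl hbu
  · obtain ⟨d, hd, hud⟩ := hex ![u] (by norm_num)
    exact h.hasListedBasis_heisenberg_dim4 hg (orthonormal_pair hu hd (hud 0)) hκ rfl rfl hbu
  · obtain ⟨d, hd, hud⟩ := hex ![u] (by norm_num)
    have ho2 := orthonormal_pair hu hd (hud 0)
    obtain ⟨e, he, hue⟩ := hex ![u, d] (by norm_num)
    exact h.hasListedBasis_heisenberg_dim5 hg (orthonormal_triple ho2 he (hue 0) (hue 1)) hκ rfl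
      rfl hbu
  · obtain ⟨d, hd, hud⟩ := hex ![u] (by norm_num)
    have ho2 := orthonormal_pair hu hd (hud 0)
    obtain ⟨e, he, hue⟩ := hex ![u, d] (by norm_num)
    obtain ⟨f, hf, huf⟩ := hex ![u, d, e] (by norm_num)
    exact h.hasListedBasis_heisenberg_dim6 hg (orthonormal_quadruple ho2
      (orthonormal_pair he hf (huf 2)) (hue 0) (hue 1) (huf 0) (huf 1)) hκ rfl rfl hbu

theorem hasListedBasis_of_ξ_eq_zero (h : IsFlatFrame B 0 A 0 b₀ z w ι)
    (hg : finrank ℝ g = finrank ℝ V + 2) (hV : finrank ℝ V ≤ 4)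
    (hA : ∀ a b, inner ℝ (A a) b = -inner ℝ a (A b)) {u v : V} (ho : Orthonormal ℝ ![u, v])
    (hu : A u = v) (hv : A v = -u) : HasListedBasis B := by
  have hf := ho.finrank_orthogonal
  have hinv : ∀ x ∈ (Submodule.span ℝ (Set.range ![u, v]))ᗮ,
      A x ∈ (Submodule.span ℝ (Set.range ![u, v]))ᗮ := fun x hx =>
    apply_mem_orthogonal_of_skew hA (fun a ha => apply_mem_span_range (fun i => by
      fin_cases i
      · change A u ∈ _
        rw [hu]
        exact Submodule.subset_span ⟨1, rfl⟩
      · change A v ∈ _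
        rw [hv]
        exact Submodule.neg_mem _ (Submodule.subset_span ⟨0, rfl⟩)) ha) hx
  have hdim : finrank ℝ V = 2 ∨ finrank ℝ V = 3 ∨ finrank ℝ V = 4 := by omega
  rcases hdim with hm | hm | hm
  · exact h.hasListedBasis_rotation_dim4 (by omega) ho hu hv rfl
  · obtain ⟨d, hdW, hd, hAd⟩ := exists_unit_of_skew_of_finrank_eq_one hA (by omega) hinv
    rw [mem_orthogonal_span_range] at hdW
    exact h.hasListedBasis_rotation_dim5 (by omega) (orthonormal_triple ho hd (hdW 0) (hdW 1)) hu hv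
      hAd rfl
  · obtain ⟨d, hdW, e, heW, κ, hde, hAd, hAe⟩ :=
      exists_rotation_of_skew_of_finrank_eq_two hA (by omega) hinv
    rw [mem_orthogonal_span_range] at hdW heW
    have ho4 := orthonormal_quadruple ho hde (hdW 0) (hdW 1) (heW 0) (heW 1)
    by_cases hκ : κ = 0
    · rw [hκ, zero_smul] at hAd hAe
      exact h.hasListedBasis_rotation_dim6 (by omega) ho4 hu hv hAd (by simpa using hAe) rfl
    · exact h.hasListedBasis_rotation_rotation (by omega) ho4 hκ hu hv hAd hAe rfl

/-- On the plane of `u` and `v` the operator `A` vanishes, and on its orthogonal complement it is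
zero, or a rotation that is normalized by rescaling `w`. -/
theorem hasListedBasis_of_rank_one (h : IsFlatFrame B 0 A ξ b₀ z w ι)
    (hg : finrank ℝ g = finrank ℝ V + 2) (hV : finrank ℝ V ≤ 4)
    (hA : ∀ a b, inner ℝ (A a) b = -inner ℝ a (A b)) {u v : V} (ho : Orthonormal ℝ ![u, v])
    {r : ℝ} (hr : r ≠ 0) (hξu : ξ u = 0) (hξv : ξ v = r • u)
    (hξ : ∀ x, inner ℝ v x = 0 → ξ x = 0) (hu : A u = 0) (hv : A v = 0) : HasListedBasis B := by
  have hf := ho.finrank_orthogonal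
  have hinv : ∀ x ∈ (Submodule.span ℝ (Set.range ![u, v]))ᗮ,
      A x ∈ (Submodule.span ℝ (Set.range ![u, v]))ᗮ := fun x hx =>
    apply_mem_orthogonal_of_skew hA (fun a ha => apply_mem_span_range (fun i => by
      fin_cases i
      · change A u ∈ _
        rw [hu]
        exact Submodule.zero_mem _
      · change A v ∈ _
        rw [hv]
        exact Submodule.zero_mem _) ha) hx
  have hA0 : ∀ {k : ℕ} {f : Fin k → V}, Orthonormal ℝ f → finrank ℝ V ≤ k →
      (∀ i, A (f i) = 0) → A = 0 := fun hf hk hAf => LinearMap.ext fun x =>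
    hf.linearMap_eq_zero (W := ⊤) (fun _ => trivial) (by rwa [finrank_top]) hAf trivial
  have hdim : finrank ℝ V = 2 ∨ finrank ℝ V = 3 ∨ finrank ℝ V = 4 := by omega
  rcases hdim with hm | hm | hm
  · refine h.hasListedBasis_nilpotent_dim4 (by omega) ho hr hξu hξv (hA0 ho hm.le fun i => ?_)
    fin_cases i <;> assumption
  · obtain ⟨d, hdW, hd, hAd⟩ := exists_unit_of_skew_of_finrank_eq_one hA (by omega) hinv
    rw [mem_orthogonal_span_range] at hdW
    have ho3 := orthonormal_triple ho hd (hdW 0) (hdW 1)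
    refine h.hasListedBasis_nilpotent_dim5 (by omega) ho3 hr hξu hξv (hξ d (hdW 1))
      (hA0 ho3 hm.le fun i => ?_)
    fin_cases i <;> assumption
  · obtain ⟨d, hdW, e, heW, κ, hde, hAd, hAe⟩ :=
      exists_rotation_of_skew_of_finrank_eq_two hA (by omega) hinv
    rw [mem_orthogonal_span_range] at hdW heW
    have ho4 := orthonormal_quadruple ho hde (hdW 0) (hdW 1) (heW 0) (heW 1)
    have hξd := hξ d (hdW 1)
    have hξe := hξ e (heW 1)
    by_cases hκ : κ = 0
    · rw [hκ, zero_smul] at hAd hAe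
      rw [neg_zero] at hAe
      refine h.hasListedBasis_nilpotent_dim6 (by omega) ho4 hr hξu hξv hξd hξe
        (hA0 ho4 hm.le fun i => ?_)
      fin_cases i <;> assumption
    · refine (h.rescale hκ).hasListedBasis_nilpotent_rotation (by omega) ho4
        (r := κ⁻¹ * r) (by positivity) ?_ ?_ ?_ ?_ ?_ ?_ ?_ ?_
      · change κ⁻¹ • ξ u = 0
        rw [hξu, smul_zero]
      · change κ⁻¹ • ξ v = (κ⁻¹ * r) • u
        rw [hξv, smul_smul]
      · change κ⁻¹ • ξ d = 0
        rw [hξd, smul_zero]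
      · change κ⁻¹ • ξ e = 0
        rw [hξe, smul_zero]
      · change κ⁻¹ • A u = 0
        rw [hu, smul_zero]
      · change κ⁻¹ • A v = 0
        rw [hv, smul_zero]
      · change κ⁻¹ • A d = e
        rw [hAd, smul_smul, inv_mul_cancel₀ hκ, one_smul]
      · change κ⁻¹ • A e = -d
        rw [hAe, smul_neg, smul_smul, inv_mul_cancel₀ hκ, one_smul]

/-- The case of an abelian quotient. Here `ξ² = 0` and `A` commutes with `ξ`, and the normal forms
of the pair `(A, ξ)` are given by the rank of `ξ`, which is at most two. -/
theorem hasListedBasis_of_abelian (h : IsFlatFrame B 0 A ξ b₀ z w ι)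
    (hg : finrank ℝ g = finrank ℝ V + 2) (hV : finrank ℝ V ≤ 4)
    (hA : ∀ a b, inner ℝ (A a) b = -inner ℝ a (A b))
    (hAξ : ∀ a, A (ξ a) - ξ (A a) = -ξ (ξ a)) (hne : A = 0 → ξ = 0 → b₀ ≠ 0) :
    HasListedBasis B := by
  have hsq : ∀ a, ξ (ξ a) = 0 := by
    have hcomm : (A : Module.End ℝ V) * ξ - ξ * A = -ξ ^ 2 := by
      ext a
      simpa [pow_two] using hAξ a
    intro a
    simpa [pow_two] using LinearMap.congr_fun (sq_eq_zero_of_commutator_eq_neg_sq hA hcomm) a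
  have hcomm : ∀ a, A (ξ a) = ξ (A a) := fun a => by
    rw [← sub_eq_zero, hAξ, hsq, neg_zero]
  by_cases hξ0 : ξ = 0
  · subst hξ0
    by_cases hA0 : A = 0
    · subst hA0
      exact h.hasListedBasis_of_all_eq_zero hg hV (hne rfl rfl)
    -- Rescaling `w` makes one of the rotation angles of `A` equal to one.
    obtain ⟨u, v, θ, hθ, ho, hu, hv⟩ := exists_rotation_of_skew hA hA0
    have h' := h.rescale hθ
    rw [smul_zero] at h'
    refine h'.hasListedBasis_of_ξ_eq_zero hg hV (fun a b => ?_) ho ?_ ?_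
    · simp [inner_smul_left, inner_smul_right, hA]
    · rw [LinearMap.smul_apply, hu, smul_smul, inv_mul_cancel₀ hθ, one_smul]
    · rw [LinearMap.smul_apply, hv, smul_neg, smul_smul, inv_mul_cancel₀ hθ, one_smul]
  set K := LinearMap.ker ξ with hK
  have hKmem : ∀ x, x ∈ K ↔ ξ x = 0 := fun x => LinearMap.mem_ker
  have hrk := LinearMap.finrank_range_add_finrank_ker ξ
  rw [← hK] at hrk
  have hperpK := K.finrank_add_finrank_orthogonal
  -- As `ξ² = 0`, the rank of `ξ` is at most half the dimension of `V`.
  have hle : finrank ℝ (LinearMap.range ξ) ≤ finrank ℝ K := Submodule.finrank_mono (by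
    rintro _ ⟨y, rfl⟩
    exact (hKmem _).2 (hsq y))
  have hAK : ∀ a ∈ K, A a ∈ K := fun a ha => by
    rw [hKmem] at ha ⊢
    rw [← hcomm, ha, map_zero]
  have hAM : ∀ a ∈ Kᗮ, A a ∈ Kᗮ := fun a ha => apply_mem_orthogonal_of_skew hA hAK ha
  have hKM : ∀ x ∈ Kᗮ, ξ x = 0 → x = 0 := fun x hx hξx =>
    inner_self_eq_zero.1 (Submodule.inner_left_of_mem_orthogonal ((hKmem x).2 hξx) hx)
  have hξperp : ∀ y ∈ Kᗮ, ∀ x, inner ℝ y (ξ x) = 0 := fun y hy x =>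
    Submodule.inner_left_of_mem_orthogonal ((hKmem _).2 (hsq x)) hy
  have hM0 : finrank ℝ Kᗮ ≠ 0 := fun h0 => by
    rw [Submodule.finrank_eq_zero, Submodule.orthogonal_eq_bot_iff] at h0
    exact hξ0 (LinearMap.ker_eq_top.1 h0)
  have hM : finrank ℝ Kᗮ = 1 ∨ finrank ℝ Kᗮ = 2 := by omega
  rcases hM with hM | hM
  · obtain ⟨v, hvM, hv, hAv⟩ := exists_unit_of_skew_of_finrank_eq_one hA hM hAM
    have hv0 : v ≠ 0 := fun h0 => by simp [h0] at hv
    have hr : ‖ξ v‖ ≠ 0 := norm_ne_zero_iff.2 fun h0 => hv0 (hKM v hvM h0)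
    have ho1 : Orthonormal ℝ ![v] := by simp [hv, Orthonormal]
    refine h.hasListedBasis_of_rank_one hg hV hA (u := ‖ξ v‖⁻¹ • ξ v) (v := v)
      (orthonormal_pair ?_ hv ?_) hr ?_ ?_ (fun x hx => ?_) ?_ hAv
    · rw [norm_smul, norm_inv, norm_norm, inv_mul_cancel₀ hr]
    · rw [inner_smul_left, real_inner_comm, hξperp v hvM, mul_zero]
    · rw [map_smul, hsq, smul_zero]
    · rw [smul_smul, mul_inv_cancel₀ hr, one_smul]
    · obtain ⟨k, hk, y, hy, rfl⟩ := K.exists_add_mem_mem_orthogonal x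
      rw [inner_add_right, Submodule.inner_left_of_mem_orthogonal hk hvM, zero_add] at hx
      have : y = 0 := ho1.eq_zero_of_inner_eq_zero (W := Kᗮ) (fun i => by fin_cases i; exact hvM)
        hM.le hy fun i => by fin_cases i; exact hx
      rw [this, add_zero, (hKmem k).1 hk]
    · rw [map_smul, hcomm, hAv, map_zero, smul_zero]
  · obtain ⟨w₁, hw1, w₂, hw2, θ, ho, hA1, hA2⟩ :=
      exists_rotation_of_skew_of_finrank_eq_two hA hM hAM
    have hV4 : finrank ℝ V = 4 := by omega
    have hw10 : w₁ ≠ 0 := fun h0 => by simpa [h0] using ho.1 0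
    have hperp : ∀ x, inner ℝ w₁ (ξ x) = 0 ∧ inner ℝ w₂ (ξ x) = 0 := fun x =>
      ⟨hξperp _ hw1 x, hξperp _ hw2 x⟩
    by_cases hθ : θ = 0
    · rw [hθ, zero_smul] at hA1 hA2
      rw [neg_zero] at hA2
      have hAM0 : ∀ x ∈ Kᗮ, A x = 0 := fun x hx =>
        ho.linearMap_eq_zero (W := Kᗮ) (fun i => by fin_cases i <;> assumption) hM.le
          (fun i => by fin_cases i <;> assumption) hx
      have hrange : LinearMap.range ξ = K := by
        apply Submodule.eq_of_le_of_finrank_eq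
        · rintro _ ⟨y, rfl⟩
          exact (hKmem _).2 (hsq y)
        · omega
      -- `A` vanishes on `Kᗮ`, hence on `ξ Kᗮ = ξ V = K`.
      have hA0 : A = 0 := by
        ext x
        obtain ⟨k, hk, y, hy, rfl⟩ := K.exists_add_mem_mem_orthogonal x
        rw [map_add, hAM0 y hy, add_zero, LinearMap.zero_apply]
        rw [← hrange] at hk
        obtain ⟨x, rfl⟩ := hk
        obtain ⟨k, hk, y, hy, rfl⟩ := K.exists_add_mem_mem_orthogonal x
        rw [hcomm, map_add, hAM0 y hy, add_zero]
        exact (hKmem _).1 (hAK k hk)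
      refine h.hasListedBasis_rank_two (by omega) ho (p₁ := ξ w₁) (p₂ := ξ w₂) ?_ (hperp _).1
        (hperp _).1 (hperp _).2 (hperp _).2 hA0 rfl rfl (hsq _) (hsq _)
      have hli := ho.linearIndependent
      rw [LinearIndependent.pair_iff] at hli ⊢
      intro s t hst
      refine hli s t (hKM _ (Submodule.add_mem _ (Submodule.smul_mem _ _ hw1)
        (Submodule.smul_mem _ _ hw2)) ?_)
      rw [map_add, map_smul, map_smul, hst]
    · refine (h.rescale hθ).hasListedBasis_of_rank_two_of_rotation (by omega) (fun a b => ?_)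
        (fun a => ?_) (fun a => ?_) ho ?_ ?_ (fun x => ?_) ?_
      · simp [inner_smul_left, inner_smul_right, hA]
      · simp [hcomm]
      · simp [hsq]
      · rw [LinearMap.smul_apply, hA1, smul_smul, inv_mul_cancel₀ hθ, one_smul]
      · rw [LinearMap.smul_apply, hA2, smul_neg, smul_smul, inv_mul_cancel₀ hθ, one_smul]
      · simp [inner_smul_right, hperp]
      · rw [LinearMap.smul_apply]
        exact smul_ne_zero (inv_ne_zero hθ) fun h0 => hw10 (hKM _ hw1 h0)

end IsFlatFrame
end

/-! ### Classification for nonabelian quotient -/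

section

set_option linter.unusedSimpArgs false

variable {g : Type*} [LieRing g] [LieAlgebra ℝ g] {B : LinearMap.BilinForm ℝ g}
variable {V : Type*} [NormedAddCommGroup V] [InnerProductSpace ℝ V]
  {P : V →ₗ[ℝ] V →ₗ[ℝ] V} {A ξ : V →ₗ[ℝ] V} {b₀ : V} {z w : g} {ι : V →ₗ[ℝ] g}

namespace IsFlatFrame

/-- If the remaining parameters vanish, then `w + ι a` commutes with everything for a suitable
`a` in the span of `s`, `e`, `f`. -/
theorem exists_central_of_nonabelian (h : IsFlatFrame B P A ξ b₀ z w ι) {s e f : V} {r θ w₁ w₂ : ℝ}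
    (ho : Orthonormal ℝ ![s, e, f]) (hr : r ≠ 0)
    (hP : ∀ a b, P a b = (r * inner ℝ s a) • (inner ℝ e b • f - (inner ℝ f b : ℝ) • e))
    (hAs : A s = 0) (hAe : A e = θ • f) (hAf : A f = -(θ • e))
    (hξs : ξ s = w₁ • e + w₂ • f) (hξe : ξ e = 0) (hξf : ξ f = 0)
    (hbs : inner ℝ b₀ s = 0) (hbe : inner ℝ b₀ e = θ / r * w₁) (hbf : inner ℝ b₀ f = θ / r * w₂) :
    ∃ a, ⁅ι a, w⁆ = 0 ∧ ⁅w + ι a, ι s⁆ = 0 ∧ ⁅w + ι a, ι e⁆ = 0 ∧ ⁅w + ι a, ι f⁆ = 0 ∧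
      ∀ t, inner ℝ s t = 0 → inner ℝ e t = 0 → inner ℝ f t = 0 → A t = 0 → ξ t = 0 →
        inner ℝ b₀ t = 0 → ⁅w + ι a, ι t⁆ = 0 := by
  have hin := orthonormal_iff_ite.1 ho
  have hs1 : ‖s‖ = 1 := ho.1 0
  have he1 : ‖e‖ = 1 := ho.1 1
  have hf1 : ‖f‖ = 1 := ho.1 2
  have hse : inner ℝ s e = (0 : ℝ) := hin 0 1
  have hsf : inner ℝ s f = (0 : ℝ) := hin 0 2
  have hes : inner ℝ e s = (0 : ℝ) := hin 1 0
  have hef : inner ℝ e f = (0 : ℝ) := hin 1 2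
  have hfs : inner ℝ f s = (0 : ℝ) := hin 2 0
  have hfe : inner ℝ f e = (0 : ℝ) := hin 2 1
  refine ⟨-(θ / r) • s - (w₂ / r) • e + (w₁ / r) • f, ?_, ?_, ?_, ?_,
    fun t hst het hft hAt hξt hbt => ?_⟩
  · simp [h.lie_w', hAs, hAe, hAf, hξs, hξe, hξf, hbs, hbe, hbf, inner_add_right, inner_sub_right,
      inner_smul_right]
    match_scalars <;> field_simp <;> ring
  · simp [h.lie_w, h.lie_ι, hP, hAs, hAe, hAf, hξs, hξe, hξf, hbs, inner_add_right, inner_sub_right,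
      inner_smul_right, hs1, he1, hf1, hse, hsf, hes, hef, hfs, hfe]
    match_scalars <;> field_simp <;> ring
  · simp [h.lie_w, h.lie_ι, hP, hAs, hAe, hAf, hξs, hξe, hξf, hbe, inner_add_right, inner_sub_right,
      inner_smul_right, hs1, he1, hf1, hse, hsf, hes, hef, hfs, hfe]
    match_scalars <;> field_simp <;> ring
  · simp [h.lie_w, h.lie_ι, hP, hAs, hAe, hAf, hξs, hξe, hξf, hbf, inner_add_right, inner_sub_right,
      inner_smul_right, hs1, he1, hf1, hse, hsf, hes, hef, hfs, hfe]
    match_scalars <;> field_simp <;> ring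
  · have hte : inner ℝ t e = (0 : ℝ) := by rw [real_inner_comm, het]
    have htf : inner ℝ t f = (0 : ℝ) := by rw [real_inner_comm, hft]
    simp [h.lie_w, h.lie_ι, hP, hAt, hξt, hbt, hξs, hξe, hξf, inner_add_right,
      inner_smul_right, hst, het, hft, hte, htf]

variable [FiniteDimensional ℝ V] [FiniteDimensional ℝ g]

/-- The case of a nonabelian quotient. The operator `A` commutes with the rotations `P a`, and the
cocycle conditions leave only `ξ s` and the component of `b₀` orthogonal to the rotated plane. -/
theorem hasListedBasis_of_nonabelian (h : IsFlatFrame B P A ξ b₀ z w ι)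
    (hg : finrank ℝ g = finrank ℝ V + 2) (hV : finrank ℝ V ≤ 4)
    (hA : ∀ a b, inner ℝ (A a) b = -inner ℝ a (A b))
    (hcoc : ∀ a b, ξ (P a b - P b a) = P a (ξ b) - P b (ξ a))
    (hder : ∀ a b, P (A a - ξ a) b = A (P a b) - P a (A b))
    (hAξ : ∀ a, A (ξ a) - ξ (A a) = P a b₀ - ξ (ξ a))
    (hcent : ∀ a, ⁅ι a, w⁆ = 0 → ¬ ∀ b, ⁅w + ι a, ι b⁆ = 0)
    {s e f : V} {r : ℝ} (hr : r ≠ 0) (ho : Orthonormal ℝ ![s, e, f])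
    (hP : ∀ a b, P a b = (r * inner ℝ s a) • (inner ℝ e b • f - (inner ℝ f b : ℝ) • e)) :
    HasListedBasis B := by
  have hin := orthonormal_iff_ite.1 ho
  have hss : inner ℝ s s = (1 : ℝ) := hin 0 0
  have hee : inner ℝ e e = (1 : ℝ) := hin 1 1
  have hff : inner ℝ f f = (1 : ℝ) := hin 2 2
  have hse : inner ℝ s e = (0 : ℝ) := hin 0 1
  have hsf : inner ℝ s f = (0 : ℝ) := hin 0 2
  have hes : inner ℝ e s = (0 : ℝ) := hin 1 0
  have hef : inner ℝ e f = (0 : ℝ) := hin 1 2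
  have hfs : inner ℝ f s = (0 : ℝ) := hin 2 0
  have hfe : inner ℝ f e = (0 : ℝ) := hin 2 1
  have hPs : ∀ b, P s b = r • (inner ℝ e b • f - (inner ℝ f b : ℝ) • e) := fun b => by
    rw [hP, hss, mul_one]
  have hPe : ∀ b, P e b = 0 := fun b => by rw [hP, hse, mul_zero, zero_smul]
  have hPf : ∀ b, P f b = 0 := fun b => by rw [hP, hsf, mul_zero, zero_smul]
  have hPse : P s e = r • f := by rw [hPs, hee, hfe]; module
  have hPsf : P s f = -(r • e) := by rw [hPs, hef, hff]; module
  have haa := inner_self_of_skew hA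
  obtain ⟨θ, hθ⟩ : ∃ θ : ℝ, inner ℝ f (A e) = θ := ⟨_, rfl⟩
  have hθ' : inner ℝ e (A f) = -θ := by rw [← hθ, ← neg_inj, ← hA, real_inner_comm, neg_neg]
  -- The derivation rule says `P (A a - ξ a) = [A, P a]`. For `a = s` its left side is a multiple of
  -- the rotation `P s`, and a commutator with `P s` has no component along `P s`.
  have hc : r * inner ℝ s (A s - ξ s) = 0 := by
    have := congrArg (inner ℝ f) (hder s e)
    rw [hP, hPse, map_smul, hPs] at this
    simp only [inner_smul_right, inner_sub_right, hff, hfe, hee, haa] at this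
    rw [inner_sub_right, haa]
    linarith
  have hAf : A f = -(θ • e) := by
    have := hder s e
    rw [hP, hc, zero_smul, hPse, map_smul, hPs, haa, hθ, ← smul_sub] at this
    have h1 := (smul_eq_zero.1 this.symm).resolve_left hr
    rw [sub_eq_zero.1 h1]
    module
  have hAe : A e = θ • f := by
    have := hder s f
    rw [hP, hc, zero_smul, hPsf, map_neg, map_smul, hPs, haa, hθ', ← smul_neg, ← smul_sub] at this
    have h1 := (smul_eq_zero.1 this.symm).resolve_left hr
    rw [sub_eq_zero, neg_eq_iff_eq_neg] at h1
    rw [h1]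
    module
  have hsA : ∀ a, inner ℝ s (ξ a) = (inner ℝ s (A a) : ℝ) := fun a => by
    have := congrArg (inner ℝ f) (hder a e)
    rw [hP, hP, hP, hAe] at this
    simp only [hee, hfe, map_smul, map_sub, hAf, inner_smul_right, inner_sub_right, hff,
      hef] at this
    simp [inner_smul_right, hfe, hr] at this
    linarith
  -- The cocycle condition makes `ξ` commute with the rotation, so that on its plane `ξ` is complex
  -- multiplication by a number, with coordinates `p` and `q`. Its square vanishes.
  have hξf : ξ f = inner ℝ e (ξ e) • f - (inner ℝ f (ξ e) : ℝ) • e := by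
    have := hcoc s e
    rw [hPse, hPe, hPe, hPs, sub_zero, sub_zero, map_smul] at this
    exact smul_right_injective V hr this
  have hξe : ξ e = (inner ℝ f (ξ f) : ℝ) • e - (inner ℝ e (ξ f) : ℝ) • f := by
    have := hcoc s f
    rw [hPsf, hPf, hPf, hPs, sub_zero, sub_zero, map_neg, map_smul, ← smul_neg] at this
    have h1 := smul_right_injective V hr this
    rw [← neg_inj]
    refine h1.trans ?_
    module
  obtain ⟨p, hp⟩ : ∃ p : ℝ, inner ℝ f (ξ f) = p := ⟨_, rfl⟩
  obtain ⟨q, hq⟩ : ∃ q : ℝ, inner ℝ e (ξ f) = -q := ⟨-inner ℝ e (ξ f), (neg_neg _).symm⟩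
  rw [hp, hq] at hξe
  have hp' : inner ℝ e (ξ e) = p := by
    rw [hξe, inner_sub_right, inner_smul_right, inner_smul_right, hee, hef]
    ring
  have hq' : inner ℝ f (ξ e) = q := by
    rw [hξe, inner_sub_right, inner_smul_right, inner_smul_right, hfe, hff]
    ring
  rw [hp', hq'] at hξf
  have hξξe : ξ (ξ e) = 0 := by
    have := hAξ e
    rw [hPe, zero_sub, eq_neg_iff_add_eq_zero, hAe, map_smul, hξf] at this
    rw [← this]
    nth_rewrite 2 [hξe]
    rw [map_sub, map_smul, map_smul, hAe, hAf]
    module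
  have hξξe' : ξ (ξ e) = (p * p - q * q) • e + (2 * p * q) • f := by
    nth_rewrite 1 [hξe]
    rw [map_sub, map_smul, map_smul, hξf, hξe]
    module
  have h1 : p * p - q * q = 0 := by
    have := congrArg (inner ℝ e) (hξξe.symm.trans hξξe')
    rw [inner_zero_right, inner_add_right, inner_smul_right, inner_smul_right, hee, hef] at this
    linarith
  have h2 : 2 * p * q = 0 := by
    have := congrArg (inner ℝ f) (hξξe.symm.trans hξξe')
    rw [inner_zero_right, inner_add_right, inner_smul_right, inner_smul_right, hfe, hff] at this
    linarith
  have hp0 : p = 0 := by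
    by_contra hne
    have : q = 0 := by simpa [hne] using h2
    rw [this] at h1
    simp [hne] at h1
  have hq0 : q = 0 := by
    rw [hp0] at h1
    simpa using h1
  rw [hp0, hq0, neg_zero, zero_smul, zero_smul, sub_zero] at hξe
  rw [hp0, hq0, zero_smul, zero_smul, sub_zero] at hξf
  have hAse : inner ℝ e (A s) = (0 : ℝ) := by
    rw [← neg_inj, ← hA, hAe, inner_smul_left, hfs, mul_zero, neg_zero]
  have hAsf : inner ℝ f (A s) = (0 : ℝ) := by
    rw [← neg_inj, ← hA, hAf, inner_neg_left, inner_smul_left, hes, mul_zero, neg_zero]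
  have hξss : inner ℝ s (ξ s) = (0 : ℝ) := by rw [hsA, haa]
  have hAξs : A s = 0 → ξ (ξ s) = 0 → A (ξ s) =
      r • (inner ℝ e b₀ • f - (inner ℝ f b₀ : ℝ) • e) := fun hs0 hξ0 => by
    have := hAξ s
    rwa [hs0, hξ0, map_zero, sub_zero, sub_zero, hPs] at this
  -- The components of `b₀` in the plane are determined by those of `ξ s`.
  obtain ⟨w₁, hw1⟩ : ∃ w₁ : ℝ, inner ℝ e (ξ s) = w₁ := ⟨_, rfl⟩
  obtain ⟨w₂, hw2⟩ : ∃ w₂ : ℝ, inner ℝ f (ξ s) = w₂ := ⟨_, rfl⟩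
  have hb : A s = 0 → ξ (ξ s) = 0 →
      inner ℝ b₀ e = θ / r * w₁ ∧ inner ℝ b₀ f = θ / r * w₂ := fun hs0 hξ0 => by
    have hf' := congrArg (inner ℝ f) (hAξs hs0 hξ0)
    have he' := congrArg (inner ℝ e) (hAξs hs0 hξ0)
    rw [← neg_inj, ← hA, hAf, inner_neg_left, inner_smul_left, hw1, inner_smul_right,
      inner_sub_right, inner_smul_right, inner_smul_right, hff, hfe, conj_trivial] at hf'
    rw [← neg_inj, ← hA, hAe, inner_smul_left, hw2, inner_smul_right,
      inner_sub_right, inner_smul_right, inner_smul_right, hef, hee, conj_trivial] at he'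
    constructor
    · rw [real_inner_comm]
      field_simp
      linarith
    · rw [real_inner_comm]
      field_simp
      linarith
  have hf := ho.finrank_orthogonal
  have hdim : finrank ℝ V = 3 ∨ finrank ℝ V = 4 := by omega
  rcases hdim with hm | hm
  · have hAs : A s = 0 := ho.ext_inner hm.le fun i => by
      rw [inner_zero_right]
      fin_cases i
      · exact haa s
      · exact hAse
      · exact hAsf
    have hξs : ξ s = w₁ • e + w₂ • f := ho.ext_inner hm.le fun i => by
      rw [inner_add_right, inner_smul_right, inner_smul_right]
      fin_cases i
      · change inner ℝ s (ξ s) = w₁ * inner ℝ s e + w₂ * inner ℝ s f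
        rw [hξss, hse, hsf]
        ring
      · change inner ℝ e (ξ s) = w₁ * inner ℝ e e + w₂ * inner ℝ e f
        rw [hw1, hee, hef]
        ring
      · change inner ℝ f (ξ s) = w₁ * inner ℝ f e + w₂ * inner ℝ f f
        rw [hw2, hfe, hff]
        ring
    have hξξs : ξ (ξ s) = 0 := by
      rw [hξs, map_add, map_smul, map_smul, hξe, hξf, smul_zero, smul_zero, add_zero]
    obtain ⟨hbe, hbf⟩ := hb hAs hξξs
    refine h.hasListedBasis_nonabelian_dim5 (by omega) ho hr (fun hβ => ?_) hP hAs hAe hAf hξs hξe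
      hξf
      rfl hbe hbf
    obtain ⟨a, ha, has, hae, haf, -⟩ := h.exists_central_of_nonabelian ho hr hP hAs hAe hAf hξs hξe
      hξf hβ hbe hbf
    refine hcent a ha fun b => ?_
    exact ho.linearMap_eq_zero (W := ⊤) (fun _ => trivial) (by rw [finrank_top, hm])
      (A := (LieAlgebra.ad ℝ g (w + ι a) : g →ₗ[ℝ] g) ∘ₗ ι)
      (fun i => by fin_cases i <;> assumption) trivial
  · obtain ⟨t, -, ht, hot⟩ := exists_unit_orthogonal (⊤ : Submodule ℝ V) ![s, e, f]
      (by rw [finrank_top]; omega)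
    have hst : inner ℝ s t = (0 : ℝ) := hot 0
    have het : inner ℝ e t = (0 : ℝ) := hot 1
    have hft : inner ℝ f t = (0 : ℝ) := hot 2
    have hts : inner ℝ t s = (0 : ℝ) := by rw [real_inner_comm, hst]
    have hte : inner ℝ t e = (0 : ℝ) := by rw [real_inner_comm, het]
    have htf : inner ℝ t f = (0 : ℝ) := by rw [real_inner_comm, hft]
    have htt : inner ℝ t t = (1 : ℝ) := by rw [real_inner_self_eq_norm_sq, ht, one_pow]
    have hPt : ∀ b, P t b = 0 := fun b => by rw [hP, hst, mul_zero, zero_smul]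
    have hPst : P s t = 0 := by rw [hPs, het, hft]; module
    have ho4 : Orthonormal ℝ ![s, e, f, t] := by
      have h1 : Orthonormal ℝ ![s, e] := orthonormal_pair (ho.1 0) (ho.1 1) hse
      exact orthonormal_quadruple h1 (orthonormal_pair (ho.1 2) ht hft) hsf hef hst het
    have hext : ∀ {x y : V}, inner ℝ s x = (inner ℝ s y : ℝ) → inner ℝ e x = (inner ℝ e y : ℝ) →
        inner ℝ f x = (inner ℝ f y : ℝ) → inner ℝ t x = (inner ℝ t y : ℝ) → x = y :=
      fun {x y} h1 h2 h3 h4 => ho4.ext_inner hm.le fun i => by fin_cases i <;> assumption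
    -- The remaining entries of `A` and `ξ` on the plane of `s` and `t` are `x`, `y` and `q`; the
    -- relation for `[A, ξ]` at `t` forces `x = y = 0`.
    obtain ⟨x, hx⟩ : ∃ x : ℝ, inner ℝ s (A t) = x := ⟨_, rfl⟩
    obtain ⟨y, hy⟩ : ∃ y : ℝ, inner ℝ t (ξ t) = y := ⟨_, rfl⟩
    obtain ⟨q, hq⟩ : ∃ q : ℝ, inner ℝ t (ξ s) = q := ⟨_, rfl⟩
    have hx' : inner ℝ t (A s) = -x := by rw [← hx, ← neg_inj, ← hA, real_inner_comm, neg_neg]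
    have hJ : inner ℝ e (ξ t) • f - (inner ℝ f (ξ t) : ℝ) • e = 0 := by
      have := hcoc s t
      rw [hPst, hPt, hPt, hPs, sub_zero, sub_zero, map_zero] at this
      exact (smul_eq_zero.1 this.symm).resolve_left hr
    have hξte : inner ℝ e (ξ t) = (0 : ℝ) := by
      have := congrArg (inner ℝ f) hJ
      rw [inner_sub_right, inner_smul_right, inner_smul_right, hff, hfe, inner_zero_right] at this
      linarith
    have hξtf : inner ℝ f (ξ t) = (0 : ℝ) := by
      have := congrArg (inner ℝ e) hJ
      rw [inner_sub_right, inner_smul_right, inner_smul_right, hef, hee, inner_zero_right] at this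
      linarith
    have hAt : A t = x • s := by
      apply hext <;> rw [inner_smul_right]
      · rw [hx, hss, mul_one]
      · rw [hes, ← neg_inj, ← hA, hAe, inner_smul_left, hft]
        ring
      · rw [hfs, ← neg_inj, ← hA, hAf, inner_neg_left, inner_smul_left, het]
        ring
      · rw [haa, hts, mul_zero]
    have hAs : A s = -(x • t) := by
      apply hext <;> rw [inner_neg_right, inner_smul_right]
      · rw [haa, hst]
        ring
      · rw [hAse, het]
        ring
      · rw [hAsf, hft]
        ring
      · rw [hx', htt, mul_one]
    have hξt : ξ t = x • s + y • t := by
      apply hext <;> rw [inner_add_right, inner_smul_right, inner_smul_right]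
      · rw [hsA, hx, hss, hst]
        ring
      · rw [hξte, hes, het]
        ring
      · rw [hξtf, hfs, hft]
        ring
      · rw [hy, hts, htt]
        ring
    have hrel : (2 * x * y) • s = (x * x - y * y) • t := by
      have := hAξ t
      rw [hPt, hAt, hξt, map_add, map_add, map_smul, map_smul, map_smul, map_smul, hAs, hAt,
        hξt, ← sub_eq_zero] at this
      rw [← sub_eq_zero, ← this]
      module
    have hxy : 2 * x * y = 0 := by
      have := congrArg (inner ℝ s) hrel
      rw [inner_smul_right, inner_smul_right, hss, hst] at this
      linarith
    have hxx : x * x - y * y = 0 := by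
      have := congrArg (inner ℝ t) hrel
      rw [inner_smul_right, inner_smul_right, hts, htt] at this
      linarith
    have hx0 : x = 0 := by
      by_contra hne
      have : y = 0 := by simpa [hne] using hxy
      rw [this] at hxx
      simp [hne] at hxx
    have hy0 : y = 0 := by
      rw [hx0] at hxx
      simpa using hxx
    rw [hx0, zero_smul] at hAt hAs
    rw [neg_zero] at hAs
    rw [hx0, hy0, zero_smul, zero_smul, add_zero] at hξt
    have hξs : ξ s = q • t + w₁ • e + w₂ • f := by
      apply hext <;> rw [inner_add_right, inner_add_right, inner_smul_right, inner_smul_right,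
        inner_smul_right]
      · rw [hξss, hst, hse, hsf]
        ring
      · rw [hw1, het, hee, hef]
        ring
      · rw [hw2, hft, hfe, hff]
        ring
      · rw [hq, htt, hte, htf]
        ring
    have hξξs : ξ (ξ s) = 0 := by
      rw [hξs, map_add, map_add, map_smul, map_smul, map_smul, hξt, hξe, hξf]
      simp
    obtain ⟨hbe, hbf⟩ := hb hAs hξξs
    refine h.hasListedBasis_nonabelian_dim6 (by omega) ho4 hr (fun hβ => ?_) hP hAs hAe hAf hAt hξs
      hξe hξf hξt rfl hbe hbf rfl
    obtain ⟨hq0, hbs, hbt⟩ := hβ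
    rw [hq0, zero_smul, zero_add] at hξs
    obtain ⟨a, ha, has, hae, haf, hat⟩ := h.exists_central_of_nonabelian ho hr hP hAs hAe hAf hξs
      hξe hξf hbs hbe hbf
    have hat := hat t hst het hft hAt hξt hbt
    refine hcent a ha fun b => ?_
    exact ho4.linearMap_eq_zero (W := ⊤) (fun _ => trivial) (by rw [finrank_top, hm])
      (A := (LieAlgebra.ad ℝ g (w + ι a) : g →ₗ[ℝ] g) ∘ₗ ι)
      (fun i => by fin_cases i <;> assumption) trivial

end IsFlatFrame
end

/-! ### The classification -/

/-- The three parts of the splitting of a double extension form a frame. -/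
theorem FlatExtension.isFlatFrame {g : Type*} [LieRing g] [LieAlgebra ℝ g]
    {B : LinearMap.BilinForm ℝ g} {V : Type*} [NormedAddCommGroup V] [InnerProductSpace ℝ V]
    {Φ : (ℝ × ℝ × V) ≃ₗ[ℝ] g} (D : FlatExtension V) (hΦ : IsSplitting B Φ)
    (hbr : ∀ p q, ⁅Φ p, Φ q⁆ = Φ (D.bracket p q)) :
    IsFlatFrame B D.P D.A D.ξ D.b₀ (Φ (1, 0, 0)) (Φ (0, 1, 0))
      ((Φ : (ℝ × ℝ × V) →ₗ[ℝ] g) ∘ₗ LinearMap.inr ℝ ℝ _ ∘ₗ LinearMap.inr ℝ ℝ V) where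
  symm u v := by
    obtain ⟨p, rfl⟩ := Φ.surjective u
    obtain ⟨q, rfl⟩ := Φ.surjective v
    rw [hΦ, hΦ, real_inner_comm]
    ring
  lie_z u := by
    obtain ⟨p, rfl⟩ := Φ.surjective u
    simp [hbr, FlatExtension.bracket]
  lie_w a := by
    simp [hbr, FlatExtension.bracket, ← map_smul, ← map_sub, -map_neg]
  lie_ι a b := by
    simp [hbr, FlatExtension.bracket, ← map_smul, ← map_add]
  apply_z_z := by simp [hΦ _ _]
  apply_z_w := by simp [hΦ _ _]
  apply_w_w := by simp [hΦ _ _]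
  apply_z_ι a := by simp [hΦ _ _]
  apply_w_ι a := by simp [hΦ _ _]
  apply_ι_ι a b := by simp [hΦ _ _]

/-- A double extension is listed if its center is orthogonal to the null direction `z`. This
excludes the abelian Lie algebra when `P = 0`, and is the nonvanishing condition on the parameters
when `P ≠ 0`. -/
theorem FlatExtension.hasListedBasis {g : Type*} [LieRing g] [LieAlgebra ℝ g]
    [FiniteDimensional ℝ g] {B : LinearMap.BilinForm ℝ g} {m : ℕ}
    {Φ : (ℝ × ℝ × EuclideanSpace ℝ (Fin m)) ≃ₗ[ℝ] g} (D : FlatExtension (EuclideanSpace ℝ (Fin m)))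
    (hΦ : IsSplitting B Φ) (hbr : ∀ p q, ⁅Φ p, Φ q⁆ = Φ (D.bracket p q))
    (hcent : ∀ p, (∀ q, D.bracket p q = 0) → p.2.1 = 0) (hm : m ≤ 4) : HasListedBasis B := by
  have h := D.isFlatFrame hΦ hbr
  have hV : finrank ℝ (EuclideanSpace ℝ (Fin m)) = m := finrank_euclideanSpace_fin
  have hg : finrank ℝ g = finrank ℝ (EuclideanSpace ℝ (Fin m)) + 2 := by
    rw [hV, IsSplitting.finrank_eq (Φ := Φ)]
  have hflat : IsFlatEuclidean D.P := ⟨D.P_skew, D.P_flat⟩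
  rcases hflat.eq_zero_or_exists (by rwa [hV]) with hP | ⟨s, e, f, r, hr, ho, hP⟩
  · rw [hP] at h
    refine h.hasListedBasis_of_abelian hg (by rwa [hV]) D.A_skew (fun a => ?_)
      fun hA hξ hb => ?_
    · simpa [hP] using D.A_ξ a
    · refine one_ne_zero (hcent (0, 1, 0) fun q => ?_)
      simp [FlatExtension.bracket, hA, hξ, hb, hP]
  · refine h.hasListedBasis_of_nonabelian hg (by rwa [hV]) D.A_skew D.ξ_cocycle D.P_derivation D.A_ξ
      (fun a haw ha => ?_) hr ho hP
    refine one_ne_zero (hcent (0, 1, a) fun q => Φ.injective ?_)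
    have hsum : ∀ p : ℝ × ℝ × EuclideanSpace ℝ (Fin m), Φ p = p.1 • Φ (1, 0, 0) +
        p.2.1 • Φ (0, 1, 0) + Φ (0, 0, p.2.2) := fun p => by
      rw [← map_smul, ← map_smul, ← map_add, ← map_add]
      simp
    have haq := ha q.2.2
    change ⁅Φ (0, 0, a), Φ (0, 1, 0)⁆ = 0 at haw
    change ⁅Φ (0, 1, 0) + Φ (0, 0, a), Φ (0, 0, q.2.2)⁆ = 0 at haq
    rw [← hbr, map_zero, hsum q, hsum (0, 1, a)]
    simp only [zero_smul, zero_add, one_smul]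
    rw [lie_add, lie_add, haq, lie_smul, lie_smul, h.lie_z', add_lie, lie_self, haw]
    simp

/-- Completeness of the list. -/
theorem IsLorentzian.hasListedBasis {g : Type*} [LieRing g] [LieAlgebra ℝ g]
    [FiniteDimensional ℝ g] {B : LinearMap.BilinForm ℝ g} (hg : finrank ℝ g ≤ 6)
    (hB : IsLorentzian B) (hF : IsFlatMetric B) (hC : HasDegenerateCenter B) :
    HasListedBasis B := by
  obtain ⟨m, Φ, D, hΦ, hbr, hcent⟩ := exists_flatExtension hB hF hC
  have := IsSplitting.finrank_eq (Φ := Φ)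
  exact D.hasListedBasis hΦ hbr hcent (by omega)

theorem mainTheorem5 :
    -- completeness of the list, and every listed metric Lie algebra has the required properties
    (∀ (g : Type*) [LieRing g] [LieAlgebra ℝ g] [FiniteDimensional ℝ g]
        (B : LinearMap.BilinForm ℝ g), Module.finrank ℝ g ≤ 6 →
        ((IsLorentzian B ∧ IsFlatMetric B ∧ HasDegenerateCenter B) ↔
          ∃ (n : ℕ) (E : Entry n), IsListed n E ∧
            ∃ b : Module.Basis (Fin n) ℝ g, E.Realizes B b)) ∧
    -- every entry of the list is realized by a Lie algebra, which has the stated nature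
    (∀ (n : ℕ) (E : Entry n), IsListed n E →
        (∃ (g : Type) (_ : LieRing g) (_ : LieAlgebra ℝ g) (B : LinearMap.BilinForm ℝ g)
            (b : Module.Basis (Fin n) ℝ g), E.Realizes B b) ∧
        ∀ (g : Type*) [LieRing g] [LieAlgebra ℝ g] (B : LinearMap.BilinForm ℝ g)
            (b : Module.Basis (Fin n) ℝ g), E.Realizes B b → E.nature.Holds g) := by
  refine ⟨fun g _ _ _ B hg => ⟨fun ⟨hB, hF, hC⟩ => hB.hasListedBasis hg hF hC,
    fun ⟨n, E, hE, b, hb⟩ => hE.isLorentzian_and_isFlat_and_degenerate hb⟩, fun n E hE => ⟨?_, ?_⟩⟩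
  · obtain ⟨l, hl⟩ := hE.exists_isFlatTable
    exact hl.exists_realizes
  · intro g _ _ B b hb
    exact hb.nature_holds hE.natureTest
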